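/- **Setting.** Let $d\ge 2$, $\rho,r,\nu>0$, $N\ge 1$. Let $\{x_m^\omega\}_m$ be a Poisson point process on $\mathbb R^d$ with intensity $\nu$, $\Lambda_N=(-L_N/2,L_N/2)^d$ with $L_N=\rho^{-1/d}N^{1/d}$, and let $\Lambda_N^\omega=\Lambda_N\setminus\bigcup_m \overline{B_r(x_m^\omega)}$ be the vacancy set. Let $v_N\in (L^1\cap L^\infty)(\mathbb R^d)$ be real-valued, nonnegative and even, with Fourier transform $\widehat v_N(\xi)=(2\pi)^{-d/2}\int e^{-ix\cdot\xi}v_N(x)\,dx$ satisfying $\widehat v_N\ge 0$ and $\widehat v_N\in L^1(\mathbb R^d)$; put $v_N(0)=(2\pi)^{-d/2}\|\widehat v_N\|_1$. Let $\lambda_1^\omega\le\lambda_2^\omega$ be the two lowest eigenvalues, counted with multiplicity, of the Dirichlet Laplacian $-\Delta$ on $\Lambda_N^\omega$. Let $\omega_d$ be the volume of the unit ball of $\mathbb R^d$ and $C_1=2(4\pi)^{-d/4}\mathrm e$. For $0<\eta<\mathrm e^{-\nu\omega_d r^d}$ let $$\Omega_N^{(2),\eta}=\Big\{\omega:\ \Big|\tfrac{|\Lambda_N^\omega|}{|\Lambda_N|}-\mathrm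 e^{-\nu\omega_dr^d}\Big|<\eta,\quad \lambda_2^\omega-\lambda_1^\omega> C_1^2N\|v_N\|_1(\lambda_1^\omega)^{d/2}\Big\}.$$ Let $E_N^\omega$ be the ground-state energy of $H_N^\omega=-\sum_{j=1}^N\Delta_j+\sum_{1\le i<j\le N}v_N(x_i-x_j)$ on the permutation-symmetric functions in $L^2((\Lambda_N^\omega)^N)$ with Dirichlet boundary conditions, i.e. the infimum of its quadratic form over the normalized symmetric functions in $H_0^1((\Lambda_N^\omega)^N)$. **Theorem.** Let $0<\eta<\mathrm e^{-\nu\omega_dr^d}$ and $\omega\in\Omega_N^{(2),\eta}$. There is exactly one connected component $\widetilde\Lambda$ of $\Lambda_N^\omega$ on which a normalized eigenfunction of the Dirichlet Laplacian on $\Lambda_N^\omega$ with eigenvalue $\lambda_1^\omega$ is supported. The Hartree functional $$\mathcal E[\psi]=\int|\nabla\psi|^2\,dx+\frac{N-1}{2}\iint v_N(x-y)|\psi(x)|^2|\psi(y)|^2\,dx\,dy$$ has a minimizer among the $\psi\in H_0^1(\widetilde\Lambda)$ with $\|\psi\|_2=1$. Let $\widetilde u$ be any such minimizer, extended by zero,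 and let $e_N^{1,\widetilde u}\le e_N^{2,\widetilde u}$ be the two lowest eigenvalues, counted with multiplicity, of the operator $$-\Delta+(N-1)(|\widetilde u|^2*v_N)-\frac{N-1}{2}\iint v_N(x-y)|\widetilde u(x)|^2|\widetilde u(y)|^2\,dx\,dy$$ on $L^2(\Lambda_N^\omega)$ with form domain $H_0^1(\Lambda_N^\omega)$. Then $e_N^{1,\widetilde u}=\mathcal E[\widetilde u]$ is the Hartree minimum, $e_N^{2,\widetilde u}-e_N^{1,\widetilde u}>0$, and $$\left|\frac{E_N^\omega}{N}-e_N^{1,\widetilde u}\right|\le\frac{v_N(0)}{2}.$$ Moreover, $H_N^\omega$ has a normalized ground state (an eigenfunction with eigenvalue $E_N^\omega$), and for every normalized ground state $\Psi$, with one-particle density matrix $\varrho^{(1)}(x;y)=\int\Psi(x,x_2,\dots,x_N)\overline{\Psi(y,x_2,\dots,x_N)}\,dx_2\cdots dx_N$ and $n_N^\omega=N\,\mathrm{tr}(\varrho^{(1)}|\widetilde u\rangle\langle\widetilde u|)$, $$1-\frac{n_N^\omega}{N}\le\frac{v_N(0)}{2}\cdot\frac{1}{e_N^{2,\widetilde u}-e_N^{1,\widetilde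 u}}.$$ -/

import Mathlib

open MeasureTheory ProbabilityTheory
open scoped ComplexConjugate

namespace KacLuttinger

noncomputable section

/-- One-particle space `ℝ^d`. -/
abbrev Space (d : ℕ) := EuclideanSpace ℝ (Fin d)

/-- Space `(ℝ^d)^N` of configurations of `N` particles. Only its vector space structure, topology and
Lebesgue (product) measure are used. -/
abbrev Config (N d : ℕ) := Fin N → Space d

/-! ### Dirichlet Sobolev spaces -/

section Sobolev

variable {X : Type*} [NormedAddCommGroup X] [NormedSpace ℝ X] [MeasureSpace X]
  {κ : Type*} [Fintype κ]

/-- Gradient of `φ : X → ℂ` with respect to the coordinate directions `e`. -/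
def grad (e : κ → X) (φ : X → ℂ) (x : X) : EuclideanSpace ℂ κ :=
  WithLp.toLp 2 fun k => fderiv ℝ φ x (e k)

/-- Pairs `(f, g)` of an `L²` function and an `L²` vector field, with the norm
`(‖f‖₂² + ‖g‖₂²)^{1/2}`. An element `f` of a Sobolev space is represented by the pair `(f, ∇f)`, on
which this norm is the `H¹` norm. -/
abbrev GradPair (X : Type*) [MeasureSpace X] (κ : Type*) [Fintype κ] :=
  WithLp 2 (Lp ℂ 2 (volume : Measure X) × Lp (EuclideanSpace ℂ κ) 2 (volume : Measure X))

/-- The pairs `(φ, ∇φ)` with `φ ∈ C_c^∞(U)`. -/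
def testPairs (e : κ → X) (U : Set X) : Submodule ℂ (GradPair X κ) where
  carrier := {p | ∃ φ : X → ℂ, ContDiff ℝ ((⊤ : ℕ∞) : WithTop ℕ∞) φ ∧ HasCompactSupport φ ∧ tsupport φ ⊆ U ∧
    p.fst =ᵐ[volume] φ ∧ p.snd =ᵐ[volume] grad e φ}
  zero_mem' := by
    refine ⟨0, contDiff_const, HasCompactSupport.zero, by simp, ?_, ?_⟩
    · exact Lp.coeFn_zero _ _ _
    · filter_upwards [Lp.coeFn_zero (EuclideanSpace ℂ κ) 2 (volume : Measure X)] with x hx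
      refine hx.trans ?_
      ext k
      simp [grad]
  add_mem' := by
    rintro p q ⟨φ, h1, h2, h3, h4, h5⟩ ⟨χ, k1, k2, k3, k4, k5⟩
    refine ⟨φ + χ, h1.add k1, h2.add k2,
      (tsupport_add φ χ).trans (Set.union_subset h3 k3), ?_, ?_⟩
    · filter_upwards [Lp.coeFn_add p.fst q.fst, h4, k4] with x hx a b
      rw [WithLp.add_fst, hx, Pi.add_apply, a, b, Pi.add_apply]
    · filter_upwards [Lp.coeFn_add p.snd q.snd, h5, k5] with x hx a b
      rw [WithLp.add_snd, hx, Pi.add_apply, a, b]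
      ext k
      have := fderiv_add (x := x) ((h1.differentiable (by simp)) x)
        ((k1.differentiable (by simp)) x)
      simp [grad, this]
  smul_mem' := by
    rintro c p ⟨φ, h1, h2, h3, h4, h5⟩
    refine ⟨c • φ, contDiff_const.smul h1, h2.smul_left (f := fun _ => c),
      (tsupport_smul_subset_right (fun _ => c) φ).trans h3, ?_, ?_⟩
    · filter_upwards [Lp.coeFn_smul c p.fst, h4] with x hx a
      rw [WithLp.smul_fst, hx, Pi.smul_apply, a, Pi.smul_apply]
    · filter_upwards [Lp.coeFn_smul c p.snd, h5] with x hx a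
      rw [WithLp.smul_snd, hx, Pi.smul_apply, a]
      ext k
      have := fderiv_const_smul (x := x) ((h1.differentiable (by simp)) x) c
      simp [grad, this]

/-- `H¹₀(U)`: the closure of `C_c^∞(U)` in the `H¹` norm. Elements are represented by `(f, ∇f)` with
`f` and `∇f` extended by zero to the whole space. -/
def H10 (e : κ → X) (U : Set X) : Submodule ℂ (GradPair X κ) :=
  (testPairs e U).topologicalClosure

/-- The sesquilinear form `⟨f, (-Δ + W) g⟩ = ∫ ∇f̄ · ∇g + ∫ W f̄ g`. -/
def schrodingerForm (W : X → ℝ) (f g : GradPair X κ) : ℂ :=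
  inner ℂ f.snd g.snd + ∫ x, (W x : ℂ) * (conj (f.fst x) * g.fst x)

/-- `f` is an eigenfunction, with eigenvalue `μ`, of the self-adjoint operator `-Δ + W` with form
domain `D`. -/
def IsEigenpair (D : Set (GradPair X κ)) (W : X → ℝ) (f : GradPair X κ) (μ : ℝ) : Prop :=
  f ∈ D ∧ f.fst ≠ 0 ∧ ∀ g ∈ D, schrodingerForm W g f = (μ : ℂ) * inner ℂ g.fst f.fst

/-- The `n`-th lowest eigenvalue (`n = 1, 2, …`), counted with multiplicity, of the operator
`-Δ + W` with form domain `D`: the least `t` such that there are `n` linearly independent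
eigenfunctions with eigenvalues at most `t`. -/
def eigenvalue (D : Set (GradPair X κ)) (W : X → ℝ) (n : ℕ) : ℝ :=
  sInf {t : ℝ | ∃ f : Fin n → GradPair X κ, LinearIndependent ℂ (fun i => (f i).fst) ∧
    ∀ i, ∃ μ ≤ t, IsEigenpair D W (f i) μ}

end Sobolev

/-- The standard basis of `ℝ^d`. -/
def dir (d : ℕ) (a : Fin d) : Space d := EuclideanSpace.single a 1

/-- The standard basis of `(ℝ^d)^N`. -/
def configDir (N d : ℕ) (ia : Fin N × Fin d) : Config N d := Pi.single ia.1 (dir d ia.2)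

/-- Representatives of one-particle Sobolev functions. -/
abbrev OneBody (d : ℕ) := GradPair (Space d) (Fin d)

/-- Representatives of `N`-particle Sobolev functions. -/
abbrev ManyBody (N d : ℕ) := GradPair (Config N d) (Fin N × Fin d)

/-- The form domain `H¹₀(U)` of one-particle operators. -/
def oneBodyDomain {d : ℕ} (U : Set (Space d)) : Set (OneBody d) := H10 (dir d) U

/-- `n`-th eigenvalue of the Dirichlet Laplacian `-Δ` on `U`, counted with multiplicity. -/
def dirichletEigenvalue {d : ℕ} (U : Set (Space d)) (n : ℕ) : ℝ :=
  eigenvalue (oneBodyDomain U) 0 n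

/-! ### The random domain -/

/-- `X` is a Poisson point process on `ℝ^d` with constant intensity `ν` under `P`. -/
structure IsPoissonPointProcess {Ω : Type*} [MeasurableSpace Ω] (P : Measure Ω) {d : ℕ} (ν : ℝ)
    (X : Ω → Set (Space d)) : Prop where
  locallyFinite : ∀ ω, ∀ B : Set (Space d), Bornology.IsBounded B → (X ω ∩ B).Finite
  measurable_count : ∀ B : Set (Space d), MeasurableSet B → Bornology.IsBounded B →
    Measurable fun ω => (X ω ∩ B).ncard
  law_count : ∀ B : Set (Space d), MeasurableSet B → Bornology.IsBounded B →
    P.map (fun ω => (X ω ∩ B).ncard) = poissonMeasure (ν.toNNReal * (volume B).toNNReal)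
  indep_count : ∀ (n : ℕ) (B : Fin n → Set (Space d)), (∀ i, MeasurableSet (B i)) →
    (∀ i, Bornology.IsBounded (B i)) → Pairwise (fun i j => Disjoint (B i) (B j)) →
    iIndepFun (fun i ω => (X ω ∩ B i).ncard) P

/-- The box `(-L/2, L/2)^d` with `L = ρ^{-1/d} N^{1/d}`. -/
def box (d : ℕ) (ρ : ℝ) (N : ℕ) : Set (Space d) :=
  {x | ∀ a, |x a| < ρ ^ (-(1 / (d : ℝ))) * (N : ℝ) ^ (1 / (d : ℝ)) / 2}

/-- The vacancy set: the box without the closed balls of radius `r` around the points of `S`. -/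
def vacancySet {d : ℕ} (ρ r : ℝ) (N : ℕ) (S : Set (Space d)) : Set (Space d) :=
  box d ρ N \ ⋃ p ∈ S, Metric.closedBall p r

/-- The number `exp(-ν ω_d r^d)`, `ω_d` being the volume of the unit ball of `ℝ^d`. -/
def vacancyFraction (d : ℕ) (ν r : ℝ) : ℝ :=
  Real.exp (-(ν * (volume (Metric.ball (0 : Space d) 1)).toReal * r ^ d))

/-- The event that the volume fraction of the vacancy set is `η`-close to `exp(-ν ω_d r^d)`. -/
def Omega1 {Ω : Type*} {d : ℕ} (X : Ω → Set (Space d)) (ρ r ν η : ℝ) (N : ℕ) : Set Ω :=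
  {ω | |(volume (vacancySet ρ r N (X ω))).toReal / (volume (box d ρ N)).toReal
    - vacancyFraction d ν r| < η}

/-- The constant `C₁ = 2 (4π)^{-d/4} e`. -/
def C1 (d : ℕ) : ℝ := 2 * (4 * Real.pi) ^ (-((d : ℝ) / 4)) * Real.exp 1

/-- The event, inside `Omega1`, that the spectral gap of the Dirichlet Laplacian on the vacancy set is
larger than `C₁² N ‖v‖₁ λ₁^{d/2}`, `λ₁` being its lowest eigenvalue. -/
def Omega2 {Ω : Type*} {d : ℕ} (X : Ω → Set (Space d)) (ρ r ν η : ℝ) (N : ℕ)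
    (v : Space d → ℝ) : Set Ω :=
  {ω | ω ∈ Omega1 X ρ r ν η N ∧
    dirichletEigenvalue (vacancySet ρ r N (X ω)) 2 - dirichletEigenvalue (vacancySet ρ r N (X ω)) 1
      > C1 d ^ 2 * N * (∫ x, |v x|)
        * dirichletEigenvalue (vacancySet ρ r N (X ω)) 1 ^ ((d : ℝ) / 2)}

/-! ### The interaction -/

/-- Fourier transform `(2π)^{-d/2} ∫ e^{-i x·ξ} v(x) dx`. -/
def fourier {d : ℕ} (v : Space d → ℝ) (ξ : Space d) : ℂ :=
  (((2 * Real.pi) ^ (-((d : ℝ) / 2)) : ℝ) : ℂ) *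
    ∫ x, Complex.exp (-Complex.I * (inner ℝ x ξ : ℝ)) * (v x : ℂ)

/-- The standing assumptions on the pair interaction. -/
structure IsAdmissibleInteraction {d : ℕ} (v : Space d → ℝ) : Prop where
  memLp_one : MemLp v 1 volume
  memLp_top : MemLp v ⊤ volume
  nonneg : ∀ᵐ x, 0 ≤ v x
  even : ∀ᵐ x, v (-x) = v x
  fourier_nonneg : ∀ ξ, 0 ≤ (fourier v ξ).re ∧ (fourier v ξ).im = 0
  fourier_integrable : Integrable (fourier v) volume

/-- The value `(2π)^{-d/2} ‖v̂‖₁` at `0` of the continuous representative of `v`. -/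
def valueAtZero {d : ℕ} (v : Space d → ℝ) : ℝ :=
  (2 * Real.pi) ^ (-((d : ℝ) / 2)) * ∫ ξ, ‖fourier v ξ‖

/-! ### Hartree functional and mean-field operator -/

/-- `∫∫ v(x-y) |u(x)|² |u(y)|² dx dy`. -/
def selfInteraction {d : ℕ} (v : Space d → ℝ) (u : OneBody d) : ℝ :=
  ∫ x, ∫ y, v (x - y) * ‖u.fst x‖ ^ 2 * ‖u.fst y‖ ^ 2

/-- The Hartree functional `∫ |∇u|² + (N-1)/2 ∫∫ v(x-y) |u(x)|² |u(y)|² dx dy`. -/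
def hartree {d : ℕ} (N : ℕ) (v : Space d → ℝ) (u : OneBody d) : ℝ :=
  ‖u.snd‖ ^ 2 + ((N : ℝ) - 1) / 2 * selfInteraction v u

/-- `u` is an `L²`-normalized minimizer of the Hartree functional on `H¹₀(K)`. -/
def IsHartreeMinimizer {d : ℕ} (N : ℕ) (v : Space d → ℝ) (K : Set (Space d)) (u : OneBody d) :
    Prop :=
  u ∈ oneBodyDomain K ∧ ‖u.fst‖ = 1 ∧
    ∀ f ∈ oneBodyDomain K, ‖f.fst‖ = 1 → hartree N v u ≤ hartree N v f

/-- The potential `(N-1) (|u|² ∗ v) - (N-1)/2 ∫∫ v(x-y) |u(x)|² |u(y)|² dx dy`. -/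
def meanFieldPotential {d : ℕ} (N : ℕ) (v : Space d → ℝ) (u : OneBody d) (x : Space d) : ℝ :=
  ((N : ℝ) - 1) * (∫ y, ‖u.fst y‖ ^ 2 * v (x - y)) - ((N : ℝ) - 1) / 2 * selfInteraction v u

/-- `n`-th eigenvalue, counted with multiplicity, of the one-particle mean-field operator
`-Δ + (N-1) (|u|² ∗ v) - (N-1)/2 ∫∫ v(x-y) |u(x)|² |u(y)|² dx dy` with form domain `H¹₀(U)`. -/
def meanFieldEigenvalue {d : ℕ} (N : ℕ) (v : Space d → ℝ) (U : Set (Space d)) (u : OneBody d)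
    (n : ℕ) : ℝ :=
  eigenvalue (oneBodyDomain U) (meanFieldPotential N v u) n

/-- `K` is a connected component of `U` on which a normalized eigenfunction for the lowest eigenvalue
of the Dirichlet Laplacian on `U` is supported. -/
def IsGroundComponent {d : ℕ} (U K : Set (Space d)) : Prop :=
  (∃ x ∈ U, K = connectedComponentIn U x) ∧
    ∃ φ : OneBody d, IsEigenpair (oneBodyDomain U) 0 φ (dirichletEigenvalue U 1) ∧
      ‖φ.fst‖ = 1 ∧ ∀ᵐ x, x ∉ K → φ.fst x = 0

/-! ### The many-body problem -/

/-- Form domain of the `N`-body Hamiltonian: permutation symmetric elements of `H¹₀(U^N)`. -/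
def bosonicDomain (N : ℕ) {d : ℕ} (U : Set (Space d)) : Set (ManyBody N d) :=
  {f | f ∈ H10 (configDir N d) {x : Config N d | ∀ i, x i ∈ U} ∧
    ∀ σ : Equiv.Perm (Fin N), (fun x : Config N d => f.fst (fun i => x (σ i))) =ᵐ[volume] f.fst}

/-- `∑_{i<j} v(x_i - x_j)`. -/
def pairPotential {N d : ℕ} (v : Space d → ℝ) (x : Config N d) : ℝ :=
  ∑ i : Fin N, ∑ j ∈ Finset.Ioi i, v (x i - x j)

/-- Ground state energy of `H_N = -∑_j Δ_j + ∑_{i<j} v(x_i - x_j)` on symmetric functions. -/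
def groundStateEnergy (N : ℕ) {d : ℕ} (v : Space d → ℝ) (U : Set (Space d)) : ℝ :=
  sInf {t : ℝ | ∃ f ∈ bosonicDomain N U, ‖f.fst‖ = 1 ∧
    t = (schrodingerForm (pairPotential v) f f).re}

/-- `Ψ` is a normalized ground state of `H_N`. -/
def IsGroundState {N d : ℕ} (v : Space d → ℝ) (U : Set (Space d)) (Ψ : ManyBody N d) : Prop :=
  IsEigenpair (bosonicDomain N U) (pairPotential v) Ψ (groundStateEnergy N v U) ∧ ‖Ψ.fst‖ = 1

/-- The configuration `(x, z_2, …, z_N)`. -/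
def insertFirst {N d : ℕ} (x : Space d) (z : {j : Fin N // (j : ℕ) ≠ 0} → Space d) : Config N d :=
  fun j => if h : (j : ℕ) ≠ 0 then z ⟨j, h⟩ else x

/-- Kernel of the one-particle density matrix:
`∫ Ψ(x, z_2, …, z_N) Ψ̄(y, z_2, …, z_N) dz_2 … dz_N`. -/
def densityKernel {N d : ℕ} (Ψ : ManyBody N d) (x y : Space d) : ℂ :=
  ∫ z : {j : Fin N // (j : ℕ) ≠ 0} → Space d,
    Ψ.fst (insertFirst x z) * conj (Ψ.fst (insertFirst y z))

/-- The expected number `N tr(ϱ |u⟩⟨u|) = N ⟨u, ϱ u⟩` of particles in the state `u`, `ϱ` being the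
one-particle density matrix of `Ψ`. -/
def occupation {N d : ℕ} (Ψ : ManyBody N d) (u : OneBody d) : ℝ :=
  N * (∫ x, ∫ y, conj (u.fst x) * densityKernel Ψ x y * u.fst y).re

end

end KacLuttinger

open KacLuttinger

open MeasureTheory ProbabilityTheory
open scoped ComplexConjugate
open KacLuttinger

namespace KacLuttinger

noncomputable section

set_option linter.unusedSectionVars false

open Filter Topology Set
open scoped ENNReal

/-! ### Closed convex sets in Hilbert spaces -/

section Hilbert

variable {H : Type*} [NormedAddCommGroup H] [InnerProductSpace ℂ H]

/-! The many-body estimate comes from positive definiteness. Since the Fourier transform of `v` is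
nonnegative, the quadratic form of `v` is nonnegative on the charge distribution consisting of unit
point charges at `x_1, …, x_N` minus the background `(N-1)|u|²`. Expanding it
(`IsAdmissibleInteraction.pos_def`, `IsAdmissibleInteraction.pairPotential_ge`) bounds the pair
potential from below by the sum of the mean-field potentials minus `N v(0)/2`, where `v(0)` comes
from the diagonal terms. Hence `H_N` is at least a sum of one-particle mean-field operators `h`, up
to `N v(0)/2`. If `u` is the ground state of `h` on the whole of `U`, the gap of `h` gives `h ≥ e₂ -
(e₂ - e₁)|u⟩⟨u|`, and summing over the particles of a symmetric wave function bounds its energy from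
below by `N (e₁ - v(0)/2 + (e₂ - e₁)(1 - n/N))` (`bosonic_bound`, `le_pairEnergy`). The product
state of `u` has energy at most `N e₁` (`exists_trial`). Comparing the two bounds yields the energy
estimate and the depletion estimate together.

What remains is one-particle theory: `u` must be the ground state of its own mean-field operator,
with a gap. On the component `K` this follows from convexity of the kinetic energy in the density
(`exists_mem_H10_sqrt`): the Hartree functional is differentiated along segments of densities
(`IsHartreeMinimizer.isGround`). On all of `U` the hypothesis on the Dirichlet gap is used. On the
complement of the Dirichlet ground state `w` the form of `h` is at least `λ₂` minus the subtracted
constant, while the Hartree energy of `w`, and so that of `u`, exceeds `λ₁` by at most a multiple of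
`N ‖v‖₁ sup |w|²` (`IsHartreeMinimizer.meanField`).

The supremum of `w` is controlled by the heat kernel. Extended by zero, `w ≥ 0` satisfies `-Δw ≤ λ₁
w` weakly on the whole space (`IsGround.subsolution`), so `e^{λ₁t} e^{tΔ} w` is nondecreasing in
`t`. This gives `w ≤ e^{λ₁t} (8πt)^{-d/4}`, evaluated at `t = 1/λ₁` (`IsGround.ae_norm_sq_le`).

Existence of minimizers and of eigenfunctions rests on Rellich's theorem (`hasCompactEmbedding_H10`)
and the direct method (`exists_minimizer`), in a form that serves the one-particle space and the
configuration space alike. -/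

/-- A decreasing sequence of nonempty closed convex subsets of a Hilbert space, the first of which is
bounded, has a common point. -/
theorem exists_mem_iInter_of_antitone_convex [CompleteSpace H] (A : ℕ → Set H)
    (hA : Antitone A) (hne : ∀ n, (A n).Nonempty) (hcl : ∀ n, IsClosed (A n))
    (hcv : ∀ n, ∀ x ∈ A n, ∀ y ∈ A n, (2⁻¹ : ℂ) • (x + y) ∈ A n) (C : ℝ)
    (hC : ∀ x ∈ A 0, ‖x‖ ≤ C) : ∃ x, ∀ n, x ∈ A n := by
  set a : ℕ → ℝ := fun n => sInf (norm '' A n) with ha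
  have hbdd : ∀ n, BddBelow (norm '' A n) := fun n => ⟨0, by rintro _ ⟨x, -, rfl⟩; exact norm_nonneg x⟩
  have ha_le : ∀ n, ∀ x ∈ A n, a n ≤ ‖x‖ := fun n x hx => csInf_le (hbdd n) ⟨x, hx, rfl⟩
  have ha0 : ∀ n, 0 ≤ a n := fun n => Real.sInf_nonneg (by rintro _ ⟨x, -, rfl⟩; exact norm_nonneg x)
  have hmono : Monotone a := fun m n h =>
    csInf_le_csInf (hbdd m) ((hne n).image _) (image_mono (hA h))
  have haC : ∀ n, a n ≤ C := fun n => by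
    obtain ⟨x, hx⟩ := hne n
    exact (ha_le n x hx).trans (hC x (hA (Nat.zero_le n) hx))
  obtain ⟨l, hl⟩ : ∃ l, Tendsto a atTop (𝓝 l) :=
    ⟨_, tendsto_atTop_ciSup hmono ⟨C, by rintro _ ⟨n, rfl⟩; exact haC n⟩⟩
  have hal : ∀ n, a n ≤ l := fun n => hmono.ge_of_tendsto hl n
  have hch : ∀ n : ℕ, ∃ x ∈ A n, ‖x‖ < a n + 1 / ((n : ℝ) + 1) := fun n => by
    obtain ⟨_, ⟨x, hx, rfl⟩, h⟩ := exists_lt_of_csInf_lt ((hne n).image norm)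
      (lt_add_of_pos_right (a n) (Nat.one_div_pos_of_nat (α := ℝ) (n := n)))
    exact ⟨x, hx, h⟩
  choose p hpA hp using hch
  -- The midpoint of `p n` and `p m` lies in `A m`, so its norm is at least `a m`; the parallelogram
  -- law converts near-minimality of both norms into closeness.
  have key : ∀ m n, m ≤ n → ‖p n - p m‖ ^ 2 ≤
      4 * ((l + 1 / ((m : ℝ) + 1)) ^ 2 - a m ^ 2) := by
    intro m n hmn
    have hmid := ha_le m _ (hcv m _ (hA hmn (hpA n)) _ (hpA m))
    have hpar := parallelogram_law_with_norm ℂ (p n) (p m)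
    have h1 : ‖(2⁻¹ : ℂ) • (p n + p m)‖ = ‖p n + p m‖ / 2 := by
      rw [norm_smul, norm_inv, Complex.norm_ofNat]; ring
    rw [h1] at hmid
    have hn1 : ‖p n‖ ≤ l + 1 / ((m : ℝ) + 1) := by
      have : 1 / ((n : ℝ) + 1) ≤ 1 / ((m : ℝ) + 1) := by
        apply one_div_le_one_div_of_le (by positivity)
        have : (m : ℝ) ≤ n := by exact_mod_cast hmn
        linarith
      linarith [hp n, hal n]
    have hm1 : ‖p m‖ ≤ l + 1 / ((m : ℝ) + 1) := by linarith [hp m, hal m]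
    nlinarith [norm_nonneg (p n), norm_nonneg (p m), ha0 m, norm_nonneg (p n + p m)]
  have hlim : Tendsto (fun m : ℕ => 4 * ((l + 1 / ((m : ℝ) + 1)) ^ 2 - a m ^ 2)) atTop (𝓝 0) := by
    have := (((tendsto_const_nhds (x := l)).add
      (tendsto_one_div_add_atTop_nhds_zero_nat (𝕜 := ℝ))).pow 2).sub (hl.pow 2)
    simpa using this.const_mul 4
  have hcau : CauchySeq p := by
    rw [Metric.cauchySeq_iff']
    intro ε hε
    obtain ⟨m, hm⟩ := (hlim.eventually (gt_mem_nhds (by positivity : (0:ℝ) < ε ^ 2))).exists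
    refine ⟨m, fun n hn => ?_⟩
    rw [dist_eq_norm]
    exact lt_of_pow_lt_pow_left₀ 2 hε.le ((key m n hn).trans_lt hm)
  obtain ⟨x, hx⟩ := cauchySeq_tendsto_of_complete hcau
  refine ⟨x, fun n => (hcl n).mem_of_tendsto hx ?_⟩
  filter_upwards [eventually_ge_atTop n] with k hk using hA hk (hpA k)

/-- A point of a submodule where a nonnegative quadratic form vanishes is in its kernel. -/
theorem inner_eq_zero_of_quadratic_nonneg (A : H →ₗ[ℂ] H)
    (hA : ∀ x y, inner ℂ (A x) y = inner ℂ x (A y)) (S : Submodule ℂ H)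
    (hpos : ∀ g ∈ S, 0 ≤ (inner ℂ g (A g)).re) {f : H} (hf : f ∈ S)
    (h0 : (inner ℂ f (A f)).re = 0) {g : H} (hg : g ∈ S) : inner ℂ g (A f) = 0 := by
  set c := inner ℂ g (A f) with hc
  -- Perturbing along `c • g`, with `c` the very number that should vanish, makes the term linear in
  -- `t` equal to `2 t ‖c‖²`, whatever the phase of `c`.
  have key : ∀ t : ℝ, 0 ≤ t ^ 2 * (inner ℂ (c • g) (A (c • g))).re + 2 * t * ‖c‖ ^ 2 := by
    intro t
    have hmem : f + (t : ℂ) • (c • g) ∈ S := S.add_mem hf (S.smul_mem _ (S.smul_mem _ hg))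
    have h := hpos _ hmem
    have e1 : inner ℂ (c • g) (A f) = ((‖c‖ ^ 2 : ℝ) : ℂ) := by
      rw [inner_smul_left, ← hc, Complex.conj_mul']; push_cast; rfl
    have e2 : (inner ℂ f (A (c • g))).re = ‖c‖ ^ 2 := by
      rw [← hA, ← inner_conj_symm, e1, Complex.conj_ofReal, Complex.ofReal_re]
    rw [map_add, map_smul A (t : ℂ), inner_add_left, inner_add_right, inner_add_right,
      inner_smul_left _ _ (t : ℂ), inner_smul_left _ _ (t : ℂ), inner_smul_right _ _ (t : ℂ),
      inner_smul_right _ _ (t : ℂ), e1, Complex.conj_ofReal] at h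
    simp only [Complex.add_re, Complex.re_ofReal_mul, h0, e2, Complex.ofReal_re] at h
    nlinarith
  set B := (inner ℂ (c • g) (A (c • g))).re
  have hB : 0 ≤ B := hpos _ (S.smul_mem _ hg)
  -- The optimal `t` would be `-‖c‖² / B`; using `B + 1` covers `B = 0` and still leaves a negative
  -- multiple of `‖c‖⁴`.
  have h1 := key (-(‖c‖ ^ 2 / (B + 1)))
  have h2 : 0 ≤ -(‖c‖ ^ 2) ^ 2 * ((B + 2) / (B + 1) ^ 2) := by
    have : (-(‖c‖ ^ 2 / (B + 1))) ^ 2 * B + 2 * -(‖c‖ ^ 2 / (B + 1)) * ‖c‖ ^ 2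
      = -(‖c‖ ^ 2) ^ 2 * ((B + 2) / (B + 1) ^ 2) := by field_simp; ring
    linarith
  have h3 : 0 < (B + 2) / (B + 1) ^ 2 := by positivity
  have h4 : (‖c‖ ^ 2) ^ 2 ≤ 0 := by nlinarith
  have : ‖c‖ = 0 := by
    have := le_antisymm h4 (by positivity)
    simpa using this
  simpa using this

end Hilbert

/-! ### Multiplication by bounded functions -/

section Mul

variable {X : Type*} [MeasureSpace X] {E : Type*} [NormedAddCommGroup E] [NormedSpace ℂ E]

theorem MemLp.ofReal_top {W : X → ℝ} (hW : MemLp W ∞ (volume : Measure X)) :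
    MemLp (fun x => (W x : ℂ)) ∞ (volume : Measure X) := hW.ofReal

/-- Multiplication by a bounded real function, as an operator on `L²`. -/
def mulL {W : X → ℝ} (hW : MemLp W ∞ (volume : Measure X)) :
    Lp E 2 (volume : Measure X) →L[ℂ] Lp E 2 (volume : Measure X) :=
  (ContinuousLinearMap.lsmul ℂ ℂ : ℂ →L[ℂ] E →L[ℂ] E).holderL volume ∞ 2 2 ((MemLp.ofReal_top hW).toLp _)

theorem coeFn_mulL {W : X → ℝ} (hW : MemLp W ∞ (volume : Measure X))
    (f : Lp E 2 (volume : Measure X)) : mulL hW f =ᵐ[volume] fun x => (W x : ℂ) • f x := by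
  have h := (ContinuousLinearMap.lsmul ℂ ℂ : ℂ →L[ℂ] E →L[ℂ] E).coeFn_holder (r := 2)
    ((MemLp.ofReal_top hW).toLp _) f
  filter_upwards [h, (MemLp.ofReal_top hW).coeFn_toLp] with x hx h'
  have : mulL hW f x = ((ContinuousLinearMap.lsmul ℂ ℂ : ℂ →L[ℂ] E →L[ℂ] E).holder 2
    ((MemLp.ofReal_top hW).toLp _) f) x := rfl
  rw [this, hx, h', ContinuousLinearMap.lsmul_apply]

theorem integrable_mul_conj_mul {W : X → ℝ} (hW : MemLp W ∞ (volume : Measure X))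
    (f g : Lp ℂ 2 (volume : Measure X)) :
    Integrable (fun x => (W x : ℂ) * (conj (f x) * g x)) volume := by
  refine (L2.integrable_inner (𝕜 := ℂ) f (mulL hW g)).congr ?_
  filter_upwards [coeFn_mulL hW g] with x hx
  rw [hx, smul_eq_mul, RCLike.inner_apply]
  ring

theorem inner_mulL {W : X → ℝ} (hW : MemLp W ∞ (volume : Measure X))
    (f g : Lp ℂ 2 (volume : Measure X)) :
    inner ℂ f (mulL hW g) = ∫ x, (W x : ℂ) * (conj (f x) * g x) := by
  rw [L2.inner_def]
  refine integral_congr_ae ?_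
  filter_upwards [coeFn_mulL hW g] with x hx
  rw [hx, smul_eq_mul, RCLike.inner_apply]
  ring

theorem mulL_symm {W : X → ℝ} (hW : MemLp W ∞ (volume : Measure X))
    (f g : Lp ℂ 2 (volume : Measure X)) :
    inner ℂ (mulL hW f) g = inner ℂ f (mulL hW g) := by
  rw [← inner_conj_symm, inner_mulL, inner_mulL, ← integral_conj]
  refine integral_congr_ae (Eventually.of_forall fun x => ?_)
  simp only [map_mul, Complex.conj_ofReal, Complex.conj_conj]
  ring

theorem integrable_mul_norm_sq {W : X → ℝ} (hW : MemLp W ∞ (volume : Measure X))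
    (f : Lp ℂ 2 (volume : Measure X)) : Integrable (fun x => W x * ‖f x‖ ^ 2) volume := by
  have := (integrable_mul_conj_mul hW f f).re
  refine this.congr (Eventually.of_forall fun x => ?_)
  simp only [RCLike.re_to_complex, Complex.conj_mul', ← Complex.ofReal_pow, ← Complex.ofReal_mul,
    Complex.ofReal_re]

theorem inner_mulL_self {W : X → ℝ} (hW : MemLp W ∞ (volume : Measure X))
    (f : Lp ℂ 2 (volume : Measure X)) :
    inner ℂ f (mulL hW f) = ((∫ x, W x * ‖f x‖ ^ 2 : ℝ) : ℂ) := by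
  rw [inner_mulL, ← integral_complex_ofReal]
  refine integral_congr_ae (Eventually.of_forall fun x => ?_)
  simp only [Complex.conj_mul', Complex.ofReal_pow, Complex.ofReal_mul]

theorem norm_sq_eq_integral {F : Type*} [NormedAddCommGroup F] [InnerProductSpace ℂ F]
    (f : Lp F 2 (volume : Measure X)) : ‖f‖ ^ 2 = ∫ x, ‖f x‖ ^ 2 := by
  have h : (inner ℂ f f : ℂ) = ((‖f‖ ^ 2 : ℝ) : ℂ) := by
    rw [inner_self_eq_norm_sq_to_K]; push_cast; rfl
  have h2 : (inner ℂ f f : ℂ) = ((∫ x, ‖f x‖ ^ 2 : ℝ) : ℂ) := by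
    rw [L2.inner_def, ← integral_complex_ofReal]
    refine integral_congr_ae (Eventually.of_forall fun x => ?_)
    simp only [inner_self_eq_norm_sq_to_K]
    push_cast; rfl
  rw [h] at h2
  exact_mod_cast h2

theorem integrable_norm_sq {F : Type*} [NormedAddCommGroup F]
    (f : Lp F 2 (volume : Measure X)) : Integrable (fun x => ‖f x‖ ^ 2) volume :=
  (Lp.memLp f).integrable_norm_pow (by norm_num)

end Mul

/-! ### Quadratic forms and variational eigenvalues -/

section Forms

variable {X : Type*} [NormedAddCommGroup X] [NormedSpace ℝ X] [MeasureSpace X]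
  {κ : Type*} [Fintype κ]

/-- The quadratic form `∫ |∇f|² + ∫ W |f|²`. -/
def energy (W : X → ℝ) (f : GradPair X κ) : ℝ := ‖f.snd‖ ^ 2 + ∫ x, W x * ‖f.fst x‖ ^ 2

/-- The operator `(f, g) ↦ (W f - m f, g)` on `GradPair`, which represents the form of
`-Δ + W - m`. -/
def formOp {W : X → ℝ} (hW : MemLp W ∞ (volume : Measure X)) (m : ℝ) :
    GradPair X κ →ₗ[ℂ] GradPair X κ where
  toFun f := WithLp.toLp 2 (mulL hW f.fst - (m : ℂ) • f.fst, f.snd)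
  map_add' f g := by
    apply WithLp.ofLp_injective 2
    ext1
    · simp only [WithLp.add_fst, map_add, smul_add, WithLp.ofLp_add, Prod.fst_add]; abel
    · simp
  map_smul' c f := by
    apply WithLp.ofLp_injective 2
    ext1
    · simp only [WithLp.smul_fst, map_smul, WithLp.ofLp_smul, Prod.smul_fst, RingHom.id_apply,
        smul_sub, smul_comm c (m : ℂ)]
    · simp

theorem inner_formOp {W : X → ℝ} (hW : MemLp W ∞ (volume : Measure X)) (m : ℝ)
    (f g : GradPair X κ) :
    inner ℂ f (formOp hW m g) = schrodingerForm W f g - (m : ℂ) * inner ℂ f.fst g.fst := by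
  rw [WithLp.prod_inner_apply]
  change inner ℂ f.fst (mulL hW g.fst - (m : ℂ) • g.fst) + inner ℂ f.snd g.snd = _
  rw [inner_sub_right, inner_mulL, inner_smul_right, schrodingerForm]
  ring

theorem formOp_symm {W : X → ℝ} (hW : MemLp W ∞ (volume : Measure X)) (m : ℝ)
    (f g : GradPair X κ) :
    inner ℂ (formOp hW m f) g = inner ℂ f (formOp hW m g) := by
  rw [WithLp.prod_inner_apply, WithLp.prod_inner_apply]
  change inner ℂ (mulL hW f.fst - (m : ℂ) • f.fst) g.fst + inner ℂ f.snd g.snd =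
    inner ℂ f.fst (mulL hW g.fst - (m : ℂ) • g.fst) + inner ℂ f.snd g.snd
  rw [inner_sub_right, inner_sub_left, mulL_symm, inner_smul_left, inner_smul_right,
    Complex.conj_ofReal]

theorem schrodingerForm_self {W : X → ℝ} (hW : MemLp W ∞ (volume : Measure X))
    (f : GradPair X κ) : schrodingerForm W f f = (energy W f : ℂ) := by
  rw [schrodingerForm, ← inner_mulL hW, inner_mulL_self, energy, inner_self_eq_norm_sq_to_K]
  push_cast; rfl

theorem schrodingerForm_conj {W : X → ℝ} (hW : MemLp W ∞ (volume : Measure X))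
    (f g : GradPair X κ) : conj (schrodingerForm W f g) = schrodingerForm W g f := by
  have h := inner_formOp hW 0 f g
  have h' := inner_formOp hW 0 g f
  simp only [Complex.ofReal_zero, zero_mul, sub_zero] at h h'
  rw [← h, ← h', inner_conj_symm, formOp_symm]

theorem inner_self_fst (f : GradPair X κ) : inner ℂ f.fst f.fst = ((‖f.fst‖ ^ 2 : ℝ) : ℂ) := by
  rw [inner_self_eq_norm_sq_to_K]; push_cast; rfl

theorem re_inner_formOp_self {W : X → ℝ} (hW : MemLp W ∞ (volume : Measure X)) (m : ℝ)
    (f : GradPair X κ) :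
    (inner ℂ f (formOp hW m f)).re = energy W f - m * ‖f.fst‖ ^ 2 := by
  rw [inner_formOp, schrodingerForm_self hW, inner_self_fst, ← Complex.ofReal_mul,
    ← Complex.ofReal_sub, Complex.ofReal_re]

theorem energy_smul (W : X → ℝ) (c : ℂ) (f : GradPair X κ) :
    energy W (c • f) = ‖c‖ ^ 2 * energy W f := by
  have : ∫ x, W x * ‖(c • f).fst x‖ ^ 2 = ‖c‖ ^ 2 * ∫ x, W x * ‖f.fst x‖ ^ 2 := by
    rw [← integral_const_mul]
    refine integral_congr_ae ?_
    rw [WithLp.smul_fst]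
    filter_upwards [Lp.coeFn_smul c f.fst] with x hx
    rw [hx, Pi.smul_apply, norm_smul]; ring
  rw [energy, this, energy, WithLp.smul_snd, norm_smul]; ring

/-- A minimizer of the energy on a submodule is an eigenfunction. -/
theorem isEigenpair_of_minimizer {W : X → ℝ} (hW : MemLp W ∞ (volume : Measure X))
    {S : Submodule ℂ (GradPair X κ)} {f : GradPair X κ} (hf : f ∈ S) (hf0 : f.fst ≠ 0) {m : ℝ}
    (hm : energy W f = m * ‖f.fst‖ ^ 2) (hmin : ∀ g ∈ S, m * ‖g.fst‖ ^ 2 ≤ energy W g) :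
    IsEigenpair (S : Set (GradPair X κ)) W f m := by
  refine ⟨hf, hf0, fun g hg => ?_⟩
  have := inner_eq_zero_of_quadratic_nonneg (formOp hW m) (formOp_symm hW m) S
    (fun g hg => by rw [re_inner_formOp_self]; linarith [hmin g hg]) hf
    (by rw [re_inner_formOp_self]; linarith) hg
  rw [inner_formOp] at this
  exact sub_eq_zero.1 this

theorem IsEigenpair.energy_eq {W : X → ℝ} (hW : MemLp W ∞ (volume : Measure X))
    {D : Set (GradPair X κ)} {f : GradPair X κ} {m : ℝ} (h : IsEigenpair D W f m) :
    energy W f = m * ‖f.fst‖ ^ 2 := by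
  have := h.2.2 f h.1
  rw [schrodingerForm_self hW, inner_self_fst] at this
  exact_mod_cast this

/-- The lower bound `m ‖g‖² ≤ energy W g` only has to be checked on normalized elements. -/
theorem le_energy_of_normalized {W : X → ℝ} {S : Submodule ℂ (GradPair X κ)} {m : ℝ}
    (h : ∀ g ∈ S, ‖g.fst‖ = 1 → m ≤ energy W g) {g : GradPair X κ} (hg : g ∈ S) :
    m * ‖g.fst‖ ^ 2 ≤ energy W g := by
  -- A pair with zero function part cannot be normalized; there the left side is zero and the energy
  -- is just `‖g.snd‖²`.
  by_cases h0 : g.fst = 0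
  · have : ∫ x, W x * ‖g.fst x‖ ^ 2 = 0 := by
      rw [h0]
      refine integral_eq_zero_of_ae ?_
      filter_upwards [Lp.coeFn_zero ℂ 2 (volume : Measure X)] with x hx
      rw [hx]; simp
    rw [energy, this, h0, norm_zero]; nlinarith [sq_nonneg ‖g.snd‖]
  · have hn : 0 < ‖g.fst‖ := norm_pos_iff.2 h0
    have := h (((‖g.fst‖⁻¹ : ℝ) : ℂ) • g) (S.smul_mem _ hg) (by
      rw [WithLp.smul_fst, norm_smul, Complex.norm_real, norm_inv, norm_norm]
      field_simp)
    rw [energy_smul, Complex.norm_real, norm_inv, norm_norm, inv_pow] at this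
    rwa [← div_eq_inv_mul, le_div_iff₀ (by positivity)] at this

/-- Bounded sequences in `S` have subsequences whose function parts converge in `L²`. -/
def HasCompactEmbedding (S : Submodule ℂ (GradPair X κ)) : Prop :=
  ∀ f : ℕ → GradPair X κ, (∀ n, f n ∈ S) → ∀ C : ℝ, (∀ n, ‖f n‖ ≤ C) →
    ∃ (w : Lp ℂ 2 (volume : Measure X)) (φ : ℕ → ℕ), StrictMono φ ∧
      Tendsto (fun n => (f (φ n)).fst) atTop (𝓝 w)

theorem HasCompactEmbedding.mono {S T : Submodule ℂ (GradPair X κ)} (hT : HasCompactEmbedding T)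
    (h : S ≤ T) : HasCompactEmbedding S := fun f hf C hC => hT f (fun n => h (hf n)) C hC

/-- Weak closedness: if the function parts of a sequence in a closed submodule converge and their
gradients are asymptotically bounded by `c`, then the limit is in the submodule, with gradient bounded
by `c`. -/
theorem exists_mem_of_tendsto_fst {S : Submodule ℂ (GradPair X κ)}
    (hS : IsClosed (S : Set (GradPair X κ))) {f : ℕ → GradPair X κ} (hf : ∀ n, f n ∈ S)
    {w : Lp ℂ 2 (volume : Measure X)} (hw : Tendsto (fun n => (f n).fst) atTop (𝓝 w))
    {b : ℕ → ℝ} (hb : ∀ n, ‖(f n).snd‖ ^ 2 ≤ b n) {c : ℝ} (hc : Tendsto b atTop (𝓝 c)) :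
    ∃ g ∈ S, g.fst = w ∧ ‖g.snd‖ ^ 2 ≤ c := by
  have hc0 : 0 ≤ c := ge_of_tendsto' hc fun n => (sq_nonneg _).trans (hb n)
  have hev : ∀ ε > 0, ∃ n, ‖(f n).fst - w‖ ≤ ε ∧ ‖(f n).snd‖ ≤ Real.sqrt c + ε := by
    intro ε hε
    have h1 := (tendsto_iff_norm_sub_tendsto_zero.1 hw).eventually (gt_mem_nhds hε)
    have h2 := hc.eventually (gt_mem_nhds (show c < (Real.sqrt c + ε) ^ 2 by
      nlinarith [Real.sq_sqrt hc0, Real.sqrt_nonneg c]))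
    obtain ⟨n, hn1, hn2⟩ := (h1.and h2).exists
    exact ⟨n, hn1.le, le_of_sq_le_sq ((hb n).trans hn2.le) (by positivity)⟩
  -- These sets are closed, convex, decreasing and bounded, so they have a common point without any
  -- weak convergence of the gradients; that point has function part `w` and gradient norm at most
  -- `√c`.
  set A : ℕ → Set (GradPair X κ) := fun n =>
    {g | g ∈ S ∧ ‖g.fst - w‖ ≤ 1 / ((n : ℝ) + 1) ∧ ‖g.snd‖ ≤ Real.sqrt c + 1 / ((n : ℝ) + 1)}
  have hfst : Continuous fun g : GradPair X κ => g.fst := (WithLp.fstL 2 ℂ _ _).continuous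
  have hsnd : Continuous fun g : GradPair X κ => g.snd := (WithLp.sndL 2 ℂ _ _).continuous
  have hanti : ∀ m n : ℕ, m ≤ n → 1 / ((n : ℝ) + 1) ≤ 1 / ((m : ℝ) + 1) := fun m n h => by
    apply one_div_le_one_div_of_le (by positivity)
    have : (m : ℝ) ≤ n := by exact_mod_cast h
    linarith
  obtain ⟨g, hg⟩ := exists_mem_iInter_of_antitone_convex A
    (fun m n h g hg => ⟨hg.1, hg.2.1.trans (hanti m n h),
      hg.2.2.trans (by linarith [hanti m n h])⟩)
    (fun n => by
      obtain ⟨k, h1, h2⟩ := hev _ (Nat.one_div_pos_of_nat (α := ℝ) (n := n))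
      exact ⟨f k, hf k, h1, h2⟩)
    (fun n => hS.inter ((isClosed_le (hfst.sub continuous_const).norm continuous_const).inter
      (isClosed_le hsnd.norm continuous_const)))
    (fun n x hx y hy => by
      have hn : ‖(2⁻¹ : ℂ)‖ = 2⁻¹ := by rw [norm_inv, Complex.norm_ofNat]
      refine ⟨S.smul_mem _ (S.add_mem hx.1 hy.1), ?_, ?_⟩
      · have : ((2⁻¹ : ℂ) • (x + y)).fst - w
            = (2⁻¹ : ℂ) • ((x.fst - w) + (y.fst - w)) := by
          rw [WithLp.smul_fst, WithLp.add_fst]; module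
        rw [this, norm_smul, hn]
        have := norm_add_le (x.fst - w) (y.fst - w)
        linarith [hx.2.1, hy.2.1]
      · rw [WithLp.smul_snd, WithLp.add_snd, norm_smul, hn]
        have := norm_add_le x.snd y.snd
        linarith [hx.2.2, hy.2.2])
    (‖w‖ + Real.sqrt c + 2) (fun x hx => by
      have h1 : ‖x‖ ^ 2 = ‖x.fst‖ ^ 2 + ‖x.snd‖ ^ 2 := WithLp.prod_norm_sq_eq_of_L2 x
      have h2 : ‖x.fst‖ ≤ ‖w‖ + 1 := by
        have := norm_le_norm_add_norm_sub' x.fst w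
        have := hx.2.1
        norm_num at this
        linarith
      have h3 := hx.2.2
      norm_num at h3
      have := Real.sqrt_nonneg c
      refine le_of_sq_le_sq ?_ (by positivity)
      nlinarith [norm_nonneg x.fst, norm_nonneg x.snd, norm_nonneg w])
  refine ⟨g, (hg 0).1, ?_, ?_⟩
  · have : ‖g.fst - w‖ ≤ 0 :=
      ge_of_tendsto' (tendsto_one_div_add_atTop_nhds_zero_nat (𝕜 := ℝ)) fun n => (hg n).2.1
    exact sub_eq_zero.1 (norm_le_zero_iff.1 this)
  · have : ‖g.snd‖ ≤ Real.sqrt c + 0 :=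
      ge_of_tendsto' ((tendsto_one_div_add_atTop_nhds_zero_nat (𝕜 := ℝ)).const_add (Real.sqrt c))
        fun n => (hg n).2.2
    rw [add_zero] at this
    calc ‖g.snd‖ ^ 2 ≤ Real.sqrt c ^ 2 := by gcongr
      _ = c := Real.sq_sqrt hc0

/-- The direct method: a functional `‖∇f‖² + F(f)`, with `F` continuous and bounded below on `L²`, has
a minimizer among the normalized elements of a closed, compactly embedded submodule. -/
theorem exists_minimizer {S : Submodule ℂ (GradPair X κ)}
    (hS : IsClosed (S : Set (GradPair X κ))) (hc : HasCompactEmbedding S)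
    (F : Lp ℂ 2 (volume : Measure X) → ℝ) (hF : Continuous F) (C : ℝ)
    (hC : ∀ w, ‖w‖ = 1 → C ≤ F w) (hne : ∃ f ∈ S, f.fst ≠ 0) :
    ∃ f ∈ S, ‖f.fst‖ = 1 ∧ ∀ g ∈ S, ‖g.fst‖ = 1 →
      ‖f.snd‖ ^ 2 + F f.fst ≤ ‖g.snd‖ ^ 2 + F g.fst := by
  set T : Set ℝ := {t | ∃ f ∈ S, ‖f.fst‖ = 1 ∧ t = ‖f.snd‖ ^ 2 + F f.fst}
  have hTne : T.Nonempty := by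
    obtain ⟨f, hf, hf0⟩ := hne
    have hn : 0 < ‖f.fst‖ := norm_pos_iff.2 hf0
    refine ⟨_, ((‖f.fst‖⁻¹ : ℝ) : ℂ) • f, S.smul_mem _ hf, ?_, rfl⟩
    rw [WithLp.smul_fst, norm_smul, Complex.norm_real, norm_inv, norm_norm]
    field_simp
  have hTb : BddBelow T := ⟨C, by
    rintro _ ⟨f, -, h1, rfl⟩
    have := hC _ h1
    nlinarith [sq_nonneg ‖f.snd‖]⟩
  obtain ⟨t, -, htlim, htT⟩ := exists_seq_tendsto_sInf hTne hTb
  choose f hfS hf1 hft using htT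
  obtain ⟨B, hB⟩ : ∃ B, ∀ n, t n ≤ B := by
    obtain ⟨B, hB⟩ := htlim.bddAbove_range
    exact ⟨B, fun n => hB ⟨n, rfl⟩⟩
  have hbd : ∀ n, ‖f n‖ ≤ 1 + |B - C| := fun n => by
    have h1 : ‖f n‖ ^ 2 = ‖(f n).fst‖ ^ 2 + ‖(f n).snd‖ ^ 2 := WithLp.prod_norm_sq_eq_of_L2 _
    have h2 : ‖(f n).snd‖ ^ 2 ≤ |B - C| := by
      have := le_abs_self (B - C)
      linarith [hft n, hB n, hC _ (hf1 n)]
    rw [hf1] at h1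
    refine le_of_sq_le_sq ?_ (by positivity)
    nlinarith [abs_nonneg (B - C)]
  obtain ⟨w, φ, hφ, hw⟩ := hc f hfS _ hbd
  -- Along the minimizing sequence the squared gradient norm is exactly `t - F`, so it converges to
  -- `sInf T - F w`, the bound that the limit inherits.
  have hlim : Tendsto (fun n => t (φ n) - F (f (φ n)).fst) atTop (𝓝 (sInf T - F w)) :=
    (htlim.comp hφ.tendsto_atTop).sub ((hF.tendsto w).comp hw)
  obtain ⟨g, hgS, hgw, hg⟩ := exists_mem_of_tendsto_fst hS (fun n => hfS (φ n)) hw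
    (fun n => by rw [hft (φ n)]; linarith) hlim
  refine ⟨g, hgS, ?_, fun h hh hh1 => ?_⟩
  · rw [hgw]
    exact tendsto_nhds_unique hw.norm (by simp [hf1])
  · have := csInf_le hTb ⟨h, hh, hh1, rfl⟩
    rw [hgw]
    linarith

end Forms

/-! ### The two lowest eigenvalues through the variational principle -/

section Eigenvalues

variable {X : Type*} [NormedAddCommGroup X] [NormedSpace ℝ X] [MeasureSpace X]
  {κ : Type*} [Fintype κ] {W : X → ℝ} {S : Submodule ℂ (GradPair X κ)}

/-- `f` is a normalized minimizer of the energy on `S`. -/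
def IsGround (S : Submodule ℂ (GradPair X κ)) (W : X → ℝ) (f : GradPair X κ) : Prop :=
  f ∈ S ∧ ‖f.fst‖ = 1 ∧ ∀ g ∈ S, energy W f * ‖g.fst‖ ^ 2 ≤ energy W g

theorem ne_zero_of_norm_one {f : GradPair X κ} (h : ‖f.fst‖ = 1) : f.fst ≠ 0 := by
  rw [← norm_ne_zero_iff, h]; norm_num

theorem IsGround.isEigenpair (hW : MemLp W ∞ (volume : Measure X)) {f : GradPair X κ}
    (hf : IsGround S W f) : IsEigenpair (S : Set (GradPair X κ)) W f (energy W f) :=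
  isEigenpair_of_minimizer hW hf.1 (ne_zero_of_norm_one hf.2.1) (by rw [hf.2.1]; ring) hf.2.2

theorem exists_isGround (hW : MemLp W ∞ (volume : Measure X))
    (hS : IsClosed (S : Set (GradPair X κ))) (hc : HasCompactEmbedding S)
    (hne : ∃ f ∈ S, f.fst ≠ 0) : ∃ f, IsGround S W f := by
  set F : Lp ℂ 2 (volume : Measure X) → ℝ := fun w => (inner ℂ w (mulL hW w)).re with hF
  have hFe : ∀ w, F w = ∫ x, W x * ‖w x‖ ^ 2 := fun w => by
    rw [hF]; simp only [inner_mulL_self, Complex.ofReal_re]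
  obtain ⟨f, hf, hf1, hmin⟩ := exists_minimizer hS hc F (by fun_prop)
    (-‖(mulL hW : Lp ℂ 2 (volume : Measure X) →L[ℂ] _)‖) (fun w hw => by
      have h1 := (abs_le.1 (Complex.abs_re_le_norm (inner ℂ w (mulL hW w)))).1
      have h2 := norm_inner_le_norm (𝕜 := ℂ) w (mulL hW w)
      have h3 := (mulL hW : Lp ℂ 2 (volume : Measure X) →L[ℂ] _).le_opNorm w
      rw [hw] at h2 h3
      simp only [hF]
      linarith) hne
  refine ⟨f, hf, hf1, fun g hg => le_energy_of_normalized (fun g hg h1 => ?_) hg⟩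
  have := hmin g hg h1
  rwa [hFe, hFe] at this

/-- The set of which `eigenvalue` is the infimum is bounded below. -/
theorem bddBelow_eigenvalue (hW : MemLp W ∞ (volume : Measure X)) {m : ℝ}
    (hm : ∀ g ∈ S, m * ‖g.fst‖ ^ 2 ≤ energy W g) {n : ℕ} (hn : 0 < n) :
    m ∈ lowerBounds {t : ℝ | ∃ f : Fin n → GradPair X κ, LinearIndependent ℂ (fun i => (f i).fst) ∧
      ∀ i, ∃ μ ≤ t, IsEigenpair (S : Set (GradPair X κ)) W (f i) μ} := by
  rintro t ⟨f, -, h⟩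
  obtain ⟨μ, hμ, he⟩ := h ⟨0, hn⟩
  have h1 := hm _ he.1
  rw [he.energy_eq hW] at h1
  have : 0 < ‖(f ⟨0, hn⟩).fst‖ ^ 2 := by have := norm_pos_iff.2 he.2.1; positivity
  exact (le_of_mul_le_mul_right h1 this).trans hμ

theorem linearIndependent_fin_one {f : GradPair X κ} (h : f.fst ≠ 0) :
    LinearIndependent ℂ (fun _ : Fin 1 => f.fst) := by
  rw [linearIndependent_unique_iff]; exact h

theorem IsGround.eigenvalue_one (hW : MemLp W ∞ (volume : Measure X)) {f : GradPair X κ}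
    (hf : IsGround S W f) : eigenvalue (S : Set (GradPair X κ)) W 1 = energy W f := by
  have hlb := bddBelow_eigenvalue hW hf.2.2 Nat.one_pos
  refine le_antisymm (csInf_le ⟨_, hlb⟩ ?_) (le_csInf ⟨energy W f, ?_⟩ hlb) <;>
  exact ⟨fun _ => f, linearIndependent_fin_one (ne_zero_of_norm_one hf.2.1),
      fun _ => ⟨_, le_rfl, hf.isEigenpair hW⟩⟩

/-- The elements of `S` orthogonal to `q`. -/
def orthIn (S : Submodule ℂ (GradPair X κ)) (q : Lp ℂ 2 (volume : Measure X)) :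
    Submodule ℂ (GradPair X κ) where
  carrier := {g | g ∈ S ∧ inner ℂ q g.fst = 0}
  zero_mem' := ⟨S.zero_mem, by simp⟩
  add_mem' := fun ha hb => ⟨S.add_mem ha.1 hb.1, by
    rw [WithLp.add_fst, inner_add_right, ha.2, hb.2, add_zero]⟩
  smul_mem' := fun c a ha => ⟨S.smul_mem c ha.1, by
    rw [WithLp.smul_fst, inner_smul_right, ha.2, mul_zero]⟩

theorem orthIn_le (q : Lp ℂ 2 (volume : Measure X)) : orthIn S q ≤ S := fun _ h => h.1

theorem continuous_fst : Continuous fun g : GradPair X κ => g.fst :=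
  (WithLp.fstL 2 ℂ _ _).continuous

theorem continuous_snd : Continuous fun g : GradPair X κ => g.snd :=
  (WithLp.sndL 2 ℂ _ _).continuous

theorem isClosed_orthIn (hS : IsClosed (S : Set (GradPair X κ)))
    (q : Lp ℂ 2 (volume : Measure X)) : IsClosed (orthIn S q : Set (GradPair X κ)) :=
  hS.inter (isClosed_eq (continuous_const.inner continuous_fst) continuous_const)

theorem isEigenpair_iff (hW : MemLp W ∞ (volume : Measure X)) {f : GradPair X κ} {m : ℝ} :
    IsEigenpair (S : Set (GradPair X κ)) W f m ↔
      f ∈ S ∧ f.fst ≠ 0 ∧ ∀ g ∈ S, inner ℂ g (formOp hW m f) = 0 := by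
  refine and_congr Iff.rfl (and_congr Iff.rfl (forall₂_congr fun g _ => ?_))
  rw [inner_formOp, sub_eq_zero]

/-- A second eigenfunction, minimizing the energy on the orthogonal complement of the first. -/
theorem IsGround.exists_second (hW : MemLp W ∞ (volume : Measure X))
    (hS : IsClosed (S : Set (GradPair X κ))) (hc : HasCompactEmbedding S) {f : GradPair X κ}
    (hf : IsGround S W f) (hne : ∃ g ∈ orthIn S f.fst, g.fst ≠ 0) :
    ∃ f₂, IsGround (orthIn S f.fst) W f₂ ∧
      IsEigenpair (S : Set (GradPair X κ)) W f₂ (energy W f₂) := by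
  obtain ⟨f₂, hf₂⟩ := exists_isGround hW (isClosed_orthIn hS f.fst) (hc.mono (orthIn_le _)) hne
  refine ⟨f₂, hf₂, (isEigenpair_iff hW).2 ⟨hf₂.1.1, ne_zero_of_norm_one hf₂.2.1, fun g hg => ?_⟩⟩
  have h2 := ((isEigenpair_iff hW).1 (hf₂.isEigenpair hW)).2.2
  -- Minimality of `f₂` gives the eigenvalue equation against the complement of `f` only. It also
  -- holds against `f`, because the form of `f` and `f₂` is a multiple of their inner product, which
  -- vanishes. Splitting a test vector along `f` then covers all of `S`.
  have h1 : inner ℂ f (formOp hW (energy W f₂) f₂) = 0 := by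
    have h3 := (hf.isEigenpair hW).2.2 f₂ hf₂.1.1
    have h4 := hf₂.1.2
    rw [inner_formOp, ← schrodingerForm_conj hW, h3, ← inner_conj_symm f₂.fst, h4]
    simp
  set c := inner ℂ f.fst g.fst with hcdef
  have hg' : g - c • f ∈ orthIn S f.fst := by
    refine ⟨S.sub_mem hg (S.smul_mem c hf.1), ?_⟩
    rw [WithLp.sub_fst, WithLp.smul_fst, inner_sub_right, inner_smul_right, inner_self_fst, hf.2.1]
    simp [hcdef]
  have h5 := h2 _ hg'
  rw [inner_sub_left, inner_smul_left, h1, mul_zero, sub_zero] at h5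
  exact h5

theorem linearIndependent_pair_of_orthogonal {f g : Lp ℂ 2 (volume : Measure X)} (hf : f ≠ 0)
    (hg : g ≠ 0) (h : inner ℂ f g = 0) : LinearIndependent ℂ ![f, g] := by
  rw [LinearIndependent.pair_iff' hf]
  rintro c rfl
  rw [inner_smul_right, inner_self_eq_norm_sq_to_K] at h
  rcases mul_eq_zero.1 h with h | h
  · exact hg (by rw [h, zero_smul])
  · exact hf (by simpa using h)

/-- The bound `m` makes the infimum a genuine one: the `sInf` of a set of reals unbounded below
would be `0`. -/
theorem eigenvalue_two_le (hW : MemLp W ∞ (volume : Measure X)) {m : ℝ}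
    (hm : ∀ g ∈ S, m * ‖g.fst‖ ^ 2 ≤ energy W g) {f g : GradPair X κ} {a b t : ℝ}
    (hf : IsEigenpair (S : Set (GradPair X κ)) W f a)
    (hg : IsEigenpair (S : Set (GradPair X κ)) W g b) (hat : a ≤ t) (hbt : b ≤ t)
    (hfg : LinearIndependent ℂ ![f.fst, g.fst]) :
    eigenvalue (S : Set (GradPair X κ)) W 2 ≤ t := by
  refine csInf_le ⟨m, bddBelow_eigenvalue hW hm two_pos⟩ ⟨![f, g], ?_, ?_⟩
  · convert hfg using 1
    ext i; fin_cases i <;> rfl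
  · intro i
    fin_cases i
    exacts [⟨a, hat, hf⟩, ⟨b, hbt, hg⟩]

/-- The minimizer on the complement of `f` is a second, independent eigenfunction, so the second
eigenvalue is at most its energy, which is minimal among normalized competitors orthogonal to `f`.
-/
theorem IsGround.eigenvalue_two_le_energy (hW : MemLp W ∞ (volume : Measure X))
    (hS : IsClosed (S : Set (GradPair X κ))) (hc : HasCompactEmbedding S) {f : GradPair X κ}
    (hf : IsGround S W f) {g : GradPair X κ} (hg : g ∈ S) (hfg : inner ℂ f.fst g.fst = 0) :
    eigenvalue (S : Set (GradPair X κ)) W 2 * ‖g.fst‖ ^ 2 ≤ energy W g := by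
  refine le_energy_of_normalized (S := orthIn S f.fst) (fun g hg h1 => ?_) ⟨hg, hfg⟩
  obtain ⟨f₂, h₂, he⟩ := hf.exists_second hW hS hc ⟨g, hg, ne_zero_of_norm_one h1⟩
  have h3 := h₂.2.2 g hg
  have h4 := hf.2.2 f₂ h₂.1.1
  rw [h₂.2.1] at h4
  rw [h1] at h3
  refine (eigenvalue_two_le hW hf.2.2 (hf.isEigenpair hW) he (by linarith) le_rfl
    (linearIndependent_pair_of_orthogonal (ne_zero_of_norm_one hf.2.1)
      (ne_zero_of_norm_one h₂.2.1) h₂.1.2)).trans (by linarith)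

/-- A two-dimensional span meets every hyperplane; this is the dimension count in the max-min
principle. -/
theorem exists_combination_orthogonal {f g : Lp ℂ 2 (volume : Measure X)}
    (h : LinearIndependent ℂ ![f, g]) (q : Lp ℂ 2 (volume : Measure X)) :
    ∃ a b : ℂ, a • f + b • g ≠ 0 ∧ inner ℂ q (a • f + b • g) = 0 := by
  rw [LinearIndependent.pair_iff] at h
  by_cases h0 : inner ℂ q f = 0
  · refine ⟨1, 0, fun h1 => one_ne_zero (h 1 0 h1).1, by simp [h0]⟩
  · refine ⟨inner ℂ q g, -inner ℂ q f, fun h1 => h0 (neg_eq_zero.1 (h _ _ h1).2), ?_⟩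
    rw [inner_add_right, inner_smul_right, inner_smul_right]; ring

/-- On the span of two eigenfunctions the energy is at most the larger eigenvalue. -/
theorem energy_combination_le (hW : MemLp W ∞ (volume : Measure X)) {f g : GradPair X κ}
    {a b t : ℝ} (hf : IsEigenpair (S : Set (GradPair X κ)) W f a)
    (hg : IsEigenpair (S : Set (GradPair X κ)) W g b) (hat : a ≤ t) (hbt : b ≤ t) (α β : ℂ) :
    energy W (α • f + β • g) ≤ t * ‖(α • f + β • g).fst‖ ^ 2 := by
  have hff := hf.2.2 f hf.1
  have hgg := hg.2.2 g hg.1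
  have hfg := hg.2.2 f hf.1
  have hgf := hf.2.2 g hg.1
  -- Symmetry of the form: eigenfunctions are orthogonal unless their eigenvalues coincide.
  have hor : ((a : ℂ) - b) * inner ℂ f.fst g.fst = 0 := by
    have h := schrodingerForm_conj hW g f
    rw [hgf, hfg, map_mul, Complex.conj_ofReal, inner_conj_symm] at h
    linear_combination h
  suffices h : (inner ℂ (α • f + β • g) (formOp hW t (α • f + β • g))).re ≤ 0 by
    rw [re_inner_formOp_self] at h; linarith
  have key : inner ℂ (α • f + β • g) (formOp hW t (α • f + β • g)) =
      ((‖α‖ ^ 2 * (a - t) * ‖f.fst‖ ^ 2 + ‖β‖ ^ 2 * (b - t) * ‖g.fst‖ ^ 2 : ℝ) : ℂ)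
      + (conj α * β * ((b - t) * inner ℂ f.fst g.fst) +
          conj (conj α * β) * ((a - t) * inner ℂ g.fst f.fst)) := by
    simp only [map_add, map_smul, inner_add_left, inner_add_right, inner_smul_left,
      inner_smul_right, inner_formOp, hff, hgg, hfg, hgf, inner_self_fst]
    have ea : conj α * α = ((‖α‖ ^ 2 : ℝ) : ℂ) := by rw [Complex.conj_mul']; push_cast; rfl
    have eb : conj β * β = ((‖β‖ ^ 2 : ℝ) : ℂ) := by rw [Complex.conj_mul']; push_cast; rfl
    push_cast at ea eb ⊢
    simp only [map_mul, Complex.conj_conj]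
    linear_combination ((a : ℂ) - t) * (‖f.fst‖ : ℂ) ^ 2 * ea + ((b : ℂ) - t) * (‖g.fst‖ : ℂ) ^ 2 * eb
  have hA : ‖α‖ ^ 2 * (a - t) * ‖f.fst‖ ^ 2 ≤ 0 := by
    have : 0 ≤ ‖α‖ ^ 2 * (t - a) * ‖f.fst‖ ^ 2 := by
      have := sub_nonneg.2 hat; positivity
    nlinarith
  have hB : ‖β‖ ^ 2 * (b - t) * ‖g.fst‖ ^ 2 ≤ 0 := by
    have : 0 ≤ ‖β‖ ^ 2 * (t - b) * ‖g.fst‖ ^ 2 := by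
      have := sub_nonneg.2 hbt; positivity
    nlinarith
  -- For orthogonal eigenfunctions the cross terms drop out. Otherwise `a = b`, and the whole span
  -- solves a single eigenvalue equation.
  by_cases h0 : inner ℂ f.fst g.fst = 0
  · have h0' : inner ℂ g.fst f.fst = 0 := by rw [← inner_conj_symm, h0, map_zero]
    rw [key, h0, h0']
    simp only [mul_zero, add_zero, Complex.ofReal_re]
    linarith
  · have hab : a = b := by
      have := (mul_eq_zero.1 hor).resolve_right h0
      exact_mod_cast sub_eq_zero.1 this
    subst hab
    have e : inner ℂ (α • f + β • g) (formOp hW t (α • f + β • g)) =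
        (((a - t) * ‖(α • f + β • g).fst‖ ^ 2 : ℝ) : ℂ) := by
      have : schrodingerForm W (α • f + β • g) (α • f + β • g) =
          (a : ℂ) * inner ℂ (α • f + β • g).fst (α • f + β • g).fst := by
        have h1 : ∀ h ∈ S, inner ℂ h (formOp hW a (α • f + β • g)) = 0 := fun h hh => by
          rw [map_add, map_smul, map_smul, inner_add_right, inner_smul_right, inner_smul_right,
            ((isEigenpair_iff hW).1 hf).2.2 h hh, ((isEigenpair_iff hW).1 hg).2.2 h hh]
          simp
        have h2 := h1 _ (S.add_mem (S.smul_mem α hf.1) (S.smul_mem β hg.1))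
        rw [inner_formOp] at h2
        exact sub_eq_zero.1 h2
      rw [inner_formOp, this, inner_self_fst]
      push_cast; ring
    rw [e, Complex.ofReal_re]
    have : 0 ≤ (t - a) * ‖(α • f + β • g).fst‖ ^ 2 := by
      have := sub_nonneg.2 hat; positivity
    nlinarith

/-- A lower bound for the energy on a subspace of codimension one is a lower bound for the second
eigenvalue. -/
theorem le_eigenvalue_two (hW : MemLp W ∞ (volume : Measure X)) {c : ℝ}
    (q : Lp ℂ 2 (volume : Measure X))
    (h : ∀ g ∈ S, inner ℂ q g.fst = 0 → c * ‖g.fst‖ ^ 2 ≤ energy W g)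
    (hne : ∃ (f g : GradPair X κ) (a b : ℝ), IsEigenpair (S : Set (GradPair X κ)) W f a ∧
      IsEigenpair (S : Set (GradPair X κ)) W g b ∧ LinearIndependent ℂ ![f.fst, g.fst]) :
    c ≤ eigenvalue (S : Set (GradPair X κ)) W 2 := by
  -- Nonemptiness is essential: the infimum of the empty set of reals is `0` by convention.
  refine le_csInf ?_ ?_
  · obtain ⟨f, g, a, b, hf, hg, hfg⟩ := hne
    refine ⟨max a b, ![f, g], ?_, fun i => ?_⟩
    · convert hfg using 1
      ext i; fin_cases i <;> rfl
    · fin_cases i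
      exacts [⟨a, le_max_left _ _, hf⟩, ⟨b, le_max_right _ _, hg⟩]
  · rintro t ⟨f, hli, he⟩
    obtain ⟨a, hat, ha⟩ := he 0
    obtain ⟨b, hbt, hb⟩ := he 1
    have hli' : LinearIndependent ℂ ![(f 0).fst, (f 1).fst] := by
      convert hli using 1
      ext i; fin_cases i <;> rfl
    obtain ⟨α, β, hne, hor⟩ := exists_combination_orthogonal hli' q
    have hmem := S.add_mem (S.smul_mem α ha.1) (S.smul_mem β hb.1)
    have h1 := h _ hmem hor
    have h2 := h1.trans (energy_combination_le hW ha hb hat hbt α β)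
    refine le_of_mul_le_mul_right h2 ?_
    have : 0 < ‖(α • f 0 + β • f 1).fst‖ := norm_pos_iff.2 hne
    positivity

end Eigenvalues

/-! ### Compactness of the embedding of `H¹₀` of a bounded set into `L²` -/

section WeakCompactness

variable {H : Type*} [NormedAddCommGroup H] [InnerProductSpace ℂ H] [CompleteSpace H]
  [TopologicalSpace.SeparableSpace H]

/-- Bounded sequences in a separable Hilbert space have weakly convergent subsequences. -/
theorem exists_weakly_convergent_subseq (f : ℕ → H) (C : ℝ) (hC : ∀ n, ‖f n‖ ≤ C) :
    ∃ (w : H) (σ : ℕ → ℕ), StrictMono σ ∧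
      ∀ g : H, Tendsto (fun n => inner ℂ g (f (σ n))) atTop (𝓝 (inner ℂ g w)) := by
  -- Riesz representation turns vectors into functionals, to which sequential Banach–Alaoglu
  -- applies; the conjugations below undo the antilinearity of that identification.
  have hs := WeakDual.isSeqCompact_closedBall ℂ H (0 : StrongDual ℂ H) C
  obtain ⟨l, -, σ, hσ, hl⟩ := hs
    (x := fun n => StrongDual.toWeakDual (InnerProductSpace.toDual ℂ H (f n))) (fun n => by
      rw [mem_preimage, mem_closedBall_zero_iff]
      refine le_trans (le_of_eq ?_) (hC n)
      exact (InnerProductSpace.toDual ℂ H).norm_map (f n))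
  refine ⟨(InnerProductSpace.toDual ℂ H).symm (WeakDual.toStrongDual l), σ, hσ, fun g => ?_⟩
  have h1 := ((WeakDual.eval_continuous g).tendsto l).comp hl
  have h2 := (Complex.continuous_conj.tendsto _).comp h1
  have e : (inner ℂ g ((InnerProductSpace.toDual ℂ H).symm (WeakDual.toStrongDual l)) : ℂ)
      = conj (l g) := by
    rw [← inner_conj_symm, InnerProductSpace.toDual_symm_apply]; rfl
  rw [e]
  refine h2.congr fun n => ?_
  simp only [Function.comp_apply]
  rw [← inner_conj_symm]
  rfl

end WeakCompactness

section Lintegral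

variable {α : Type*} [MeasurableSpace α] {μ : Measure α}

theorem sq_eLpNorm_two {E : Type*} [NormedAddCommGroup E] (f : α → E) :
    eLpNorm f 2 μ ^ 2 = ∫⁻ x, ‖f x‖ₑ ^ 2 ∂μ := by
  have := eLpNorm_nnreal_pow_eq_lintegral (p := 2) (f := f) (μ := μ) two_ne_zero
  simpa using this

/-- Hölder's inequality against the constant `1`, whose `L²` norm is one for a probability measure.
-/
theorem sq_lintegral_le [IsProbabilityMeasure μ] {f : α → ℝ≥0∞} (hf : AEMeasurable f μ) :
    (∫⁻ x, f x ∂μ) ^ 2 ≤ ∫⁻ x, f x ^ 2 ∂μ := by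
  have h := ENNReal.lintegral_mul_le_Lp_mul_Lq μ Real.HolderConjugate.two_two hf
    (aemeasurable_const (b := (1 : ℝ≥0∞)))
  simp only [Pi.mul_apply, mul_one, lintegral_const, measure_univ, ENNReal.rpow_ofNat, one_pow,
    ENNReal.one_rpow] at h
  calc (∫⁻ x, f x ∂μ) ^ 2 ≤ ((∫⁻ x, f x ^ 2 ∂μ) ^ (1 / 2 : ℝ)) ^ 2 := by gcongr
    _ = _ := by
      rw [← ENNReal.rpow_natCast, ← ENNReal.rpow_mul]; simp

theorem sq_enorm_integral_le [IsProbabilityMeasure μ] {E : Type*} [NormedAddCommGroup E]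
    [NormedSpace ℝ E] {f : α → E} (hf : AEStronglyMeasurable f μ) :
    ‖∫ x, f x ∂μ‖ₑ ^ 2 ≤ ∫⁻ x, ‖f x‖ₑ ^ 2 ∂μ :=
  (pow_le_pow_left₀ zero_le (enorm_integral_le_lintegral_enorm f) 2).trans
    (sq_lintegral_le hf.enorm)

end Lintegral

section Rellich

variable {X : Type*} [NormedAddCommGroup X] [NormedSpace ℝ X] [MeasureSpace X] [BorelSpace X]
  [FiniteDimensional ℝ X] [(volume : Measure X).IsAddHaarMeasure]
  {κ : Type*} [Fintype κ] {e : κ → X}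

/-- Because `e` spans, the map from coefficients to vectors has a linear right inverse, continuous
in finite dimension; expanding `h` with its coefficients bounds the derivative along `h` by the
gradient in the directions `e`. -/
theorem exists_norm_fderiv_le (he : Submodule.span ℝ (range e) = ⊤) :
    ∃ C : ℝ, 0 ≤ C ∧ ∀ (φ : X → ℂ) (x h : X), ‖fderiv ℝ φ x h‖ ≤ C * ‖h‖ * ‖grad e φ x‖ := by
  set L : (κ → ℝ) →ₗ[ℝ] X := Fintype.linearCombination ℝ e
  have hL : LinearMap.range L = ⊤ := by rw [Fintype.range_linearCombination, he]
  obtain ⟨g, hg⟩ := L.exists_rightInverse_of_surjective hL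
  set G := LinearMap.toContinuousLinearMap g
  refine ⟨Fintype.card κ * ‖G‖, by positivity, fun φ x h => ?_⟩
  have h1 : h = ∑ k, G h k • e k := by
    have := LinearMap.congr_fun hg h
    simp only [LinearMap.comp_apply, LinearMap.id_apply] at this
    rw [← Fintype.linearCombination_apply]
    exact this.symm
  have h2 : fderiv ℝ φ x h = ∑ k, (G h k : ℂ) * grad e φ x k := by
    conv_lhs => rw [h1]
    rw [map_sum]
    refine Finset.sum_congr rfl fun k _ => ?_
    rw [map_smul, Complex.real_smul]; rfl
  rw [h2]
  refine (norm_sum_le _ _).trans ?_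
  have h3 : ∀ k ∈ Finset.univ, ‖(G h k : ℂ) * grad e φ x k‖ ≤ ‖G‖ * ‖h‖ * ‖grad e φ x‖ := by
    intro k _
    rw [norm_mul, Complex.norm_real]
    gcongr
    · exact (norm_le_pi_norm (G h) k).trans (G.le_opNorm h)
    · exact PiLp.norm_apply_le (grad e φ x) k
  refine (Finset.sum_le_card_nsmul _ _ _ h3).trans (le_of_eq ?_)
  rw [Finset.card_univ, nsmul_eq_mul]; ring

theorem continuous_grad {φ : X → ℂ} (hφ : ContDiff ℝ ((⊤ : ℕ∞) : WithTop ℕ∞) φ) :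
    Continuous (grad e φ) := by
  have := hφ.continuous_fderiv (by simp)
  unfold grad
  fun_prop

/-- The modulus of continuity of translations in `L²` is controlled by the gradient. -/
theorem lintegral_translate_sub_le {C : ℝ} (hC0 : 0 ≤ C)
    (hC : ∀ (φ : X → ℂ) (x h : X), ‖fderiv ℝ φ x h‖ ≤ C * ‖h‖ * ‖grad e φ x‖)
    {φ : X → ℂ} (hφ : ContDiff ℝ ((⊤ : ℕ∞) : WithTop ℕ∞) φ) (h : X) :
    ∫⁻ x, ‖φ (x + h) - φ x‖ₑ ^ 2 ≤
      ENNReal.ofReal (C * ‖h‖) ^ 2 * ∫⁻ x, ‖grad e φ x‖ₑ ^ 2 := by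
  have hd : Differentiable ℝ φ := hφ.differentiable (by simp)
  have hcont : Continuous fun p : X × ℝ => fderiv ℝ φ (p.1 + p.2 • h) h := by
    have := hφ.continuous_fderiv (by simp)
    fun_prop
  have hg := continuous_grad (e := e) hφ
  have : IsProbabilityMeasure ((volume : Measure ℝ).restrict (Ioc (0 : ℝ) 1)) :=
    ⟨by simp⟩
  -- The increment is the integral of the derivative along the segment from `x` to `x + h`. Jensen's
  -- inequality on the unit interval moves the square inside, and translation invariance then
  -- removes the dependence on `s`.
  have h1 : ∀ x, ‖φ (x + h) - φ x‖ₑ ^ 2 ≤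
      ∫⁻ s in Ioc (0 : ℝ) 1, ENNReal.ofReal (C * ‖h‖) ^ 2 * ‖grad e φ (x + s • h)‖ₑ ^ 2 := by
    intro x
    have hder : ∀ s : ℝ, HasDerivAt (fun s : ℝ => φ (x + s • h)) (fderiv ℝ φ (x + s • h) h) s := by
      intro s
      have h2 : HasDerivAt (fun s : ℝ => x + s • h) h s := by
        simpa using ((hasDerivAt_id s).smul_const h).const_add x
      exact (hd (x + s • h)).hasFDerivAt.comp_hasDerivAt s h2
    have hc : Continuous fun s : ℝ => fderiv ℝ φ (x + s • h) h :=
      hcont.comp (continuous_const.prodMk continuous_id)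
    have hftc := intervalIntegral.integral_eq_sub_of_hasDerivAt (a := 0) (b := 1)
      (fun s _ => hder s) (hc.intervalIntegrable _ _)
    simp only [one_smul, zero_smul, add_zero] at hftc
    rw [← hftc, intervalIntegral.integral_of_le zero_le_one]
    refine (sq_enorm_integral_le hc.aestronglyMeasurable).trans (lintegral_mono fun s => ?_)
    rw [← mul_pow]
    gcongr
    rw [← ofReal_norm (grad e φ (x + s • h)), ← ENNReal.ofReal_mul (by positivity), ← ofReal_norm]
    exact ENNReal.ofReal_le_ofReal (hC _ _ _)
  refine (lintegral_mono h1).trans ?_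
  rw [lintegral_lintegral_swap]
  · have : ∀ s : ℝ, ∫⁻ x, ENNReal.ofReal (C * ‖h‖) ^ 2 * ‖grad e φ (x + s • h)‖ₑ ^ 2 =
        ENNReal.ofReal (C * ‖h‖) ^ 2 * ∫⁻ x, ‖grad e φ x‖ₑ ^ 2 := fun s => by
      rw [lintegral_const_mul' _ _ (by finiteness)]
      congr 1
      exact lintegral_add_right_eq_self (fun x => ‖grad e φ x‖ₑ ^ 2) (s • h)
    simp only [this, lintegral_const, measure_univ, mul_one, le_refl]
  · have hm : Continuous fun p : X × ℝ => grad e φ (p.1 + p.2 • h) := by fun_prop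
    exact ((hm.enorm.measurable.pow_const 2).const_mul _).aemeasurable

/-- Averages over a probability measure `P` on the ball of radius `δ` are close in `L²`. -/
theorem lintegral_average_sub_le {C : ℝ} (hC0 : 0 ≤ C)
    (hC : ∀ (φ : X → ℂ) (x h : X), ‖fderiv ℝ φ x h‖ ≤ C * ‖h‖ * ‖grad e φ x‖)
    {φ : X → ℂ} (hφ : ContDiff ℝ ((⊤ : ℕ∞) : WithTop ℕ∞) φ) (hs : HasCompactSupport φ)
    (P : Measure X) [IsProbabilityMeasure P] {δ : ℝ} (hP : ∀ᵐ h ∂P, ‖h‖ ≤ δ) :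
    ∫⁻ x, ‖(∫ h, φ (x + h) ∂P) - φ x‖ₑ ^ 2 ≤
      ENNReal.ofReal (C * δ) ^ 2 * ∫⁻ x, ‖grad e φ x‖ₑ ^ 2 := by
  have hcont := hφ.continuous
  obtain ⟨K, hK⟩ := hs.exists_bound_of_continuous hcont
  have hint : ∀ x, Integrable (fun h => φ (x + h)) P := fun x =>
    Integrable.of_bound (by fun_prop) K (Eventually.of_forall fun h => hK _)
  have h1 : ∀ x, ‖(∫ h, φ (x + h) ∂P) - φ x‖ₑ ^ 2 ≤ ∫⁻ h, ‖φ (x + h) - φ x‖ₑ ^ 2 ∂P := by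
    intro x
    have : (∫ h, φ (x + h) ∂P) - φ x = ∫ h, (φ (x + h) - φ x) ∂P := by
      rw [integral_sub (hint x) (integrable_const _)]; simp
    rw [this]
    exact sq_enorm_integral_le (by fun_prop)
  refine (lintegral_mono h1).trans ?_
  rw [lintegral_lintegral_swap (by refine Continuous.aemeasurable ?_; fun_prop)]
  calc ∫⁻ h, ∫⁻ x, ‖φ (x + h) - φ x‖ₑ ^ 2 ∂volume ∂P
      ≤ ∫⁻ _, ENNReal.ofReal (C * δ) ^ 2 * (∫⁻ x, ‖grad e φ x‖ₑ ^ 2) ∂P := by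
        refine lintegral_mono_ae ?_
        filter_upwards [hP] with h hh
        refine (lintegral_translate_sub_le hC0 hC hφ h).trans ?_
        gcongr
    _ = _ := by simp

/-- Averages of a weakly convergent sequence of functions supported in a bounded set converge
in `L²`. -/
theorem tendsto_lintegral_average {φ : ℕ → X → ℂ} (hφ : ∀ n, Continuous (φ n)) {U : Set X}
    (hU : Bornology.IsBounded U) (hs : ∀ n x, x ∉ U → φ n x = 0)
    (F : ℕ → Lp ℂ 2 (volume : Measure X)) (hF : ∀ n, F n =ᵐ[volume] φ n) {M : ℝ}
    (hM : ∀ n, ‖F n‖ ≤ M) (w : Lp ℂ 2 (volume : Measure X))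
    (hw : ∀ g, Tendsto (fun n => inner ℂ g (F n)) atTop (𝓝 (inner ℂ g w))) (δ : ℝ) :
    ∃ T : X → ℂ, AEStronglyMeasurable T volume ∧
      Tendsto (fun n => eLpNorm (fun x =>
        (∫ h, φ n (x + h) ∂(volume[|Metric.ball (0 : X) δ])) - T x) 2 volume) atTop (𝓝 0) := by
  set V := (volume : Measure X).real (Metric.ball (0 : X) δ) with hV
  have hfin : ∀ x : X, volume (Metric.ball x δ) ≠ ∞ := fun x => measure_ball_lt_top.ne
  -- A ball average is a multiple of the inner product with an `L²` indicator, so weak convergence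
  -- gives pointwise convergence of the averages, bounded uniformly in `n` and `x`.
  have hT : ∀ n x, ∫ h, φ n (x + h) ∂(volume[|Metric.ball (0 : X) δ]) = (V⁻¹ : ℝ) •
      inner ℂ (indicatorConstLp 2 Metric.isOpen_ball.measurableSet (hfin x) (1 : ℂ)) (F n) := by
    intro n x
    rw [L2.inner_indicatorConstLp_one, ProbabilityTheory.cond, integral_smul_measure,
      ENNReal.toReal_inv]
    congr 1
    rw [setIntegral_congr_ae (g := φ n) Metric.isOpen_ball.measurableSet
      ((hF n).mono fun y hy _ => hy), ← integral_indicator Metric.isOpen_ball.measurableSet,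
      ← integral_indicator Metric.isOpen_ball.measurableSet,
      ← integral_add_left_eq_self (fun y => (Metric.ball x δ).indicator (φ n) y) x]
    refine integral_congr_ae (Eventually.of_forall fun h => ?_)
    simp only [indicator, Metric.mem_ball, dist_zero_right, dist_self_add_left]
  set T : X → ℂ := fun x => (V⁻¹ : ℝ) •
      inner ℂ (indicatorConstLp 2 Metric.isOpen_ball.measurableSet (hfin x) (1 : ℂ)) w with hTdef
  have hlim : ∀ x, Tendsto (fun n => ∫ h, φ n (x + h) ∂(volume[|Metric.ball (0 : X) δ])) atTop
      (𝓝 (T x)) := fun x => by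
    simp only [hT]; exact (hw _).const_smul _
  set K : ℝ := V⁻¹ * (V ^ (1 / 2 : ℝ) * M) with hKdef
  have hVx : ∀ x : X, (volume : Measure X).real (Metric.ball x δ) = V := fun x => by
    rw [hV, Measure.real, Measure.real, Measure.addHaar_ball_center]
  have hK : ∀ n x, ‖∫ h, φ n (x + h) ∂(volume[|Metric.ball (0 : X) δ])‖ ≤ K := by
    intro n x
    have hV0 : 0 ≤ V := measureReal_nonneg
    rw [hT, norm_smul, norm_inv, Real.norm_of_nonneg hV0]
    refine mul_le_mul_of_nonneg_left ((norm_inner_le_norm _ _).trans ?_) (by positivity)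
    rw [norm_indicatorConstLp (by norm_num) (by norm_num), hVx]
    simp only [norm_one, one_mul, ENNReal.toReal_ofNat]
    gcongr
    exact hM n
  have hzero : ∀ n x, x ∉ Metric.thickening δ U →
      ∫ h, φ n (x + h) ∂(volume[|Metric.ball (0 : X) δ]) = 0 := by
    intro n x hx
    refine integral_eq_zero_of_ae ?_
    filter_upwards [ProbabilityTheory.ae_cond_mem (μ := (volume : Measure X))
      (Metric.isOpen_ball (x := (0 : X)) (ε := δ)).measurableSet] with h hh
    refine hs n _ fun hU' => hx (Metric.mem_thickening_iff.2 ⟨_, hU', ?_⟩)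
    simpa using hh
  have hmeasn : ∀ n, StronglyMeasurable
      fun x => ∫ h, φ n (x + h) ∂(volume[|Metric.ball (0 : X) δ]) := fun n => by
    have hc : Continuous fun p : X × X => φ n (p.1 + p.2) := (hφ n).comp (by fun_prop)
    exact hc.stronglyMeasurable.integral_prod_right
  have hmeasT : StronglyMeasurable T :=
    stronglyMeasurable_of_tendsto atTop hmeasn (tendsto_pi_nhds.2 hlim)
  refine ⟨T, hmeasT.aestronglyMeasurable, ?_⟩
  have hTK : ∀ x, ‖T x‖ ≤ K := fun x => le_of_tendsto' (hlim x).norm fun n => hK n x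
  have hT0 : ∀ x, x ∉ Metric.thickening δ U → T x = 0 := fun x hx =>
    tendsto_nhds_unique (hlim x) (by simp [hzero _ x hx])
  have hmU : MeasurableSet (Metric.thickening δ U) := Metric.isOpen_thickening.measurableSet
  have hUfin : volume (Metric.thickening δ U) < ∞ := hU.thickening.measure_lt_top
  -- The averages vanish off the `δ`-thickening of `U`, which has finite volume, so a constant on it
  -- is an integrable majorant.
  have hdct : Tendsto (fun n => ∫⁻ x, ‖(∫ h, φ n (x + h) ∂(volume[|Metric.ball (0 : X) δ]))
      - T x‖ₑ ^ 2) atTop (𝓝 (∫⁻ _ : X, 0)) := by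
    refine tendsto_lintegral_of_dominated_convergence
      ((Metric.thickening δ U).indicator fun _ => ENNReal.ofReal (2 * K) ^ 2)
      (fun n => ((hmeasn n).sub hmeasT).enorm.pow_const 2)
      (fun n => Eventually.of_forall fun x => ?_) ?_ (Eventually.of_forall fun x => ?_)
    · by_cases hx : x ∈ Metric.thickening δ U
      · simp only [indicator_of_mem hx]
        gcongr
        rw [← ofReal_norm]
        refine ENNReal.ofReal_le_ofReal ((norm_sub_le _ _).trans ?_)
        linarith [hK n x, hTK x]
      · simp only [hzero n x hx, hT0 x hx]
        simp
    · rw [lintegral_indicator hmU, setLIntegral_const]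
      finiteness
    · have := ((hlim x).sub_const (T x)).enorm
      rw [sub_self, enorm_zero] at this
      simpa [Function.comp_def] using (ENNReal.continuous_pow 2).tendsto 0 |>.comp this
  rw [lintegral_zero] at hdct
  have h3 : Tendsto (fun n => eLpNorm (fun x =>
      (∫ h, φ n (x + h) ∂(volume[|Metric.ball (0 : X) δ])) - T x) 2 volume ^ 2) atTop (𝓝 0) := by
    simpa only [sq_eLpNorm_two] using hdct
  have h4 := (ENNReal.continuous_rpow_const (y := (1 / 2 : ℝ))).tendsto 0 |>.comp h3
  simp only [Function.comp_def, ← ENNReal.rpow_natCast, ← ENNReal.rpow_mul] at h4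
  simpa using h4

theorem memLp_of_continuous_of_hasCompactSupport {E : Type*} [NormedAddCommGroup E]
    {φ : X → E} (h : Continuous φ) (hs : HasCompactSupport φ) (p : ℝ≥0∞) :
    MemLp φ p (volume : Measure X) := h.memLp_of_hasCompactSupport hs

theorem eLpNorm_coeFn {E : Type*} [NormedAddCommGroup E] (f : Lp E 2 (volume : Measure X)) :
    eLpNorm f 2 volume = ENNReal.ofReal ‖f‖ := by
  rw [Lp.norm_def, ENNReal.ofReal_toReal (Lp.eLpNorm_ne_top f)]

theorem norm_fst_le_norm (f : GradPair X κ) : ‖f.fst‖ ≤ ‖f‖ := WithLp.norm_fst_le _ f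

theorem norm_snd_le_norm (f : GradPair X κ) : ‖f.snd‖ ≤ ‖f‖ := WithLp.norm_snd_le _ f

/-- Compactness for sequences of test functions. -/
theorem exists_subseq_tendsto_of_testPairs (he : Submodule.span ℝ (range e) = ⊤) {U : Set X}
    (hU : Bornology.IsBounded U) (p : ℕ → GradPair X κ) (hp : ∀ n, p n ∈ testPairs e U) {M : ℝ}
    (hM : ∀ n, ‖p n‖ ≤ M) :
    ∃ (w : Lp ℂ 2 (volume : Measure X)) (σ : ℕ → ℕ), StrictMono σ ∧
      Tendsto (fun n => (p (σ n)).fst) atTop (𝓝 w) := by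
  obtain ⟨C, hC0, hC⟩ := exists_norm_fderiv_le he
  choose φ hφ hcs hsupp hfst hsnd using hp
  have hM1 : ∀ n, ‖(p n).fst‖ ≤ M := fun n => (norm_fst_le_norm (p n)).trans (hM n)
  have hM2 : ∀ n, ‖(p n).snd‖ ≤ M := fun n => (norm_snd_le_norm (p n)).trans (hM n)
  have hM0 : 0 ≤ M := (norm_nonneg _).trans (hM 0)
  have : ProperSpace X := FiniteDimensional.proper ℝ X
  have : Fact ((2 : ℝ≥0∞) ≠ ∞) := ⟨by norm_num⟩
  obtain ⟨w, σ, hσ, hw⟩ := exists_weakly_convergent_subseq (fun n => (p n).fst) M hM1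
  suffices hcau : CauchySeq fun n => (p (σ n)).fst by
    obtain ⟨v, hv⟩ := cauchySeq_tendsto_of_complete hcau
    exact ⟨v, σ, hσ, hv⟩
  have hz : ∀ n x, x ∉ U → φ (σ n) x = 0 := fun n x hx =>
    image_eq_zero_of_notMem_tsupport fun h => hx (hsupp _ h)
  rw [EMetric.cauchySeq_iff]
  intro ε hε
  obtain ⟨η, hη0, hη⟩ : ∃ η : ℝ, 0 < η ∧ ENNReal.ofReal η < ε / 4 := by
    have h4 : 0 < ε / 4 := ENNReal.div_pos hε.ne' (by norm_num)
    obtain ⟨q, hq0, hq⟩ := ENNReal.lt_iff_exists_nnreal_btwn.1 h4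
    exact ⟨q, by exact_mod_cast hq0, by simpa using hq⟩
  -- The averaging error is at most `C δ M`, hence at most `η`; the `+ 1` covers `C * M = 0`.
  set δ : ℝ := η / (C * M + 1) with hδdef
  have hδ : 0 < δ := by positivity
  have hδη : C * δ * M ≤ η := by
    rw [hδdef]
    have : C * (η / (C * M + 1)) * M = η * ((C * M) / (C * M + 1)) := by ring
    rw [this]
    refine mul_le_of_le_one_right hη0.le ?_
    rw [div_le_one (by positivity)]
    linarith
  have : IsProbabilityMeasure (volume[|Metric.ball (0 : X) δ]) :=
    ProbabilityTheory.cond_isProbabilityMeasure_of_finite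
      (Metric.measure_ball_pos volume _ hδ).ne' measure_ball_lt_top.ne
  obtain ⟨T, hTm, hT⟩ := tendsto_lintegral_average (fun n => (hφ (σ n)).continuous) hU hz
    (fun n => (p (σ n)).fst) (fun n => hfst _) (fun n => hM1 _) w hw δ
  obtain ⟨n₀, hn₀⟩ := (hT.eventually (gt_mem_nhds
    (show 0 < ENNReal.ofReal η by simpa using hη0))).exists_forall_of_atTop
  have hclose : ∀ n, eLpNorm (fun x => (∫ h, φ (σ n) (x + h) ∂(volume[|Metric.ball (0 : X) δ]))
      - φ (σ n) x) 2 volume ≤ ENNReal.ofReal η := by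
    intro n
    refine (ENNReal.pow_le_pow_left_iff two_ne_zero).1 ?_
    rw [sq_eLpNorm_two]
    refine (lintegral_average_sub_le hC0 hC (hφ (σ n)) (hcs (σ n)) _ (δ := δ) ?_).trans ?_
    · filter_upwards [ProbabilityTheory.ae_cond_mem (μ := (volume : Measure X))
        (Metric.isOpen_ball (x := (0 : X)) (ε := δ)).measurableSet] with h hh
      exact (mem_ball_zero_iff.1 hh).le
    · rw [← sq_eLpNorm_two, ← eLpNorm_congr_ae (hsnd (σ n)), eLpNorm_coeFn, ← mul_pow,
        ← ENNReal.ofReal_mul (by positivity)]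
      gcongr
      exact (mul_le_mul_of_nonneg_left (hM2 _) (by positivity)).trans hδη
  have hmn : ∀ n, AEStronglyMeasurable
      (fun x => ∫ h, φ (σ n) (x + h) ∂(volume[|Metric.ball (0 : X) δ])) volume := fun n => by
    have hc : Continuous fun p : X × X => φ (σ n) (p.1 + p.2) :=
      (hφ (σ n)).continuous.comp (by fun_prop)
    exact hc.stronglyMeasurable.integral_prod_right.aestronglyMeasurable
  -- Averaging acts as intermediary: the averages are within `ε / 4` of their limit `T`, and each
  -- function is within `ε / 4` of its own average.
  have hone : ∀ n ≥ n₀, eLpNorm (fun x => φ (σ n) x - T x) 2 volume < ε / 2 := by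
    intro n hn
    have h1 : (fun x => φ (σ n) x - T x) =
        (fun x => (∫ h, φ (σ n) (x + h) ∂(volume[|Metric.ball (0 : X) δ])) - T x) -
        (fun x => (∫ h, φ (σ n) (x + h) ∂(volume[|Metric.ball (0 : X) δ])) - φ (σ n) x) := by
      ext x; simp
    rw [h1]
    refine (eLpNorm_sub_le ((hmn n).sub hTm)
      ((hmn n).sub (hφ _).continuous.aestronglyMeasurable) (by norm_num)).trans_lt ?_
    refine (add_le_add (hn₀ n hn).le (hclose n)).trans_lt ?_
    calc ENNReal.ofReal η + ENNReal.ofReal η < ε / 4 + ε / 4 := ENNReal.add_lt_add hη hη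
      _ = ε / 2 := by
        rw [ENNReal.div_add_div_same, ← two_mul]
        rw [show (4 : ℝ≥0∞) = 2 * 2 by norm_num]
        rw [ENNReal.mul_div_mul_left _ _ (by norm_num) (by norm_num)]
  refine ⟨n₀, fun m hm n hn => ?_⟩
  rw [Lp.edist_def, eLpNorm_congr_ae ((hfst (σ m)).sub (hfst (σ n)))]
  have h1 : φ (σ m) - φ (σ n) = (fun x => φ (σ m) x - T x) - (fun x => φ (σ n) x - T x) := by
    ext x; simp
  rw [h1]
  refine (eLpNorm_sub_le ((hφ _).continuous.aestronglyMeasurable.sub hTm)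
    ((hφ _).continuous.aestronglyMeasurable.sub hTm) (by norm_num)).trans_lt ?_
  calc _ < ε / 2 + ε / 2 := ENNReal.add_lt_add (hone m hm) (hone n hn)
    _ = ε := ENNReal.add_halves ε

/-- A sequence of test functions converging to an element of `H¹₀`. -/
theorem exists_testPairs_near {U : Set X} {f : GradPair X κ} (hf : f ∈ H10 e U) {ε : ℝ}
    (hε : 0 < ε) : ∃ p ∈ testPairs e U, ‖f - p‖ < ε := by
  obtain ⟨p, hp, h⟩ := Metric.mem_closure_iff.1 hf ε hε
  exact ⟨p, hp, by rwa [dist_eq_norm] at h⟩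

/-- **Rellich's theorem**. -/
theorem hasCompactEmbedding_H10 (he : Submodule.span ℝ (range e) = ⊤) {U : Set X}
    (hU : Bornology.IsBounded U) : HasCompactEmbedding (H10 e U) := by
  intro f hf C hC
  choose p hp hpf using fun n : ℕ =>
    exists_testPairs_near (hf n) (Nat.one_div_pos_of_nat (α := ℝ) (n := n))
  obtain ⟨w, σ, hσ, hw⟩ := exists_subseq_tendsto_of_testPairs he hU p hp (M := C + 1) fun n => by
    have h1 := norm_le_norm_add_norm_sub' (p n) (f n)
    have h2 := hpf n
    have h3 : 1 / ((n : ℝ) + 1) ≤ 1 := by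
      rw [div_le_one (by positivity)]; linarith [(Nat.cast_nonneg n : (0 : ℝ) ≤ n)]
    rw [norm_sub_rev] at h2
    linarith [hC n, norm_sub_rev (p n) (f n)]
  refine ⟨w, σ, hσ, ?_⟩
  have h0 : Tendsto (fun n => (f (σ n)).fst - (p (σ n)).fst) atTop (𝓝 0) := by
    refine squeeze_zero_norm (fun n => ?_)
      ((tendsto_one_div_add_atTop_nhds_zero_nat (𝕜 := ℝ)).comp hσ.tendsto_atTop)
    refine le_trans ?_ (hpf (σ n)).le
    rw [← WithLp.sub_fst]
    exact norm_fst_le_norm _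
  simpa using h0.add hw

theorem isClosed_H10 {U : Set X} : IsClosed (H10 e U : Set (GradPair X κ)) :=
  Submodule.isClosed_topologicalClosure _

end Rellich

/-! ### Test functions and localization in `H10` -/

section TestFunctions

variable {X : Type*} [NormedAddCommGroup X] [NormedSpace ℝ X] [MeasureSpace X] [BorelSpace X]
  [FiniteDimensional ℝ X] [(volume : Measure X).IsAddHaarMeasure]
  {κ : Type*} [Fintype κ] {e : κ → X}

theorem hasCompactSupport_grad {φ : X → ℂ} (hs : HasCompactSupport φ) :
    HasCompactSupport (grad e φ) := by
  refine hs.mono' fun x hx => ?_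
  by_contra h
  have h0 : fderiv ℝ φ x = 0 := image_eq_zero_of_notMem_tsupport
    (fun h' => h (tsupport_fderiv_subset ℝ h'))
  refine hx ?_
  ext k
  simp [grad, h0]

/-- The pair `(φ, ∇φ)` of a test function. -/
theorem exists_testPair {U : Set X} {φ : X → ℂ} (hφ : ContDiff ℝ ((⊤ : ℕ∞) : WithTop ℕ∞) φ)
    (hs : HasCompactSupport φ) (hU : tsupport φ ⊆ U) :
    ∃ p ∈ testPairs e U, p.fst =ᵐ[volume] φ ∧ p.snd =ᵐ[volume] grad e φ := by
  have h1 : MemLp φ 2 (volume : Measure X) := hφ.continuous.memLp_of_hasCompactSupport hs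
  have h2 : MemLp (grad e φ) 2 (volume : Measure X) :=
    (continuous_grad hφ).memLp_of_hasCompactSupport (hasCompactSupport_grad hs)
  exact ⟨WithLp.toLp 2 (h1.toLp _, h2.toLp _),
    ⟨φ, hφ, hs, hU, h1.coeFn_toLp, h2.coeFn_toLp⟩, h1.coeFn_toLp, h2.coeFn_toLp⟩

theorem testPairs_le_H10 {U : Set X} : testPairs e U ≤ H10 e U :=
  Submodule.le_topologicalClosure _

theorem testPairs_mono {U V : Set X} (h : U ⊆ V) : testPairs e U ≤ testPairs e V := by
  rintro p ⟨φ, h1, h2, h3, h4⟩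
  exact ⟨φ, h1, h2, h3.trans h, h4⟩

theorem H10_mono {U V : Set X} (h : U ⊆ V) : H10 e U ≤ H10 e V :=
  Submodule.topologicalClosure_mono (testPairs_mono h)

theorem exists_seq_testPairs {U : Set X} {f : GradPair X κ} (hf : f ∈ H10 e U) :
    ∃ p : ℕ → GradPair X κ, (∀ n, p n ∈ testPairs e U) ∧ Tendsto p atTop (𝓝 f) := by
  obtain ⟨p, hp, h⟩ := mem_closure_iff_seq_limit.1 (show f ∈ closure (testPairs e U : Set _) from hf)
  exact ⟨p, hp, h⟩

/-! ### Restriction to measurable sets -/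

theorem memLp_top_indicator {K : Set X} (hK : MeasurableSet K) :
    MemLp (K.indicator fun _ => (1 : ℝ)) ∞ (volume : Measure X) :=
  memLp_top_of_bound (stronglyMeasurable_const.indicator hK).aestronglyMeasurable 1
    (Eventually.of_forall fun x => by
      by_cases hx : x ∈ K <;> simp [hx])

/-- Multiplication of a pair by the indicator function of `K`. -/
def restrictL {K : Set X} (hK : MeasurableSet K) : GradPair X κ →L[ℂ] GradPair X κ :=
  (WithLp.prodContinuousLinearEquiv 2 ℂ _ _).symm.toContinuousLinearMap ∘L
    ((mulL (memLp_top_indicator hK)).prodMap (mulL (memLp_top_indicator hK))) ∘L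
      (WithLp.prodContinuousLinearEquiv 2 ℂ _ _).toContinuousLinearMap

theorem mulL_indicator {E : Type*} [NormedAddCommGroup E] [NormedSpace ℂ E] {K : Set X}
    (hK : MeasurableSet K) (f : Lp E 2 (volume : Measure X)) :
    mulL (memLp_top_indicator hK) f =ᵐ[volume] K.indicator f := by
  filter_upwards [coeFn_mulL (memLp_top_indicator hK) f] with x hx
  rw [hx]
  by_cases h : x ∈ K <;> simp [h]

theorem restrictL_fst {K : Set X} (hK : MeasurableSet K) (f : GradPair X κ) :
    (restrictL hK f).fst =ᵐ[volume] K.indicator f.fst := mulL_indicator hK f.fst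

theorem restrictL_snd {K : Set X} (hK : MeasurableSet K) (f : GradPair X κ) :
    (restrictL hK f).snd =ᵐ[volume] K.indicator f.snd := mulL_indicator hK f.snd

theorem mulL_indicator_add_compl {E : Type*} [NormedAddCommGroup E] [NormedSpace ℂ E] {K : Set X}
    (hK : MeasurableSet K) (f : Lp E 2 (volume : Measure X)) :
    mulL (memLp_top_indicator hK) f + mulL (memLp_top_indicator hK.compl) f = f := by
  refine Lp.ext ?_
  filter_upwards [Lp.coeFn_add (mulL (memLp_top_indicator hK) f)
    (mulL (memLp_top_indicator hK.compl) f), mulL_indicator hK f, mulL_indicator hK.compl f]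
    with x h1 h2 h3
  rw [h1, Pi.add_apply, h2, h3, indicator_self_add_compl_apply]

theorem restrictL_add_compl {K : Set X} (hK : MeasurableSet K) (f : GradPair X κ) :
    restrictL hK f + restrictL hK.compl f = f := by
  apply WithLp.ofLp_injective 2
  ext1
  · exact mulL_indicator_add_compl hK f.fst
  · exact mulL_indicator_add_compl hK f.snd

theorem norm_sq_mulL_indicator {E : Type*} [NormedAddCommGroup E] [InnerProductSpace ℂ E] {K : Set X}
    (hK : MeasurableSet K) (f : Lp E 2 (volume : Measure X)) :
    ‖f‖ ^ 2 = ‖mulL (memLp_top_indicator hK) f‖ ^ 2 + ‖mulL (memLp_top_indicator hK.compl) f‖ ^ 2 := by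
  rw [norm_sq_eq_integral, norm_sq_eq_integral, norm_sq_eq_integral,
    ← integral_add (integrable_norm_sq _) (integrable_norm_sq _)]
  refine integral_congr_ae ?_
  filter_upwards [mulL_indicator hK f, mulL_indicator hK.compl f] with x h2 h3
  rw [h2, h3]
  by_cases h : x ∈ K <;> simp [h]

theorem norm_sq_restrictL_fst {K : Set X} (hK : MeasurableSet K) (f : GradPair X κ) :
    ‖f.fst‖ ^ 2 = ‖(restrictL hK f).fst‖ ^ 2 + ‖(restrictL hK.compl f).fst‖ ^ 2 :=
  norm_sq_mulL_indicator hK f.fst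

theorem norm_sq_restrictL_snd {K : Set X} (hK : MeasurableSet K) (f : GradPair X κ) :
    ‖f.snd‖ ^ 2 = ‖(restrictL hK f).snd‖ ^ 2 + ‖(restrictL hK.compl f).snd‖ ^ 2 :=
  norm_sq_mulL_indicator hK f.snd

theorem energy_restrictL {W : X → ℝ} (hW : MemLp W ∞ (volume : Measure X)) {K : Set X}
    (hK : MeasurableSet K) (f : GradPair X κ) :
    energy W f = energy W (restrictL hK f) + energy W (restrictL hK.compl f) := by
  have h : ∫ x, W x * ‖f.fst x‖ ^ 2 = (∫ x, W x * ‖(restrictL hK f).fst x‖ ^ 2) +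
      ∫ x, W x * ‖(restrictL hK.compl f).fst x‖ ^ 2 := by
    rw [← integral_add (integrable_mul_norm_sq hW _) (integrable_mul_norm_sq hW _)]
    refine integral_congr_ae ?_
    filter_upwards [restrictL_fst hK f, restrictL_fst hK.compl f] with x h2 h3
    rw [h2, h3]
    by_cases h : x ∈ K <;> simp [h]
  rw [energy, energy, energy, norm_sq_restrictL_snd hK, h]
  ring

/-- Restriction to a relatively open and closed part `K` of `U` maps `H¹₀(U)` to `H¹₀(K)`. -/
theorem restrictL_mem_H10 {U K : Set X} (hK : IsOpen K) (hUK : IsOpen (U \ K)) {f : GradPair X κ}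
    (hf : f ∈ H10 e U) : restrictL hK.measurableSet f ∈ H10 e K := by
  refine map_mem_closure (restrictL hK.measurableSet).continuous hf ?_
  rintro p ⟨φ, h1, h2, h3, h4, h5⟩
  -- Cutting off by `K` keeps `φ` smooth because the support of `φ` avoids the boundary of `K`:
  -- inside `U` both `K` and its complement are open, and outside `U` the function vanishes locally.
  have hloc : ∀ x, (x ∈ K ∧ K.indicator φ =ᶠ[𝓝 x] φ) ∨ (x ∉ K ∧ K.indicator φ =ᶠ[𝓝 x] 0) := by
    intro x
    by_cases hx : x ∈ K
    · refine Or.inl ⟨hx, ?_⟩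
      filter_upwards [hK.mem_nhds hx] with y hy using indicator_of_mem hy _
    · right
      refine ⟨hx, ?_⟩
      by_cases hxU : x ∈ U
      · filter_upwards [hUK.mem_nhds ⟨hxU, hx⟩] with y hy using indicator_of_notMem hy.2 _
      · filter_upwards [(isClosed_tsupport φ).isOpen_compl.mem_nhds (fun h => hxU (h3 h))] with y hy
        by_cases hyK : y ∈ K
        · rw [indicator_of_mem hyK]; exact image_eq_zero_of_notMem_tsupport hy
        · rw [indicator_of_notMem hyK]; rfl
  have hsupp : tsupport (K.indicator φ) ⊆ K ∩ tsupport φ := by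
    -- Removing the open set `U \ K` from the closed support leaves a closed set, so the support of
    -- the cut-off function stays inside `K`.
    have hcl : K ∩ tsupport φ = tsupport φ \ (U \ K) := by
      ext x
      simp only [mem_inter_iff, Set.mem_sdiff, not_and, not_not]
      exact ⟨fun h => ⟨h.2, fun _ => h.1⟩, fun h => ⟨h.2 (h3 h.1), h.1⟩⟩
    refine closure_minimal (fun x hx => ?_) ?_
    · have hxK : x ∈ K := mem_of_indicator_ne_zero hx
      refine ⟨hxK, subset_tsupport φ ?_⟩
      rwa [Function.mem_support, indicator_of_mem hxK] at hx
    · rw [hcl]; exact (isClosed_tsupport φ).sdiff hUK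
  refine ⟨K.indicator φ, ?_, ?_, hsupp.trans inter_subset_left, ?_, ?_⟩
  · rw [contDiff_iff_contDiffAt]
    intro x
    rcases hloc x with ⟨-, h⟩ | ⟨-, h⟩
    · exact h1.contDiffAt.congr_of_eventuallyEq h
    · exact contDiffAt_const.congr_of_eventuallyEq h
  · exact h2.mono' ((subset_tsupport _).trans (hsupp.trans inter_subset_right))
  · filter_upwards [restrictL_fst hK.measurableSet p, h4] with x a b
    rw [a]
    by_cases hx : x ∈ K <;> simp [hx, b]
  · filter_upwards [restrictL_snd hK.measurableSet p, h5] with x a b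
    rw [a]
    rcases hloc x with ⟨hx, h⟩ | ⟨hx, h⟩
    · rw [indicator_of_mem hx, b]
      ext k
      simp [grad, h.fderiv_eq]
    · rw [indicator_of_notMem hx]
      ext k
      simp [grad, h.fderiv_eq]

/-- Elements of `H¹₀(U)` vanish outside `U`. -/
theorem ae_eq_zero_of_mem_H10 {U : Set X} (hU : MeasurableSet U) {f : GradPair X κ}
    (hf : f ∈ H10 e U) : ∀ᵐ x, x ∉ U → f.fst x = 0 := by
  -- Being unchanged by restriction to `U` is a closed condition, so it passes from test functions
  -- to their limits.
  have h : f ∈ {g : GradPair X κ | (restrictL hU g).fst = g.fst} := by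
    refine closure_minimal ?_ (isClosed_eq (continuous_fst.comp (restrictL hU).continuous)
      continuous_fst) hf
    rintro p ⟨φ, h1, h2, h3, h4, -⟩
    refine Lp.ext ?_
    filter_upwards [restrictL_fst hU p, h4] with x a b
    rw [Function.comp_apply, a]
    by_cases hx : x ∈ U
    · rw [indicator_of_mem hx]
    · rw [indicator_of_notMem hx, b, image_eq_zero_of_notMem_tsupport fun h => hx (h3 h)]
  filter_upwards [restrictL_fst hU f] with x hx hxU
  rw [← h, hx, indicator_of_notMem hxU]

end TestFunctions

/-! ### Nonlinear operations on `H10` -/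

section Composition

variable {X : Type*} [NormedAddCommGroup X] [NormedSpace ℝ X] [MeasureSpace X] [BorelSpace X]
  [FiniteDimensional ℝ X] [(volume : Measure X).IsAddHaarMeasure]
  {κ : Type*} [Fintype κ] {e : κ → X}

/-- Elements of `H¹₀(U)` with bounded gradients that approximate a function in `L²` produce an element
of `H¹₀(U)`. -/
theorem exists_mem_H10_of_approx {U : Set X} (hUm : MeasurableSet U) (hUb : Bornology.IsBounded U)
    {w : X → ℂ} (hw : AEStronglyMeasurable w volume) {p : ℕ → GradPair X κ}
    (hp : ∀ n, p n ∈ H10 e U) {A B : ℕ → Lp ℂ 2 (volume : Measure X)}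
    (hA : Tendsto A atTop (𝓝 0)) (hB : Tendsto B atTop (𝓝 0)) {δ : ℕ → ℝ}
    (hδ : Tendsto δ atTop (𝓝 0))
    (hpw : ∀ n, ∀ᵐ x, ‖(p n).fst x - w x‖ ≤ ‖A n x‖ + ‖B n x‖ + U.indicator (fun _ => |δ n|) x)
    {b : ℕ → ℝ} (hb : ∀ n, ‖(p n).snd‖ ^ 2 ≤ b n) {c : ℝ} (hc : Tendsto b atTop (𝓝 c)) :
    ∃ g ∈ H10 e U, g.fst =ᵐ[volume] w ∧ ‖g.snd‖ ^ 2 ≤ c := by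
  have hUfin : volume U < ∞ := hUb.measure_lt_top
  have hle : ∀ n, eLpNorm (fun x => (p n).fst x - w x) 2 volume ≤
      ENNReal.ofReal ‖A n‖ + ENNReal.ofReal ‖B n‖ + ENNReal.ofReal |δ n| * volume U ^ (1 / 2 : ℝ) := by
    intro n
    have h1 : eLpNorm (fun x => ‖A n x‖ + ‖B n x‖ + U.indicator (fun _ => |δ n|) x) 2 volume ≤
        eLpNorm (fun x => ‖A n x‖) 2 volume + eLpNorm (fun x => ‖B n x‖) 2 volume +
          eLpNorm (U.indicator (fun _ => |δ n|)) 2 volume := by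
      have hm1 : AEStronglyMeasurable (fun x => ‖A n x‖) volume := (Lp.aestronglyMeasurable _).norm
      have hm2 : AEStronglyMeasurable (fun x => ‖B n x‖) volume := (Lp.aestronglyMeasurable _).norm
      have hm3 : AEStronglyMeasurable (U.indicator (fun _ => |δ n|)) volume :=
        (stronglyMeasurable_const.indicator hUm).aestronglyMeasurable
      exact (eLpNorm_add_le (hm1.add hm2) hm3 (by norm_num)).trans
        (add_le_add_left (eLpNorm_add_le hm1 hm2 (by norm_num)) _)
    refine (eLpNorm_mono_ae_real (hpw n)).trans (h1.trans ?_)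
    rw [eLpNorm_norm, eLpNorm_norm, eLpNorm_coeFn, eLpNorm_coeFn,
      eLpNorm_indicator_const hUm (by norm_num) (by norm_num), Real.enorm_abs, ENNReal.toReal_ofNat,
      ← ofReal_norm (δ n), Real.norm_eq_abs]
  have hfin : ∀ n, ENNReal.ofReal ‖A n‖ + ENNReal.ofReal ‖B n‖ +
      ENNReal.ofReal |δ n| * volume U ^ (1 / 2 : ℝ) < ∞ := fun n => by finiteness
  have hdm : ∀ n, MemLp (fun x => (p n).fst x - w x) 2 volume := fun n =>
    ⟨(Lp.aestronglyMeasurable _).sub hw, (hle n).trans_lt (hfin n)⟩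
  have hwm : MemLp w 2 volume := by
    have := (Lp.memLp (p 0).fst).sub (hdm 0)
    refine this.ae_eq (Eventually.of_forall fun x => ?_)
    simp
  have hlim : Tendsto (fun n => ENNReal.ofReal ‖A n‖ + ENNReal.ofReal ‖B n‖ +
      ENNReal.ofReal |δ n| * volume U ^ (1 / 2 : ℝ)) atTop (𝓝 0) := by
    have h1 := ENNReal.tendsto_ofReal hA.norm
    have h2 := ENNReal.tendsto_ofReal hB.norm
    have h3 := ENNReal.Tendsto.mul_const (b := volume U ^ (1 / 2 : ℝ))
      (ENNReal.tendsto_ofReal hδ.abs) (Or.inr (by finiteness))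
    simpa using (h1.add h2).add h3
  have htend : Tendsto (fun n => (p n).fst) atTop (𝓝 (hwm.toLp w)) := by
    rw [Lp.tendsto_Lp_iff_tendsto_eLpNorm']
    refine tendsto_of_tendsto_of_tendsto_of_le_of_le tendsto_const_nhds hlim (fun _ => zero_le)
      fun n => ?_
    refine le_trans (le_of_eq (eLpNorm_congr_ae ?_)) (hle n)
    filter_upwards [hwm.coeFn_toLp] with x hx
    simp [hx]
  obtain ⟨g, hg, hgw, hgs⟩ := exists_mem_of_tendsto_fst isClosed_H10 hp htend hb hc
  exact ⟨g, hg, by rw [hgw]; exact hwm.coeFn_toLp, hgs⟩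

theorem norm_sq_snd_le {p : GradPair X κ} {G : X → EuclideanSpace ℂ κ} {H : X → ℝ}
    (hp : p.snd =ᵐ[volume] G) (hH : Integrable H volume) (h : ∀ᵐ x, ‖G x‖ ^ 2 ≤ H x) :
    ‖p.snd‖ ^ 2 ≤ ∫ x, H x := by
  rw [norm_sq_eq_integral]
  refine integral_mono_ae (integrable_norm_sq _) hH ?_
  filter_upwards [hp, h] with x h1 h2
  rw [h1]; exact h2

theorem norm_grad_sq (φ : X → ℂ) (x : X) :
    ‖grad e φ x‖ ^ 2 = ∑ k, ‖fderiv ℝ φ x (e k)‖ ^ 2 := by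
  rw [EuclideanSpace.norm_sq_eq]; rfl

/-! ### Square roots of convex combinations of densities -/

/-- A smooth approximation of `(a |φ|² + b |χ|²)^{1/2}`. -/
def smoothSqrt (a b δ : ℝ) (φ χ : X → ℂ) (x : X) : EuclideanSpace ℂ (Fin 3) :=
  !₂[(√a : ℂ) * φ x, (√b : ℂ) * χ x, (δ : ℂ)]

theorem norm_vec3 (x y z : ℂ) : ‖(!₂[x, y, z] : EuclideanSpace ℂ (Fin 3))‖ ^ 2 =
    ‖x‖ ^ 2 + ‖y‖ ^ 2 + ‖z‖ ^ 2 := by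
  rw [EuclideanSpace.norm_sq_eq, Fin.sum_univ_three]; rfl

theorem norm_vec3_le (x y z : ℂ) : ‖(!₂[x, y, z] : EuclideanSpace ℂ (Fin 3))‖ ≤
    ‖x‖ + ‖y‖ + ‖z‖ := by
  refine le_of_sq_le_sq ?_ (by positivity)
  rw [norm_vec3]
  nlinarith [mul_nonneg (norm_nonneg x) (norm_nonneg y), mul_nonneg (norm_nonneg x) (norm_nonneg z),
    mul_nonneg (norm_nonneg y) (norm_nonneg z)]

/-- The `ℂ³`-valued map never vanishes because of its third coordinate, so its norm is smooth. The
norm is 1-Lipschitz, so the gradient of the norm is bounded by that of the map, whose square is `a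
|∇φ|² + b |∇χ|²`. Subtracting `δ` restores the compact support. -/
theorem exists_testPair_sqrt {U : Set X} {a b δ : ℝ} (ha : 0 ≤ a) (hb : 0 ≤ b) (hδ : 0 < δ)
    {p q : GradPair X κ} {φ χ : X → ℂ} (hφ : ContDiff ℝ ((⊤ : ℕ∞) : WithTop ℕ∞) φ)
    (hφs : HasCompactSupport φ) (hφU : tsupport φ ⊆ U) (hp : p.snd =ᵐ[volume] grad e φ)
    (hχ : ContDiff ℝ ((⊤ : ℕ∞) : WithTop ℕ∞) χ)
    (hχs : HasCompactSupport χ) (hχU : tsupport χ ⊆ U) (hq : q.snd =ᵐ[volume] grad e χ) :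
    ∃ r ∈ testPairs e U, r.fst =ᵐ[volume] (fun x => ((‖smoothSqrt a b δ φ χ x‖ - δ : ℝ) : ℂ)) ∧
      ‖r.snd‖ ^ 2 ≤ a * ‖p.snd‖ ^ 2 + b * ‖q.snd‖ ^ 2 := by
  set Φ := smoothSqrt a b δ φ χ with hΦdef
  set w : X → ℂ := fun x => ((‖Φ x‖ - δ : ℝ) : ℂ) with hw
  have hΦ : ContDiff ℝ ((⊤ : ℕ∞) : WithTop ℕ∞) Φ := by
    rw [contDiff_piLp]
    intro i
    fin_cases i
    · exact contDiff_const.mul hφ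
    · exact contDiff_const.mul hχ
    · exact contDiff_const
  have hΦ0 : ∀ x, Φ x ≠ 0 := fun x h => by
    have := congrArg (fun v : EuclideanSpace ℂ (Fin 3) => v 2) h
    exact hδ.ne' (by simpa [hΦdef, smoothSqrt] using this)
  have hN : ContDiff ℝ ((⊤ : ℕ∞) : WithTop ℕ∞) (fun x => ‖Φ x‖) := hΦ.norm ℝ hΦ0
  have hwc : ContDiff ℝ ((⊤ : ℕ∞) : WithTop ℕ∞) w :=
    Complex.ofRealCLM.contDiff.comp (hN.sub contDiff_const)
  have hzero : ∀ x, φ x = 0 → χ x = 0 → w x = 0 := fun x h1 h2 => by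
    have : ‖Φ x‖ ^ 2 = δ ^ 2 := by
      rw [hΦdef, smoothSqrt, norm_vec3, h1, h2]; simp
    have : ‖Φ x‖ = δ := by
      rwa [sq_eq_sq₀ (norm_nonneg _) hδ.le] at this
    simp [hw, this]
  have hsub : Function.support w ⊆ tsupport φ ∪ tsupport χ := fun x hx => by
    by_contra h
    rw [mem_union, not_or] at h
    exact hx (hzero x (image_eq_zero_of_notMem_tsupport h.1) (image_eq_zero_of_notMem_tsupport h.2))
  have hts : tsupport w ⊆ tsupport φ ∪ tsupport χ :=
    closure_minimal hsub ((isClosed_tsupport φ).union (isClosed_tsupport χ))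
  have hws : HasCompactSupport w := (hφs.union hχs).of_isClosed_subset (isClosed_tsupport w) hts
  obtain ⟨r, hr, hr1, hr2⟩ := exists_testPair (e := e) hwc hws (hts.trans (union_subset hφU hχU))
  refine ⟨r, hr, hr1, ?_⟩
  have hbound : ∀ x h, ‖fderiv ℝ w x h‖ ^ 2 ≤
      a * ‖fderiv ℝ φ x h‖ ^ 2 + b * ‖fderiv ℝ χ x h‖ ^ 2 := by
    intro x h
    have hdφ := (hφ.differentiable (by simp) x).hasFDerivAt
    have hdχ := (hχ.differentiable (by simp) x).hasFDerivAt
    have hdΦ := (hΦ.differentiable (by simp) x).hasFDerivAt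
    have e1 : ‖fderiv ℝ Φ x h‖ ^ 2 = a * ‖fderiv ℝ φ x h‖ ^ 2 + b * ‖fderiv ℝ χ x h‖ ^ 2 := by
      have h0 : ∀ i, HasFDerivAt (fun y => Φ y i)
          ((PiLp.proj 2 (fun _ : Fin 3 => ℂ) i : EuclideanSpace ℂ (Fin 3) →L[ℝ] ℂ) ∘L
            fderiv ℝ Φ x) x := fun i =>
        (PiLp.proj 2 (fun _ : Fin 3 => ℂ) i :
          EuclideanSpace ℂ (Fin 3) →L[ℝ] ℂ).hasFDerivAt.comp x hdΦ
      have c0 : fderiv ℝ Φ x h 0 = (√a : ℂ) * fderiv ℝ φ x h := by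
        have := (h0 0).unique (hdφ.const_mul (√a : ℂ))
        simpa using congrArg (fun L : X →L[ℝ] ℂ => L h) this
      have c1 : fderiv ℝ Φ x h 1 = (√b : ℂ) * fderiv ℝ χ x h := by
        have := (h0 1).unique (hdχ.const_mul (√b : ℂ))
        simpa using congrArg (fun L : X →L[ℝ] ℂ => L h) this
      have c2 : fderiv ℝ Φ x h 2 = 0 := by
        have := (h0 2).unique (hasFDerivAt_const (δ : ℂ) x)
        simpa using congrArg (fun L : X →L[ℝ] ℂ => L h) this
      rw [EuclideanSpace.norm_sq_eq, Fin.sum_univ_three, c0, c1, c2, norm_mul, norm_mul,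
        Complex.norm_real, Complex.norm_real, mul_pow, mul_pow, Real.norm_eq_abs, Real.norm_eq_abs,
        sq_abs, sq_abs, Real.sq_sqrt ha, Real.sq_sqrt hb]
      simp
    have hdN : HasFDerivAt (fun v : EuclideanSpace ℂ (Fin 3) => ‖v‖)
        (fderiv ℝ (fun v : EuclideanSpace ℂ (Fin 3) => ‖v‖) (Φ x)) (Φ x) :=
      ((contDiffAt_norm ℝ (hΦ0 x) (n := 1)).differentiableAt (by simp)).hasFDerivAt
    have hdw := Complex.ofRealCLM.hasFDerivAt.comp x ((hdN.comp x hdΦ).sub_const δ)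
    have e2 : fderiv ℝ w x h = ((fderiv ℝ (fun v : EuclideanSpace ℂ (Fin 3) => ‖v‖) (Φ x)
        (fderiv ℝ Φ x h) : ℝ) : ℂ) := by
      have : fderiv ℝ w x = _ := hdw.fderiv
      rw [this]; rfl
    rw [e2, ← e1, Complex.norm_real]
    have h3 : ‖fderiv ℝ (fun v : EuclideanSpace ℂ (Fin 3) => ‖v‖) (Φ x)‖ ≤ 1 := by
      simpa using norm_fderiv_le_of_lipschitz ℝ (x₀ := Φ x)
        (lipschitzWith_one_norm (E := EuclideanSpace ℂ (Fin 3)))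
    gcongr
    refine (ContinuousLinearMap.le_opNorm _ _).trans ?_
    exact mul_le_of_le_one_left (norm_nonneg _) h3
  have hi1 := (integrable_norm_sq p.snd).const_mul a
  have hi2 := (integrable_norm_sq q.snd).const_mul b
  have hfin := norm_sq_snd_le hr2 (hi1.add hi2) (by
    filter_upwards [hp, hq] with x h1 h2
    rw [norm_grad_sq]
    simp only [Pi.add_apply]
    rw [h1, h2, norm_grad_sq, norm_grad_sq, Finset.mul_sum, Finset.mul_sum,
      ← Finset.sum_add_distrib]
    exact Finset.sum_le_sum fun k _ => hbound x (e k))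
  simp only [Pi.add_apply] at hfin
  rwa [integral_add hi1 hi2, integral_const_mul, integral_const_mul, ← norm_sq_eq_integral,
    ← norm_sq_eq_integral] at hfin

/-- Convexity of the kinetic energy in the density. -/
theorem exists_mem_H10_sqrt {U : Set X} (hUo : MeasurableSet U) (hUb : Bornology.IsBounded U)
    {a b : ℝ} (ha : 0 ≤ a) (hb : 0 ≤ b) {f g : GradPair X κ} (hf : f ∈ H10 e U)
    (hg : g ∈ H10 e U) :
    ∃ w ∈ H10 e U, w.fst =ᵐ[volume]
        (fun x => ((√(a * ‖f.fst x‖ ^ 2 + b * ‖g.fst x‖ ^ 2) : ℝ) : ℂ)) ∧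
      ‖w.snd‖ ^ 2 ≤ a * ‖f.snd‖ ^ 2 + b * ‖g.snd‖ ^ 2 := by
  obtain ⟨p, hp, hpf⟩ := exists_seq_testPairs hf
  obtain ⟨q, hq, hqg⟩ := exists_seq_testPairs hg
  choose φ hφ hφs hφU hp1 hp2 using hp
  choose χ hχ hχs hχU hq1 hq2 using hq
  choose r hr hr1 hr2 using fun n : ℕ => exists_testPair_sqrt ha hb
    (Nat.one_div_pos_of_nat (α := ℝ) (n := n)) (hφ n) (hφs n) (hφU n) (hp2 n)
    (hχ n) (hχs n) (hχU n) (hq2 n)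
  have hpf1 : Tendsto (fun n => (p n).fst - f.fst) atTop (𝓝 0) := by
    have := ((continuous_fst.tendsto f).comp hpf).sub_const f.fst
    simpa using this
  have hqg1 : Tendsto (fun n => (q n).fst - g.fst) atTop (𝓝 0) := by
    have := ((continuous_fst.tendsto g).comp hqg).sub_const g.fst
    simpa using this
  refine exists_mem_H10_of_approx hUo hUb ?_ (fun n => testPairs_le_H10 (hr n))
    (A := fun n => (√a : ℂ) • ((p n).fst - f.fst)) (B := fun n => (√b : ℂ) • ((q n).fst - g.fst))
    (by simpa using hpf1.const_smul (√a : ℂ)) (by simpa using hqg1.const_smul (√b : ℂ))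
    -- One `1/(n+1)` is the third coordinate of `smoothSqrt`, the other is the constant subtracted
    -- from its norm.
    (δ := fun n => 2 * (1 / ((n : ℝ) + 1)))
    (by simpa using (tendsto_one_div_add_atTop_nhds_zero_nat (𝕜 := ℝ)).const_mul 2) (fun n => ?_)
    hr2 ?_
  · have h1 := (Lp.aestronglyMeasurable f.fst).norm.aemeasurable.pow_const 2 |>.const_mul a
    have h2 := (Lp.aestronglyMeasurable g.fst).norm.aemeasurable.pow_const 2 |>.const_mul b
    exact (Complex.measurable_ofReal.comp_aemeasurable (h1.add h2).sqrt).aestronglyMeasurable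
  · set δ : ℝ := 1 / ((n : ℝ) + 1) with hδ
    have hδ0 : 0 < δ := Nat.one_div_pos_of_nat
    filter_upwards [hr1 n, hp1 n, hq1 n, ae_eq_zero_of_mem_H10 hUo hf,
      ae_eq_zero_of_mem_H10 hUo hg, Lp.coeFn_smul (√a : ℂ) ((p n).fst - f.fst),
      Lp.coeFn_sub (p n).fst f.fst, Lp.coeFn_smul (√b : ℂ) ((q n).fst - g.fst),
      Lp.coeFn_sub (q n).fst g.fst] with x x1 x2 x3 x4 x5 x6 x7 x8 x9
    rw [x1, x6, x8, Pi.smul_apply, Pi.smul_apply, x7, x9, Pi.sub_apply, Pi.sub_apply, x2, x3,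
      ← Complex.ofReal_sub, Complex.norm_real]
    set v : EuclideanSpace ℂ (Fin 3) := !₂[(√a : ℂ) * f.fst x, (√b : ℂ) * g.fst x, 0] with hv
    have hvn : √(a * ‖f.fst x‖ ^ 2 + b * ‖g.fst x‖ ^ 2) = ‖v‖ := by
      rw [← Real.sqrt_sq (norm_nonneg v), hv, norm_vec3]
      simp [mul_pow, Real.sq_sqrt ha, Real.sq_sqrt hb]
    rw [hvn]
    by_cases hx : x ∈ U
    · rw [indicator_of_mem hx]
      have h1 : ‖smoothSqrt a b δ (φ n) (χ n) x - v‖ ≤ ‖(√a : ℂ) • (φ n x - f.fst x)‖ +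
          ‖(√b : ℂ) • (χ n x - g.fst x)‖ + δ := by
        have : smoothSqrt a b δ (φ n) (χ n) x - v =
            !₂[(√a : ℂ) • (φ n x - f.fst x), (√b : ℂ) • (χ n x - g.fst x), (δ : ℂ)] := by
          ext i
          fin_cases i <;> simp [smoothSqrt, hv, mul_sub]
        rw [this]
        refine (norm_vec3_le _ _ _).trans (le_of_eq ?_)
        rw [Complex.norm_real, Real.norm_of_nonneg hδ0.le]
      have h2 := abs_norm_sub_norm_le (smoothSqrt a b δ (φ n) (χ n) x) v
      have h3 : |2 * δ| = 2 * δ := abs_of_pos (by positivity)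
      rw [h3, Real.norm_eq_abs]
      rw [abs_le] at h2 ⊢
      constructor <;> linarith [h2.1, h2.2]
    · rw [indicator_of_notMem hx]
      have h1 : φ n x = 0 := image_eq_zero_of_notMem_tsupport fun h => hx (hφU n h)
      have h2 : χ n x = 0 := image_eq_zero_of_notMem_tsupport fun h => hx (hχU n h)
      have h3 : ‖smoothSqrt a b δ (φ n) (χ n) x‖ = δ := by
        rw [← sq_eq_sq₀ (norm_nonneg _) hδ0.le, smoothSqrt, norm_vec3, h1, h2]; simp
      have h4 : ‖v‖ = 0 := by
        rw [← sq_eq_zero_iff, hv, norm_vec3, x4 hx, x5 hx]; simp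
      rw [h3, h4, h1, h2, x4 hx, x5 hx]; simp [hδ]
  · have h1 := (((continuous_snd.tendsto f).comp hpf).norm.pow 2).const_mul a
    have h2 := (((continuous_snd.tendsto g).comp hqg).norm.pow 2).const_mul b
    exact h1.add h2

end Composition

/-! ### A smooth approximation of the positive part -/

/-- A smooth approximation of `s ↦ max s 0` that vanishes for `s ≤ 0` and is `1`-Lipschitz. -/
def posApprox (δ s : ℝ) : ℝ := s * expNegInvGlue (s / δ)

theorem posApprox_of_nonpos {δ s : ℝ} (hδ : 0 < δ) (hs : s ≤ 0) : posApprox δ s = 0 := by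
  rw [posApprox, expNegInvGlue.zero_of_nonpos (div_nonpos_of_nonpos_of_nonneg hs hδ.le), mul_zero]

theorem posApprox_of_pos {δ s : ℝ} (hδ : 0 < δ) (hs : 0 < s) :
    posApprox δ s = s * Real.exp (-(δ / s)) := by
  rw [posApprox, expNegInvGlue, if_neg (not_le.2 (by positivity)), inv_div]

theorem contDiff_posApprox (δ : ℝ) : ContDiff ℝ ((⊤ : ℕ∞) : WithTop ℕ∞) (posApprox δ) :=
  contDiff_id.mul (expNegInvGlue.contDiff.comp (contDiff_id.div_const δ))

theorem posApprox_nonneg {δ : ℝ} (hδ : 0 < δ) (s : ℝ) : 0 ≤ posApprox δ s := by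
  rcases le_or_gt s 0 with h | h
  · rw [posApprox_of_nonpos hδ h]
  · rw [posApprox_of_pos hδ h]; positivity

/-- For positive `s`, multiply `1 - δ/s ≤ exp(-δ/s) ≤ 1` by `s`. -/
theorem abs_posApprox_sub_le {δ : ℝ} (hδ : 0 < δ) (s : ℝ) : |posApprox δ s - max s 0| ≤ δ := by
  rcases le_or_gt s 0 with h | h
  · rw [posApprox_of_nonpos hδ h, max_eq_right h]; simpa using hδ.le
  · rw [posApprox_of_pos hδ h, max_eq_left h.le, abs_le]
    have h1 : 1 - δ / s ≤ Real.exp (-(δ / s)) := by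
      have := Real.add_one_le_exp (-(δ / s)); linarith
    have h2 : Real.exp (-(δ / s)) ≤ 1 := by
      rw [Real.exp_le_one_iff]; have : 0 < δ / s := by positivity
      linarith
    have h3 : s * (δ / s) = δ := by field_simp
    constructor <;> nlinarith

/-- For `s > 0` the derivative is `e^{-x}(1 + x)` with `x = δ/s`, and `1 + x ≤ e^x`. At `0` the
function has a minimum, so its derivative vanishes there. -/
theorem abs_deriv_posApprox_le {δ : ℝ} (hδ : 0 < δ) (s : ℝ) : |deriv (posApprox δ) s| ≤ 1 := by
  rcases lt_trichotomy s 0 with h | rfl | h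
  · have : posApprox δ =ᶠ[𝓝 s] fun _ => 0 := by
      filter_upwards [gt_mem_nhds h] with t ht using posApprox_of_nonpos hδ ht.le
    rw [this.deriv_eq]; simp
  · have : IsLocalMin (posApprox δ) 0 := Eventually.of_forall fun t => by
      rw [posApprox_of_nonpos hδ le_rfl]; exact posApprox_nonneg hδ t
    rw [this.deriv_eq_zero]; simp
  · have he : posApprox δ =ᶠ[𝓝 s] fun t => t * Real.exp (-(δ / t)) := by
      filter_upwards [lt_mem_nhds h] with t ht using posApprox_of_pos hδ ht
    have hd : HasDerivAt (fun t : ℝ => t * Real.exp (-(δ / t)))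
        (Real.exp (-(δ / s)) * (1 + δ / s)) s := by
      have h1 : HasDerivAt (fun t : ℝ => -(δ / t)) (δ / s ^ 2) s := by
        have := ((hasDerivAt_inv h.ne').const_mul δ).neg
        refine this.congr_deriv ?_
        field_simp
      refine ((hasDerivAt_id s).mul h1.exp).congr_deriv ?_
      simp only [id_eq]
      field_simp
    rw [he.deriv_eq, hd.deriv, abs_of_pos (by positivity)]
    have h1 := Real.add_one_le_exp (δ / s)
    calc Real.exp (-(δ / s)) * (1 + δ / s) ≤ Real.exp (-(δ / s)) * Real.exp (δ / s) := by
          gcongr; linarith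
      _ = 1 := by rw [← Real.exp_add]; simp

/-! ### Ground states as weak subsolutions on the whole space -/

section Positive

variable {X : Type*} [NormedAddCommGroup X] [NormedSpace ℝ X] [MeasureSpace X] [BorelSpace X]
  [FiniteDimensional ℝ X] [(volume : Measure X).IsAddHaarMeasure]
  {κ : Type*} [Fintype κ] {e : κ → X}

/-- The sum of the second derivatives in the directions `e`. -/
def lap (e : κ → X) (χ : X → ℝ) (x : X) : ℝ :=
  ∑ k, fderiv ℝ (fun y => fderiv ℝ χ y (e k)) x (e k)

theorem contDiff_fderiv_apply {χ : X → ℝ} (hχ : ContDiff ℝ ((⊤ : ℕ∞) : WithTop ℕ∞) χ) (h : X) :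
    ContDiff ℝ ((⊤ : ℕ∞) : WithTop ℕ∞) (fun y => fderiv ℝ χ y h) :=
  (hχ.fderiv_right (by simp)).clm_apply contDiff_const

theorem continuous_lap {χ : X → ℝ} (hχ : ContDiff ℝ ((⊤ : ℕ∞) : WithTop ℕ∞) χ) :
    Continuous (lap e χ) :=
  continuous_finsetSum _ fun k _ =>
    ((contDiff_fderiv_apply (contDiff_fderiv_apply hχ (e k)) (e k)).continuous)

/-- Integration by parts with the compact support carried by `φ` alone, so that `χ` may later be a
heat kernel. -/
theorem integral_re_fderiv_mul {φ : X → ℂ} (hφ : ContDiff ℝ ((⊤ : ℕ∞) : WithTop ℕ∞) φ)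
    (hs : HasCompactSupport φ) {χ : X → ℝ} (hχ : ContDiff ℝ ((⊤ : ℕ∞) : WithTop ℕ∞) χ) :
    Integrable (fun x => ∑ k, (fderiv ℝ φ x (e k)).re * fderiv ℝ χ x (e k)) volume ∧
    Integrable (fun x => (φ x).re * lap e χ x) volume ∧
    ∫ x, ∑ k, (fderiv ℝ φ x (e k)).re * fderiv ℝ χ x (e k) = -∫ x, (φ x).re * lap e χ x := by
  have hR : ContDiff ℝ ((⊤ : ℕ∞) : WithTop ℕ∞) (fun x => (φ x).re) :=
    Complex.reCLM.contDiff.comp hφ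
  have hRs : HasCompactSupport (fun x => (φ x).re) := hs.comp_left Complex.zero_re
  have hfd : ∀ x h, fderiv ℝ (fun x => (φ x).re) x h = (fderiv ℝ φ x h).re := fun x h => by
    have := (Complex.reCLM.hasFDerivAt.comp x (hφ.differentiable (by simp) x).hasFDerivAt).fderiv
    exact congrArg (fun L : X →L[ℝ] ℝ => L h) this
  have hRs' : ∀ h, HasCompactSupport fun x => fderiv ℝ (fun x => (φ x).re) x h := fun h =>
    hRs.fderiv_apply ℝ h
  have i1 : ∀ k, Integrable (fun x => fderiv ℝ (fun x => (φ x).re) x (e k) * fderiv ℝ χ x (e k))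
      volume := fun k =>
    ((contDiff_fderiv_apply hR (e k)).continuous.mul
      (contDiff_fderiv_apply hχ (e k)).continuous).integrable_of_hasCompactSupport
      (hRs' (e k)).mul_right
  have i2 : ∀ k, Integrable (fun x => (φ x).re *
      fderiv ℝ (fun y => fderiv ℝ χ y (e k)) x (e k)) volume := fun k =>
    (hR.continuous.mul (contDiff_fderiv_apply
      (contDiff_fderiv_apply hχ (e k)) (e k)).continuous).integrable_of_hasCompactSupport
      hRs.mul_right
  have i3 : ∀ k, Integrable (fun x => (φ x).re * fderiv ℝ χ x (e k)) volume := fun k =>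
    (hR.continuous.mul (contDiff_fderiv_apply hχ (e k)).continuous).integrable_of_hasCompactSupport
      hRs.mul_right
  have hk : ∀ k, ∫ x, (fderiv ℝ φ x (e k)).re * fderiv ℝ χ x (e k) =
      -∫ x, (φ x).re * fderiv ℝ (fun y => fderiv ℝ χ y (e k)) x (e k) := fun k => by
    have := integral_mul_fderiv_eq_neg_fderiv_mul_of_integrable (i1 k) (i2 k) (i3 k)
      (fun x _ => hR.differentiable (by simp) x)
      (fun x _ => (contDiff_fderiv_apply hχ (e k)).differentiable (by simp) x)
    rw [this, neg_neg]
    exact integral_congr_ae (Eventually.of_forall fun x => by simp only [hfd])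
  simp only [hfd] at i1
  refine ⟨integrable_finsetSum _ fun k _ => i1 k, ?_, ?_⟩
  · simp only [lap, Finset.mul_sum]
    exact integrable_finsetSum _ fun k _ => i2 k
  · rw [integral_finsetSum _ fun k _ => i1 k]
    simp only [lap, Finset.mul_sum]
    rw [integral_finsetSum _ fun k _ => i2 k, ← Finset.sum_neg_distrib]
    exact Finset.sum_congr rfl fun k _ => hk k

theorem integrableOn_of_continuous {U : Set X} (hUb : Bornology.IsBounded U) {h : X → ℝ}
    (hh : Continuous h) : IntegrableOn h U volume := by
  have : ProperSpace X := FiniteDimensional.proper ℝ X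
  exact (hh.continuousOn.integrableOn_compact (μ := volume)
    (Metric.isCompact_of_isClosed_isBounded isClosed_closure hUb.closure)).mono_set subset_closure

/-- Where `φ` vanishes, `Re φ - εχ ≤ 0` and the truncation is zero, so the support stays in that of
`φ` without any cutoff of `χ`. Since `posApprox` is 1-Lipschitz, the gradient is at most that of `Re
φ - εχ`; the cross term of its square is integrated by parts onto `χ`. -/
theorem exists_testPair_pos {U : Set X} (hUm : MeasurableSet U) (hUb : Bornology.IsBounded U)
    {δ ε : ℝ} (hδ : 0 < δ) (hε : 0 ≤ ε)
    {p : GradPair X κ} {φ : X → ℂ} (hφ : ContDiff ℝ ((⊤ : ℕ∞) : WithTop ℕ∞) φ)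
    (hφs : HasCompactSupport φ) (hφU : tsupport φ ⊆ U) (hp : p.snd =ᵐ[volume] grad e φ)
    {χ : X → ℝ} (hχ : ContDiff ℝ ((⊤ : ℕ∞) : WithTop ℕ∞) χ) (hχ0 : ∀ x, 0 ≤ χ x) :
    ∃ r ∈ testPairs e U,
      r.fst =ᵐ[volume] (fun x => ((posApprox δ ((φ x).re - ε * χ x) : ℝ) : ℂ)) ∧
      ‖r.snd‖ ^ 2 ≤ ‖p.snd‖ ^ 2 + 2 * ε * (∫ x, (φ x).re * lap e χ x) +
        ε ^ 2 * ∫ x in U, ∑ k, fderiv ℝ χ x (e k) ^ 2 := by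
  set g : X → ℝ := fun x => (φ x).re - ε * χ x with hg
  set w : X → ℂ := fun x => ((posApprox δ (g x) : ℝ) : ℂ) with hw
  have hgc : ContDiff ℝ ((⊤ : ℕ∞) : WithTop ℕ∞) g :=
    (Complex.reCLM.contDiff.comp hφ).sub (contDiff_const.mul hχ)
  have hwc : ContDiff ℝ ((⊤ : ℕ∞) : WithTop ℕ∞) w :=
    Complex.ofRealCLM.contDiff.comp ((contDiff_posApprox δ).comp hgc)
  have hts : tsupport w ⊆ tsupport φ := by
    refine closure_minimal (fun x hx => ?_) (isClosed_tsupport φ)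
    by_contra h
    refine hx ?_
    simp only [hw, hg]
    rw [image_eq_zero_of_notMem_tsupport h, Complex.zero_re, posApprox_of_nonpos hδ]
    · simp
    · have := mul_nonneg hε (hχ0 x); linarith
  have hws : HasCompactSupport w := hφs.of_isClosed_subset (isClosed_tsupport w) hts
  obtain ⟨r, hr, hr1, hr2⟩ := exists_testPair (e := e) hwc hws (hts.trans hφU)
  refine ⟨r, hr, hr1, ?_⟩
  obtain ⟨i1, i2, hparts⟩ := integral_re_fderiv_mul (e := e) hφ hφs hχ
  have i3 : Integrable (U.indicator fun x => ∑ k, fderiv ℝ χ x (e k) ^ 2) volume := by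
    rw [integrable_indicator_iff hUm]
    refine integrableOn_of_continuous hUb (continuous_finsetSum _ fun k _ => ?_)
    exact (contDiff_fderiv_apply hχ (e k)).continuous.pow 2
  have hpt : ∀ x, ‖grad e w x‖ ^ 2 ≤ ‖grad e φ x‖ ^ 2
      - 2 * ε * (∑ k, (fderiv ℝ φ x (e k)).re * fderiv ℝ χ x (e k))
      + ε ^ 2 * U.indicator (fun x => ∑ k, fderiv ℝ χ x (e k) ^ 2) x := by
    intro x
    by_cases hx : x ∈ tsupport φ
    · rw [indicator_of_mem (hφU hx), norm_grad_sq, norm_grad_sq, Finset.mul_sum, Finset.mul_sum,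
        ← Finset.sum_sub_distrib, ← Finset.sum_add_distrib]
      refine Finset.sum_le_sum fun k _ => ?_
      have hdφ := (hφ.differentiable (by simp) x).hasFDerivAt
      have hdχ := (hχ.differentiable (by simp) x).hasFDerivAt
      have hdg : HasFDerivAt g (Complex.reCLM ∘L fderiv ℝ φ x - ε • fderiv ℝ χ x) x :=
        (Complex.reCLM.hasFDerivAt.comp x hdφ).sub (hdχ.const_mul ε)
      have hdF : HasDerivAt (posApprox δ) (deriv (posApprox δ) (g x)) (g x) :=
        ((contDiff_posApprox δ).differentiable (by simp) _).hasDerivAt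
      have hdw : HasFDerivAt w _ x :=
        Complex.ofRealCLM.hasFDerivAt.comp x (hdF.comp_hasFDerivAt x hdg)
      have e1 : fderiv ℝ w x (e k) = ((deriv (posApprox δ) (g x) *
          ((fderiv ℝ φ x (e k)).re - ε * fderiv ℝ χ x (e k)) : ℝ) : ℂ) := by
        rw [hdw.fderiv]; rfl
      have h1 := abs_deriv_posApprox_le hδ (g x)
      have h2 : deriv (posApprox δ) (g x) ^ 2 ≤ 1 := by
        rw [← sq_abs]; exact pow_le_one₀ (abs_nonneg _) h1
      have h3 : (fderiv ℝ φ x (e k)).re ^ 2 ≤ ‖fderiv ℝ φ x (e k)‖ ^ 2 := by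
        rw [← sq_abs]; gcongr; exact Complex.abs_re_le_norm _
      rw [e1, Complex.norm_real, Real.norm_eq_abs, sq_abs, mul_pow]
      nlinarith [sq_nonneg ((fderiv ℝ φ x (e k)).re - ε * fderiv ℝ χ x (e k))]
    · have h0 : fderiv ℝ w x = 0 := image_eq_zero_of_notMem_tsupport
        fun h => hx (hts (tsupport_fderiv_subset ℝ h))
      have h1 : fderiv ℝ φ x = 0 := image_eq_zero_of_notMem_tsupport
        fun h => hx (tsupport_fderiv_subset ℝ h)
      rw [norm_grad_sq, norm_grad_sq, h0, h1]
      have : 0 ≤ U.indicator (fun x => ∑ k, fderiv ℝ χ x (e k) ^ 2) x :=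
        indicator_nonneg (fun y _ => Finset.sum_nonneg fun k _ => sq_nonneg _) x
      simp only [zero_apply, norm_zero, Complex.zero_re, zero_mul,
        Finset.sum_const_zero, mul_zero]
      norm_num
      positivity
  have j1 := integrable_norm_sq p.snd
  have hfin := norm_sq_snd_le hr2 ((j1.sub (i1.const_mul (2 * ε))).add (i3.const_mul (ε ^ 2))) (by
    filter_upwards [hp] with x hx
    simp only [Pi.add_apply, Pi.sub_apply]
    rw [hx]
    exact hpt x)
  rw [integral_add' (j1.sub (i1.const_mul (2 * ε))) (i3.const_mul (ε ^ 2)),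
    integral_sub' j1 (i1.const_mul (2 * ε)), integral_const_mul, integral_const_mul, hparts,
    ← norm_sq_eq_integral, integral_indicator hUm] at hfin
  linarith

/-- The gradient bound of `exists_testPair_pos` survives the limit: its middle term is an inner
product with the Laplacian of `χ` cut off to the bounded set `U`, which is a fixed element of `L²`.
-/
theorem exists_mem_H10_pos {U : Set X} (hUm : MeasurableSet U) (hUb : Bornology.IsBounded U)
    {ε : ℝ} (hε : 0 ≤ ε) {f : GradPair X κ} (hf : f ∈ H10 e U)
    {χ : X → ℝ} (hχ : ContDiff ℝ ((⊤ : ℕ∞) : WithTop ℕ∞) χ) (hχ0 : ∀ x, 0 ≤ χ x) :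
    ∃ w ∈ H10 e U, w.fst =ᵐ[volume] (fun x => ((max ((f.fst x).re - ε * χ x) 0 : ℝ) : ℂ)) ∧
      ‖w.snd‖ ^ 2 ≤ ‖f.snd‖ ^ 2 + 2 * ε * (∫ x in U, (f.fst x).re * lap e χ x) +
        ε ^ 2 * ∫ x in U, ∑ k, fderiv ℝ χ x (e k) ^ 2 := by
  obtain ⟨p, hp, hpf⟩ := exists_seq_testPairs hf
  choose φ hφ hφs hφU hp1 hp2 using hp
  choose r hr hr1 hr2 using fun n : ℕ => exists_testPair_pos hUm hUb
    (Nat.one_div_pos_of_nat (α := ℝ) (n := n)) hε (hφ n) (hφs n) (hφU n) (hp2 n) hχ hχ0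
  have hpf1 : Tendsto (fun n => (p n).fst - f.fst) atTop (𝓝 0) := by
    have := ((continuous_fst.tendsto f).comp hpf).sub_const f.fst
    simpa using this
  have hL : MemLp (U.indicator fun x => (lap e χ x : ℂ)) 2 (volume : Measure X) := by
    have : ProperSpace X := FiniteDimensional.proper ℝ X
    obtain ⟨C, hC⟩ := (Metric.isCompact_of_isClosed_isBounded isClosed_closure
      hUb.closure).exists_bound_of_continuousOn (continuous_lap (e := e) hχ).continuousOn
    rw [memLp_indicator_iff_restrict hUm]
    have : IsFiniteMeasure ((volume : Measure X).restrict U) :=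
      ⟨by rw [Measure.restrict_apply_univ]; exact hUb.measure_lt_top⟩
    refine MemLp.of_bound (Complex.continuous_ofReal.comp (continuous_lap hχ)).aestronglyMeasurable C
      ?_
    filter_upwards [ae_restrict_mem hUm] with x hx
    rw [Complex.norm_real]
    exact hC x (subset_closure hx)
  have hin : ∀ F : Lp ℂ 2 (volume : Measure X),
      ∫ x in U, (F x).re * lap e χ x = (inner ℂ (hL.toLp _) F).re := by
    intro F
    have e2 : (inner ℂ (hL.toLp _) F).re = ∫ x, (inner ℂ ((hL.toLp _) x) (F x) : ℂ).re := by
      rw [L2.inner_def]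
      exact (integral_re (L2.integrable_inner (𝕜 := ℂ) _ _)).symm
    rw [e2, ← integral_indicator hUm]
    refine integral_congr_ae ?_
    filter_upwards [hL.coeFn_toLp] with x hx
    rw [hx, RCLike.inner_apply]
    by_cases h : x ∈ U <;> simp [h]
  refine exists_mem_H10_of_approx hUm hUb ?_ (fun n => testPairs_le_H10 (hr n))
    (A := fun n => (p n).fst - f.fst) (B := fun _ => 0) hpf1 tendsto_const_nhds
    (δ := fun n => 1 / ((n : ℝ) + 1)) tendsto_one_div_add_atTop_nhds_zero_nat (fun n => ?_) hr2 ?_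
  · have h1 : AEStronglyMeasurable (fun x => (f.fst x).re) volume :=
      Complex.continuous_re.comp_aestronglyMeasurable (Lp.aestronglyMeasurable f.fst)
    exact Complex.continuous_ofReal.comp_aestronglyMeasurable
      ((h1.sub (hχ.continuous.aestronglyMeasurable.const_mul ε)).sup aestronglyMeasurable_const)
  · set δ : ℝ := 1 / ((n : ℝ) + 1) with hδ
    have hδ0 : 0 < δ := Nat.one_div_pos_of_nat
    filter_upwards [hr1 n, hp1 n, ae_eq_zero_of_mem_H10 hUm hf, Lp.coeFn_sub (p n).fst f.fst]
      with x x1 x2 x4 x7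
    rw [x1, x7, Pi.sub_apply, x2, ← Complex.ofReal_sub, Complex.norm_real]
    by_cases hx : x ∈ U
    · rw [indicator_of_mem hx, abs_of_pos hδ0]
      have h1 := abs_posApprox_sub_le hδ0 ((φ n x).re - ε * χ x)
      have h2 : |max ((φ n x).re - ε * χ x) 0 - max ((f.fst x).re - ε * χ x) 0| ≤
          ‖φ n x - f.fst x‖ := by
        refine (abs_max_sub_max_le_abs _ _ _).trans ?_
        have := Complex.abs_re_le_norm (φ n x - f.fst x)
        rw [Complex.sub_re] at this
        rwa [sub_sub_sub_cancel_right]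
      have h3 := norm_nonneg ((0 : Lp ℂ 2 (volume : Measure X)) x)
      rw [Real.norm_eq_abs]
      have := abs_sub_le (posApprox δ ((φ n x).re - ε * χ x)) (max ((φ n x).re - ε * χ x) 0)
        (max ((f.fst x).re - ε * χ x) 0)
      linarith
    · rw [indicator_of_notMem hx]
      have h1 : φ n x = 0 := image_eq_zero_of_notMem_tsupport fun h => hx (hφU n h)
      have h2 : 0 - ε * χ x ≤ 0 := by have := mul_nonneg hε (hχ0 x); linarith
      rw [h1, x4 hx, Complex.zero_re, posApprox_of_nonpos hδ0 h2, max_eq_right h2]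
      simp
  · have h1 := ((continuous_snd.tendsto f).comp hpf).norm.pow 2
    have h2 : Tendsto (fun n => ∫ x, (φ n x).re * lap e χ x) atTop
        (𝓝 (∫ x in U, (f.fst x).re * lap e χ x)) := by
      rw [hin]
      have h3 : ∀ n, ∫ x, (φ n x).re * lap e χ x = (inner ℂ (hL.toLp _) (p n).fst).re := fun n => by
        rw [← hin, ← integral_indicator hUm]
        refine integral_congr_ae ?_
        filter_upwards [hp1 n] with x hx
        by_cases h : x ∈ U
        · rw [indicator_of_mem h, hx]
        · rw [indicator_of_notMem h, image_eq_zero_of_notMem_tsupport fun h' => h (hφU n h')]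
          simp
      simp only [h3]
      exact (Complex.continuous_re.tendsto _).comp
        (tendsto_const_nhds.inner ((continuous_fst.tendsto f).comp hpf))
    exact (h1.add (h2.const_mul (2 * ε))).add tendsto_const_nhds

/-- A nonnegative ground state `f` of the Dirichlet Laplacian with eigenvalue `m` satisfies
`-Δ f ≤ m f` on the whole space, in the weak sense. -/
theorem IsGround.subsolution {U : Set X} (hUm : MeasurableSet U) (hUb : Bornology.IsBounded U)
    {f : GradPair X κ} (hf : IsGround (H10 e U) 0 f)
    (hf0 : ∀ᵐ x, f.fst x = ((‖f.fst x‖ : ℝ) : ℂ))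
    {χ : X → ℝ} (hχ : ContDiff ℝ ((⊤ : ℕ∞) : WithTop ℕ∞) χ) (hχ0 : ∀ x, 0 ≤ χ x) :
    -(energy 0 f * ∫ x in U, ‖f.fst x‖ * χ x) ≤ ∫ x in U, ‖f.fst x‖ * lap e χ x := by
  set m := energy 0 f with hm
  have hm1 : ‖f.snd‖ ^ 2 = m := by rw [hm, energy]; simp
  have hm0 : 0 ≤ m := by rw [← hm1]; positivity
  have hre : ∀ᵐ x, (f.fst x).re = ‖f.fst x‖ := by
    filter_upwards [hf0] with x hx
    conv_lhs => rw [hx]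
    exact Complex.ofReal_re _
  have : ProperSpace X := FiniteDimensional.proper ℝ X
  have hfU := ae_eq_zero_of_mem_H10 hUm hf.1
  have hfi : ∀ h : X → ℝ, Continuous h → IntegrableOn (fun x => ‖f.fst x‖ * h x) U volume := by
    intro h hh
    obtain ⟨C, hC⟩ := (Metric.isCompact_of_isClosed_isBounded isClosed_closure
      hUb.closure).exists_bound_of_continuousOn hh.continuousOn
    have : IsFiniteMeasure ((volume : Measure X).restrict U) :=
      ⟨by rw [Measure.restrict_apply_univ]; exact hUb.measure_lt_top⟩
    have h1 : Integrable (fun x => ‖f.fst x‖) (volume.restrict U) :=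
      (((Lp.memLp f.fst).restrict U).integrable (by norm_num)).norm
    refine h1.mul_bdd (c := C) hh.aestronglyMeasurable ?_
    filter_upwards [ae_restrict_mem hUm] with x hx using hC x (subset_closure hx)
  set a := ∫ x in U, ‖f.fst x‖ * χ x
  set b := ∫ x in U, ‖f.fst x‖ * lap e χ x
  set c := ∫ x in U, ∑ k, fderiv ℝ χ x (e k) ^ 2
  -- The competitor is `(f - εχ)₊`. Minimality gives `m‖w‖² ≤ ‖∇w‖² ≤ m + 2εb + ε²c` while `‖w‖² ≥ 1
  -- - 2εa`; dividing by `ε` and letting `ε → 0` isolates the first-order inequality `b + m a ≥ 0`.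
  have key : ∀ ε : ℝ, 0 < ε → 0 ≤ 2 * (b + m * a) + ε * c := by
    intro ε hε
    obtain ⟨w, hw, hw1, hw2⟩ := exists_mem_H10_pos hUm hUb hε.le hf.1 hχ hχ0
    have h1 := hf.2.2 w hw
    rw [← hm, energy] at h1
    simp only [Pi.zero_apply, zero_mul, integral_zero, add_zero] at h1
    -- Pointwise, `(s - εχ)₊² ≥ s² - 2εsχ` for `s ≥ 0`: where `s ≤ εχ` the right side is
    -- nonpositive.
    have h2 : 1 - 2 * ε * a ≤ ‖w.fst‖ ^ 2 := by
      have h3 : (1 : ℝ) = ∫ x in U, ‖f.fst x‖ ^ 2 := by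
        rw [← integral_indicator hUm, ← one_pow 2, ← hf.2.1, norm_sq_eq_integral]
        refine integral_congr_ae ?_
        filter_upwards [hfU] with x hx
        by_cases h : x ∈ U
        · simp [h]
        · simp [h, hx h]
      have h4 : 1 - 2 * ε * a = ∫ x in U, (‖f.fst x‖ ^ 2 - 2 * ε * (‖f.fst x‖ * χ x)) := by
        rw [integral_sub (integrable_norm_sq _).integrableOn ((hfi χ hχ.continuous).const_mul _),
          integral_const_mul, ← h3]
      rw [h4, norm_sq_eq_integral]
      refine (setIntegral_mono_ae_restrict ((integrable_norm_sq _).integrableOn.sub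
        ((hfi χ hχ.continuous).const_mul _)) (integrable_norm_sq w.fst).integrableOn ?_).trans
        (setIntegral_le_integral (integrable_norm_sq _)
          (Eventually.of_forall fun x => by positivity))
      refine ae_restrict_of_ae ?_
      filter_upwards [hw1, hre] with x x1 x2
      simp only [Pi.sub_apply]
      rw [x1, x2, Complex.norm_real, Real.norm_eq_abs, sq_abs]
      have := mul_nonneg hε.le (hχ0 x)
      have h0 := norm_nonneg (f.fst x)
      rcases le_total (‖f.fst x‖ - ε * χ x) 0 with h | h
      · rw [max_eq_right h]; nlinarith
      · rw [max_eq_left h]; nlinarith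
    have h5 : ∫ x in U, (f.fst x).re * lap e χ x = b := by
      refine integral_congr_ae (ae_restrict_of_ae ?_)
      filter_upwards [hre] with x hx
      rw [hx]
    rw [h5, hm1] at hw2
    have h6 := mul_le_mul_of_nonneg_left h2 hm0
    have h7 : 0 ≤ ε * (2 * (b + m * a) + ε * c) := by nlinarith
    exact nonneg_of_mul_nonneg_right h7 hε
  have hlim : Tendsto (fun ε : ℝ => 2 * (b + m * a) + ε * c) (𝓝[>] 0)
      (𝓝 (2 * (b + m * a) + 0 * c)) :=
    ((continuous_const.add (continuous_id.mul continuous_const)).tendsto 0).mono_left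
      nhdsWithin_le_nhds
  have := ge_of_tendsto hlim (by filter_upwards [self_mem_nhdsWithin] with ε hε using key ε hε)
  linarith

end Positive

/-! ### The heat kernel and the supremum of the ground state -/

section Heat

variable {d : ℕ}

/-- The heat kernel. -/
def heatKernel (d : ℕ) (t : ℝ) (z : Space d) : ℝ :=
  (4 * Real.pi * t) ^ (-((d : ℝ) / 2)) * Real.exp (-(1 / (4 * t)) * ‖z‖ ^ 2)

theorem heatKernel_nonneg {t : ℝ} (ht : 0 ≤ t) (z : Space d) : 0 ≤ heatKernel d t z := by
  unfold heatKernel; positivity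

theorem contDiff_heatKernel (t : ℝ) (x : Space d) :
    ContDiff ℝ ((⊤ : ℕ∞) : WithTop ℕ∞) (fun y => heatKernel d t (y - x)) :=
  contDiff_const.mul (Real.contDiff_exp.comp
    (contDiff_const.mul ((contDiff_norm_sq ℝ).comp (contDiff_id.sub contDiff_const))))

theorem integral_heatKernel {t : ℝ} (ht : 0 < t) : ∫ z, heatKernel d t z = 1 := by
  unfold heatKernel
  rw [integral_const_mul, GaussianFourier.integral_rexp_neg_mul_sq_norm (by positivity),
    finrank_euclideanSpace_fin]
  have : Real.pi / (1 / (4 * t)) = 4 * Real.pi * t := by field_simp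
  rw [this, ← Real.rpow_add (by positivity), neg_add_cancel, Real.rpow_zero]

theorem integrable_heatKernel {t : ℝ} (ht : 0 < t) : Integrable (heatKernel d t) volume := by
  -- The integral of a nonintegrable function is `0` by convention, whereas this one is `1`.
  by_contra h
  have := integral_heatKernel (d := d) ht
  rw [integral_undef h] at this
  exact zero_ne_one this

/-- Squaring a Gaussian halves its time, so the `L²` norm of the kernel can be read off from the
normalization at time `t / 2`. -/
theorem heatKernel_sq {t : ℝ} (ht : 0 < t) (z : Space d) :
    heatKernel d t z ^ 2 = (8 * Real.pi * t) ^ (-((d : ℝ) / 2)) * heatKernel d (t / 2) z := by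
  have h1 : ((4 * Real.pi * t) ^ (-((d : ℝ) / 2))) ^ 2 =
      (8 * Real.pi * t) ^ (-((d : ℝ) / 2)) * (4 * Real.pi * (t / 2)) ^ (-((d : ℝ) / 2)) := by
    rw [sq, ← Real.mul_rpow (by positivity) (by positivity),
      ← Real.mul_rpow (by positivity) (by positivity)]
    congr 1
    ring
  have h2 : Real.exp (-(1 / (4 * t)) * ‖z‖ ^ 2) ^ 2 =
      Real.exp (-(1 / (4 * (t / 2))) * ‖z‖ ^ 2) := by
    rw [← Real.exp_nat_mul]
    congr 1
    push_cast
    field_simp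
  unfold heatKernel
  rw [mul_pow, h1, h2, mul_assoc]

theorem hasFDerivAt_heatKernel (t : ℝ) (x y : Space d) :
    HasFDerivAt (fun y => heatKernel d t (y - x))
      ((heatKernel d t (y - x) * -(1 / (2 * t))) • innerSL ℝ (y - x)) y := by
  have h1 : HasFDerivAt (fun y : Space d => ‖y - x‖ ^ 2) (2 • innerSL ℝ (y - x)) y := by
    have := (hasStrictFDerivAt_norm_sq (y - x)).hasFDerivAt.comp y ((hasFDerivAt_id y).sub_const x)
    simpa [Function.comp_def] using this
  have h2 := ((h1.const_mul (-(1 / (4 * t)))).exp).const_mul ((4 * Real.pi * t) ^ (-((d : ℝ) / 2)))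
  refine h2.congr_fderiv ?_
  ext h
  simp only [heatKernel, _root_.smul_apply, smul_eq_mul, nsmul_eq_mul]
  ring

theorem fderiv_heatKernel (t : ℝ) (x : Space d) (a : Fin d) :
    (fun y => fderiv ℝ (fun y => heatKernel d t (y - x)) y (dir d a)) =
      fun y => -(1 / (2 * t)) * (heatKernel d t (y - x) * (y - x) a) := by
  ext y
  rw [(hasFDerivAt_heatKernel t x y).fderiv]
  simp [dir, EuclideanSpace.inner_single_right]
  ring

theorem lap_heatKernel {t : ℝ} (ht : 0 < t) (x y : Space d) :
    lap (dir d) (fun y => heatKernel d t (y - x)) y =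
      heatKernel d t (y - x) * (‖y - x‖ ^ 2 / (4 * t ^ 2) - (d : ℝ) / (2 * t)) := by
  have h1 : ∀ a, fderiv ℝ (fun y => fderiv ℝ (fun y => heatKernel d t (y - x)) y (dir d a)) y
      (dir d a) = heatKernel d t (y - x) * (((y - x) a) ^ 2 / (4 * t ^ 2) - 1 / (2 * t)) := by
    intro a
    rw [fderiv_heatKernel]
    have hp : HasFDerivAt (fun y : Space d => (y - x) a)
        (EuclideanSpace.proj a : Space d →L[ℝ] ℝ) y := by
      simpa using ((EuclideanSpace.proj a : Space d →L[ℝ] ℝ).hasFDerivAt (x := y)).sub_const (x a)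
    have hh : HasFDerivAt (fun y => -(1 / (2 * t)) * (heatKernel d t (y - x) * (y - x) a)) _ y :=
      ((hasFDerivAt_heatKernel t x y).mul hp).const_mul (-(1 / (2 * t)))
    rw [hh.fderiv]
    simp [dir, EuclideanSpace.inner_single_right]
    field_simp
    ring
  rw [lap, Finset.sum_congr rfl fun a _ => h1 a, ← Finset.mul_sum, Finset.sum_sub_distrib,
    ← Finset.sum_div, EuclideanSpace.norm_sq_eq]
  simp only [Finset.sum_const, Finset.card_univ, Fintype.card_fin, nsmul_eq_mul, Real.norm_eq_abs,
    sq_abs]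
  ring

/-- The time derivative has the same form as `lap_heatKernel`; the two together are the heat
equation. -/
theorem hasDerivAt_heatKernel {t : ℝ} (ht : 0 < t) (z : Space d) :
    HasDerivAt (fun s => heatKernel d s z)
      (heatKernel d t z * (‖z‖ ^ 2 / (4 * t ^ 2) - (d : ℝ) / (2 * t))) t := by
  have h1 : HasDerivAt (fun s : ℝ => (4 * Real.pi * s) ^ (-((d : ℝ) / 2)))
      ((4 * Real.pi * t) ^ (-((d : ℝ) / 2)) * (-((d : ℝ) / 2) / t)) t := by
    have := (((hasDerivAt_id t).const_mul (4 * Real.pi)).rpow_const (p := -((d : ℝ) / 2))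
      (Or.inl (by simp only [id_eq]; positivity)))
    refine this.congr_deriv ?_
    simp only [id_eq]
    rw [Real.rpow_sub_one (by positivity)]
    field_simp
  have h2 : HasDerivAt (fun s : ℝ => -(1 / (4 * s)) * ‖z‖ ^ 2) (‖z‖ ^ 2 / (4 * t ^ 2)) t := by
    have h3 := ((hasDerivAt_inv ht.ne').const_mul (-(1 / 4 * ‖z‖ ^ 2)))
    refine (h3.congr_of_eventuallyEq (Eventually.of_forall fun s => ?_)).congr_deriv ?_
    · simp only [one_div, mul_inv]; ring
    · field_simp
  refine (h1.mul h2.exp).congr_deriv ?_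
  unfold heatKernel
  field_simp
  ring

theorem heatKernel_le {t₀ t : ℝ} (ht₀ : 0 < t₀) (ht : t₀ ≤ t) (z : Space d) :
    heatKernel d t z ≤ (4 * Real.pi * t₀) ^ (-((d : ℝ) / 2)) := by
  have h1 : Real.exp (-(1 / (4 * t)) * ‖z‖ ^ 2) ≤ 1 := by
    rw [Real.exp_le_one_iff]
    have : 0 ≤ 1 / (4 * t) * ‖z‖ ^ 2 := by have := ht₀.trans_le ht; positivity
    linarith
  have h2 : (4 * Real.pi * t) ^ (-((d : ℝ) / 2)) ≤ (4 * Real.pi * t₀) ^ (-((d : ℝ) / 2)) :=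
    Real.rpow_le_rpow_of_nonpos (by positivity) (by gcongr) (by
      rw [neg_nonpos]; positivity)
  unfold heatKernel
  calc _ ≤ (4 * Real.pi * t₀) ^ (-((d : ℝ) / 2)) * 1 := by gcongr
    _ = _ := mul_one _

/-- At time `1 / c²` the kernel is the rescaling `c ^ d * φ (c • z)` of the kernel at time one, so
small times become an approximate identity as `c → ∞`. -/
theorem heatKernel_inv_sq {c : ℝ} (hc : 0 < c) (z : Space d) :
    heatKernel d (1 / c ^ 2) z = c ^ d * heatKernel d 1 (c • z) := by
  unfold heatKernel
  rw [norm_smul, mul_pow, Real.norm_eq_abs, sq_abs, ← mul_assoc]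
  congr 1
  · rw [Real.mul_rpow (by positivity) (by positivity), mul_one, one_div, Real.inv_rpow (by positivity),
      ← Real.rpow_neg (by positivity), neg_neg, ← Real.rpow_natCast c 2, ← Real.rpow_mul hc.le]
    rw [mul_comm, ← Real.rpow_natCast c d]
    congr 2
    push_cast; ring
  · congr 1
    field_simp

/-- The decay at infinity required of an approximate identity whose support is not compact. -/
theorem tendsto_heatKernel_cobounded :
    Tendsto (fun z : Space d => ‖z‖ ^ Module.finrank ℝ (Space d) * heatKernel d 1 z)
      (Bornology.cobounded (Space d)) (𝓝 0) := by
  have A : Tendsto (fun z : Space d => ‖z‖ ^ 2) (Bornology.cobounded (Space d)) atTop :=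
    (tendsto_pow_atTop two_ne_zero).comp tendsto_norm_cobounded_atTop
  have B := ((tendsto_rpow_mul_exp_neg_mul_atTop_nhds_zero ((d : ℝ) / 2) (1 / 4)
    (by norm_num)).comp A).const_mul ((4 * Real.pi * 1) ^ (-((d : ℝ) / 2)))
  rw [mul_zero] at B
  refine B.congr fun z => ?_
  have h : ‖z‖ ^ d = (‖z‖ ^ 2) ^ ((d : ℝ) / 2) := by
    rw [← Real.rpow_natCast ‖z‖ 2, ← Real.rpow_mul (norm_nonneg _), ← Real.rpow_natCast]
    congr 1; push_cast; ring
  simp only [Function.comp_apply, heatKernel, finrank_euclideanSpace_fin]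
  rw [h]
  norm_num
  ring

variable {U : Set (Space d)} {f : OneBody d}

theorem exists_norm_sub_le (hUb : Bornology.IsBounded U) (x : Space d) :
    ∃ R, ∀ y ∈ U, ‖y - x‖ ≤ R := by
  obtain ⟨R, hR⟩ := hUb.exists_norm_le
  exact ⟨R + ‖x‖, fun y hy => (norm_sub_le _ _).trans (by linarith [hR y hy])⟩

theorem integrableOn_norm_fst (hUb : Bornology.IsBounded U) :
    IntegrableOn (fun y => ‖f.fst y‖) U volume := by
  have : IsFiniteMeasure ((volume : Measure (Space d)).restrict U) :=
    ⟨by rw [Measure.restrict_apply_univ]; exact hUb.measure_lt_top⟩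
  exact (((Lp.memLp f.fst).restrict U).integrable (by norm_num)).norm

/-- The heat evolution of `|f|` (restricted to `U`). -/
def heatFlow (U : Set (Space d)) (f : OneBody d) (x : Space d) (t : ℝ) : ℝ :=
  ∫ y in U, ‖f.fst y‖ * heatKernel d t (y - x)

theorem continuous_heatKernel (t : ℝ) : Continuous (heatKernel d t) := by
  unfold heatKernel; fun_prop

theorem integrableOn_mul_heatKernel (hUb : Bornology.IsBounded U) {t : ℝ} (ht : 0 < t)
    (x : Space d) : IntegrableOn (fun y => ‖f.fst y‖ * heatKernel d t (y - x)) U volume := by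
  refine (integrableOn_norm_fst hUb).mul_bdd (c := (4 * Real.pi * t) ^ (-((d : ℝ) / 2)))
    ((continuous_heatKernel t).comp (by fun_prop)).aestronglyMeasurable
    (Eventually.of_forall fun y => ?_)
  rw [Real.norm_of_nonneg (heatKernel_nonneg ht.le _)]
  exact heatKernel_le ht le_rfl _

/-- Differentiation under the integral: for times above `t / 2` and `y` in the bounded set `U`, the
time derivative of the kernel is bounded by a constant. The heat equation then rewrites it as a
Laplacian in `y`. -/
theorem hasDerivAt_heatFlow (hUm : MeasurableSet U) (hUb : Bornology.IsBounded U) (x : Space d)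
    {t : ℝ} (ht : 0 < t) :
    HasDerivAt (heatFlow U f x)
      (∫ y in U, ‖f.fst y‖ * lap (dir d) (fun y => heatKernel d t (y - x)) y) t := by
  obtain ⟨R, hR⟩ := exists_norm_sub_le hUb x
  have hmeas : AEStronglyMeasurable (fun y => ‖f.fst y‖) (volume.restrict U) :=
    (Lp.aestronglyMeasurable f.fst).norm.restrict
  have hK : ∀ s, AEStronglyMeasurable (fun y => heatKernel d s (y - x)) (volume.restrict U) :=
    fun s => ((continuous_heatKernel s).comp (by fun_prop)).aestronglyMeasurable
  set B := (4 * Real.pi * (t / 2)) ^ (-((d : ℝ) / 2)) *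
    (R ^ 2 / (4 * (t / 2) ^ 2) + (d : ℝ) / (2 * (t / 2))) with hB
  have hmain := hasDerivAt_integral_of_dominated_loc_of_deriv_le
    (F := fun s y => ‖f.fst y‖ * heatKernel d s (y - x))
    (F' := fun s y => ‖f.fst y‖ * (heatKernel d s (y - x) *
      (‖y - x‖ ^ 2 / (4 * s ^ 2) - (d : ℝ) / (2 * s))))
    (μ := volume.restrict U) (bound := fun y => ‖f.fst y‖ * B) (s := Ioi (t / 2)) (x₀ := t)
    (Ioi_mem_nhds (by linarith)) (Eventually.of_forall fun s => hmeas.mul (hK s))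
    (integrableOn_mul_heatKernel hUb ht x)
    (hmeas.mul ((hK t).mul (by
      have : Continuous fun y : Space d => ‖y - x‖ ^ 2 / (4 * t ^ 2) - (d : ℝ) / (2 * t) := by
        fun_prop
      exact this.aestronglyMeasurable)))
    ?_ ((integrableOn_norm_fst hUb).mul_const B) ?_
  · refine hmain.2.congr_deriv ?_
    exact integral_congr_ae (Eventually.of_forall fun y => by simp only [lap_heatKernel ht])
  · filter_upwards [ae_restrict_mem hUm] with y hy s hs
    have hs' : t / 2 ≤ s := le_of_lt hs
    have ht2 : 0 < t / 2 := by linarith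
    rw [norm_mul, norm_norm, norm_mul, Real.norm_of_nonneg (heatKernel_nonneg (ht2.trans_le hs').le _),
      hB]
    gcongr
    · exact heatKernel_le ht2 hs' _
    · rw [Real.norm_eq_abs]
      refine (abs_sub _ _).trans ?_
      have hR0 := hR y hy
      rw [abs_of_nonneg (by positivity), abs_of_nonneg (by
        have := ht2.trans_le hs'
        positivity)]
      gcongr
  · refine Eventually.of_forall fun _ s hs => ?_
    exact (hasDerivAt_heatKernel (by
      have : t / 2 < s := hs
      linarith) _).const_mul _

theorem heatFlow_nonneg (x : Space d) {t : ℝ} (ht : 0 ≤ t) : 0 ≤ heatFlow U f x t :=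
  integral_nonneg fun y => mul_nonneg (norm_nonneg _) (heatKernel_nonneg ht _)

/-- The derivative of `e^{mr}` times the flow is `e^{mr}` times the expression that
`IsGround.subsolution` shows to be nonnegative when the test function is the heat kernel centred at
`x`. -/
theorem heatFlow_le_of_le (hUm : MeasurableSet U) (hUb : Bornology.IsBounded U)
    (hf : IsGround (H10 (dir d) U) 0 f) (hf0 : ∀ᵐ x, f.fst x = ((‖f.fst x‖ : ℝ) : ℂ))
    (x : Space d) {s t : ℝ} (hs : 0 < s) (hst : s ≤ t) :
    Real.exp (energy 0 f * s) * heatFlow U f x s ≤ Real.exp (energy 0 f * t) * heatFlow U f x t := by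
  set m := energy 0 f
  have hder : ∀ r ∈ Ioi (0 : ℝ), HasDerivAt (fun r => Real.exp (m * r) * heatFlow U f x r)
      (Real.exp (m * r) * (m * heatFlow U f x r +
        ∫ y in U, ‖f.fst y‖ * lap (dir d) (fun y => heatKernel d r (y - x)) y)) r := by
    intro r hr
    have h1 : HasDerivAt (fun r => Real.exp (m * r)) (Real.exp (m * r) * m) r := by
      simpa using ((hasDerivAt_id r).const_mul m).exp
    refine (h1.mul (hasDerivAt_heatFlow hUm hUb x hr)).congr_deriv (by ring)
  have hmono : MonotoneOn (fun r => Real.exp (m * r) * heatFlow U f x r) (Ioi 0) := by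
    refine monotoneOn_of_deriv_nonneg (convex_Ioi 0)
      (fun r hr => (hder r hr).continuousAt.continuousWithinAt)
      (fun r hr => ?_) (fun r hr => ?_)
    · rw [interior_Ioi] at hr
      exact (hder r hr).differentiableAt.differentiableWithinAt
    · rw [interior_Ioi] at hr
      rw [(hder r hr).deriv]
      have := hf.subsolution hUm hUb hf0 (contDiff_heatKernel r x)
        (fun y => heatKernel_nonneg (le_of_lt hr) _)
      refine mul_nonneg (Real.exp_pos _).le ?_
      have e : heatFlow U f x r = ∫ y in U, ‖f.fst y‖ * heatKernel d r (y - x) := rfl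
      rw [e]
      linarith
  exact hmono hs (hs.trans_le hst) hst

/-- The Cauchy–Schwarz bound by the `L²` norms of `f` and of the kernel, the latter being
`(8πt)^{-d/4}`. -/
theorem heatFlow_le (hUm : MeasurableSet U) (hUb : Bornology.IsBounded U) (hf1 : ‖f.fst‖ = 1)
    (x : Space d) {t : ℝ} (ht : 0 < t) :
    heatFlow U f x t ≤ (8 * Real.pi * t) ^ (-((d : ℝ) / 4)) := by
  set C := (8 * Real.pi * t) ^ (-((d : ℝ) / 4)) with hC
  have hC0 : 0 < C := by positivity
  have hCsq : C ^ 2 = (8 * Real.pi * t) ^ (-((d : ℝ) / 2)) := by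
    rw [hC, ← Real.rpow_natCast, ← Real.rpow_mul (by positivity)]
    congr 1; push_cast; ring
  have hi1 := integrable_norm_sq f.fst
  have hi2 : Integrable (fun y => heatKernel d (t / 2) (y - x)) volume :=
    (integrable_heatKernel (by positivity)).comp_sub_right x
  -- Writing the kernel as `C * a` with `a² = heatKernel d (t / 2)`, this is `s * (C a) ≤ C (s² +
  -- a²) / 2`; both squares integrate to one over the whole space.
  have h1 : heatFlow U f x t ≤ ∫ y in U, (C / 2 * ‖f.fst y‖ ^ 2 +
      C / 2 * heatKernel d (t / 2) (y - x)) := by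
    refine setIntegral_mono_on (integrableOn_mul_heatKernel hUb ht x)
      ((hi1.const_mul _).add (hi2.const_mul _)).integrableOn hUm fun y _ => ?_
    have h2 := heatKernel_sq ht (y - x)
    rw [← hCsq] at h2
    have h3 : heatKernel d (t / 2) (y - x) = (heatKernel d t (y - x) / C) ^ 2 := by
      rw [div_pow, h2]; field_simp
    rw [h3]
    have h4 : heatKernel d t (y - x) = C * (heatKernel d t (y - x) / C) := by field_simp
    set a := heatKernel d t (y - x) / C
    rw [h4]
    nlinarith [mul_nonneg hC0.le (sq_nonneg (‖f.fst y‖ - a))]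
  refine h1.trans ((setIntegral_le_integral ((hi1.const_mul _).add (hi2.const_mul _))
    (Eventually.of_forall fun y => ?_)).trans (le_of_eq ?_))
  · have := heatKernel_nonneg (d := d) (t := t / 2) (by positivity) (y - x)
    simp only [Pi.zero_apply, Pi.add_apply]
    positivity
  · rw [integral_add' (hi1.const_mul _) (hi2.const_mul _), integral_const_mul, integral_const_mul,
      ← norm_sq_eq_integral, hf1, integral_sub_right_eq_self (heatKernel d (t / 2)) x,
      integral_heatKernel (by positivity)]
    ring

/-- A heat flow bounded by `M` for small times implies that the initial value is bounded by `M`. -/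
theorem integral_mul_le_of_heatFlow_le (hUb : Bornology.IsBounded U) {M t : ℝ}
    (ht : 0 < t) (hM : ∀ x s, 0 < s → s ≤ t → heatFlow U f x s ≤ M) {h : Space d → ℝ}
    (hc : Continuous h) (hs : HasCompactSupport h) (h0 : ∀ x, 0 ≤ h x) :
    ∫ y in U, ‖f.fst y‖ * h y ≤ M * ∫ x, h x := by
  obtain ⟨H, hH⟩ := hs.exists_bound_of_continuous hc
  have hi : Integrable h volume := hc.integrable_of_hasCompactSupport hs
  -- `T c` is `h` smeared by the heat kernel at time `1 / c²`. It converges to `h` pointwise and is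
  -- bounded by the bound of `h`, so it suffices to prove the estimate for `T c`.
  set T : ℝ → Space d → ℝ := fun c y => ∫ z, heatKernel d (1 / c ^ 2) (y - z) * h z with hT
  have hsw : ∀ c y, ∀ z : Space d, heatKernel d c (y - z) = heatKernel d c (z - y) := fun c y z => by
    unfold heatKernel; rw [norm_sub_rev]
  have hTlim : ∀ y, Tendsto (fun c => T c y) atTop (𝓝 (h y)) := by
    intro y
    have := tendsto_integral_comp_smul_smul_of_integrable' (μ := (volume : Measure (Space d)))
      (φ := heatKernel d 1) (fun x => heatKernel_nonneg zero_le_one x) (integral_heatKernel one_pos)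
      tendsto_heatKernel_cobounded hi (x₀ := y) hc.continuousAt
    refine this.congr' ?_
    filter_upwards [eventually_gt_atTop 0] with c hc0
    simp only [hT]
    refine integral_congr_ae (Eventually.of_forall fun z => ?_)
    simp only [heatKernel_inv_sq hc0, finrank_euclideanSpace_fin, smul_eq_mul]
  have hTb : ∀ c, 0 < c → ∀ y, ‖T c y‖ ≤ H := by
    intro c hc0 y
    have hki : Integrable (fun z => heatKernel d (1 / c ^ 2) (y - z)) volume :=
      (integrable_heatKernel (by positivity)).comp_sub_left y
    calc ‖T c y‖ ≤ ∫ z, heatKernel d (1 / c ^ 2) (y - z) * H := by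
          refine norm_integral_le_of_norm_le (hki.mul_const H) (Eventually.of_forall fun z => ?_)
          have := heatKernel_nonneg (d := d) (t := 1 / c ^ 2) (by positivity) (y - z)
          rw [norm_mul, Real.norm_of_nonneg this]
          gcongr
          exact hH z
      _ = H := by
          rw [integral_mul_const, integral_sub_left_eq_self (heatKernel d (1 / c ^ 2)) volume y,
            integral_heatKernel (by positivity), one_mul]
  have hTm : ∀ c, AEStronglyMeasurable (T c) (volume.restrict U) := fun c => by
    have : Continuous fun p : Space d × Space d => heatKernel d (1 / c ^ 2) (p.1 - p.2) * h p.2 :=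
      ((continuous_heatKernel _).comp (by fun_prop)).mul (by fun_prop)
    exact this.stronglyMeasurable.integral_prod_right.aestronglyMeasurable
  have hlim : Tendsto (fun c => ∫ y in U, ‖f.fst y‖ * T c y) atTop
      (𝓝 (∫ y in U, ‖f.fst y‖ * h y)) := by
    refine tendsto_integral_filter_of_dominated_convergence (fun y => ‖f.fst y‖ * H)
      (Eventually.of_forall fun c => (Lp.aestronglyMeasurable f.fst).norm.restrict.mul (hTm c)) ?_
      ((integrableOn_norm_fst hUb).mul_const H)
      (Eventually.of_forall fun y => (hTlim y).const_mul _)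
    filter_upwards [eventually_gt_atTop 0] with c hc0
    refine Eventually.of_forall fun y => ?_
    rw [norm_mul, norm_norm]
    gcongr
    exact hTb c hc0 y
  refine le_of_tendsto hlim ?_
  -- `c ≥ √(1 / t)` means `1 / c² ≤ t`, the range of times in which the bound `M` is available.
  filter_upwards [eventually_gt_atTop 0, eventually_ge_atTop (Real.sqrt (1 / t))] with c hc0 hct
  have hct' : 1 / c ^ 2 ≤ t := by
    have : 1 / t ≤ c ^ 2 := by
      rw [← Real.sq_sqrt (show (0:ℝ) ≤ 1 / t by positivity)]; gcongr
    rw [div_le_iff₀ (by positivity)] at this ⊢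
    linarith
  have hc2 : 0 < 1 / c ^ 2 := by positivity
  -- By Fubini and the symmetry of the kernel, the smearing moves from `h` to `|f|`.
  have hF : ∫ y in U, ‖f.fst y‖ * T c y = ∫ z, h z * heatFlow U f z (1 / c ^ 2) := by
    have h1 : ∀ y, ‖f.fst y‖ * T c y =
        ∫ z, ‖f.fst y‖ * (heatKernel d (1 / c ^ 2) (y - z) * h z) := fun y => by
      rw [integral_const_mul]
    have h2 : ∀ z, h z * heatFlow U f z (1 / c ^ 2) =
        ∫ y in U, ‖f.fst y‖ * (heatKernel d (1 / c ^ 2) (y - z) * h z) := fun z => by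
      rw [heatFlow, ← integral_const_mul]
      exact integral_congr_ae (Eventually.of_forall fun y => by ring)
    simp only [h1, h2]
    refine integral_integral_swap ?_
    have hprod : Integrable (fun p : Space d × Space d => ‖f.fst p.1‖ * h p.2)
        ((volume.restrict U).prod volume) := (integrableOn_norm_fst hUb).mul_prod hi
    have hk : Continuous fun p : Space d × Space d => heatKernel d (1 / c ^ 2) (p.1 - p.2) :=
      (continuous_heatKernel _).comp (by fun_prop)
    refine (hprod.bdd_mul (c := (4 * Real.pi * (1 / c ^ 2)) ^ (-((d : ℝ) / 2)))
      hk.aestronglyMeasurable (Eventually.of_forall fun p => ?_)).congr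
      (Eventually.of_forall fun p => ?_)
    · rw [Real.norm_of_nonneg (heatKernel_nonneg hc2.le _)]
      exact heatKernel_le hc2 le_rfl _
    · simp only [Function.uncurry]; ring
  rw [hF, ← integral_const_mul]
  refine integral_mono_of_nonneg (Eventually.of_forall fun z =>
    mul_nonneg (h0 z) (heatFlow_nonneg z hc2.le)) (hi.const_mul M)
    (Eventually.of_forall fun z => ?_)
  have := mul_le_mul_of_nonneg_left (hM z _ hc2 hct') (h0 z)
  simp only
  linarith

/-- Pointwise bound of a nonnegative ground state. -/
theorem IsGround.ae_norm_le (hUm : MeasurableSet U) (hUb : Bornology.IsBounded U)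
    (hf : IsGround (H10 (dir d) U) 0 f) (hf0 : ∀ᵐ x, f.fst x = ((‖f.fst x‖ : ℝ) : ℂ))
    {t : ℝ} (ht : 0 < t) :
    ∀ᵐ x, ‖f.fst x‖ ≤ Real.exp (energy 0 f * t) * (8 * Real.pi * t) ^ (-((d : ℝ) / 4)) := by
  set M := Real.exp (energy 0 f * t) * (8 * Real.pi * t) ^ (-((d : ℝ) / 4)) with hMdef
  have hm0 : 0 ≤ energy 0 f := by rw [energy]; simp
  -- The exponentially weighted flow is nondecreasing, so its value at `t` dominates all earlier
  -- ones, and the weight at time `s` is at least one.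
  have hM : ∀ x s, 0 < s → s ≤ t → heatFlow U f x s ≤ M := by
    intro x s hs hst
    have h1 := heatFlow_le_of_le hUm hUb hf hf0 x hs hst
    have h2 := heatFlow_le hUm hUb hf.2.1 x ht
    have h3 : 1 ≤ Real.exp (energy 0 f * s) := Real.one_le_exp (by positivity)
    have h4 := heatFlow_nonneg (U := U) (f := f) x hs.le
    calc heatFlow U f x s ≤ Real.exp (energy 0 f * s) * heatFlow U f x s := by nlinarith
      _ ≤ _ := h1
      _ ≤ M := by rw [hMdef]; gcongr
  have hfU := ae_eq_zero_of_mem_H10 hUm hf.1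
  have hloc : LocallyIntegrable (fun x => ‖f.fst x‖) volume :=
    (Lp.memLp f.fst).norm.locallyIntegrable (by norm_num)
  -- Convolution with shrinking normalized bumps converges almost everywhere and turns the weak
  -- bound into a pointwise one.
  set φ : ℕ → ContDiffBump (0 : Space d) := fun n =>
    ⟨1 / ((n : ℝ) + 1), 2 * (1 / ((n : ℝ) + 1)), Nat.one_div_pos_of_nat, by
      have := Nat.one_div_pos_of_nat (α := ℝ) (n := n); linarith⟩ with hφ
  have hconv := ContDiffBump.ae_convolution_tendsto_right_of_locallyIntegrable
    (μ := (volume : Measure (Space d))) (φ := φ) (l := atTop) (K := 2)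
    (by
      have := (tendsto_one_div_add_atTop_nhds_zero_nat (𝕜 := ℝ)).const_mul 2
      rw [mul_zero] at this
      exact this)
    (Eventually.of_forall fun n => le_rfl) hloc
  filter_upwards [hconv] with x hx
  refine le_of_tendsto' hx fun n => ?_
  have hsupp : HasCompactSupport fun y => (φ n).normed volume (x - y) :=
    (φ n).hasCompactSupport_normed.comp_homeomorph (Homeomorph.subLeft x)
  have h1 := integral_mul_le_of_heatFlow_le hUb ht hM
    (h := fun y => (φ n).normed volume (x - y))
    ((φ n).continuous_normed.comp (by fun_prop)) hsupp (fun y => (φ n).nonneg_normed _)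
  rw [integral_sub_left_eq_self ((φ n).normed volume) volume x, (φ n).integral_normed, mul_one] at h1
  refine le_trans (le_of_eq ?_) h1
  rw [convolution_eq_swap, ← integral_indicator hUm]
  refine integral_congr_ae ?_
  filter_upwards [hfU] with y hy
  by_cases h : y ∈ U
  · rw [indicator_of_mem h]
    exact mul_comm _ _
  · rw [indicator_of_notMem h, hy h]; simp

/-- The density of a nonnegative ground state of the Dirichlet Laplacian is at most
`C₁² λ^{d/2}`. -/
theorem IsGround.ae_norm_sq_le (hd : 1 ≤ d) (hUm : MeasurableSet U) (hUb : Bornology.IsBounded U)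
    (hf : IsGround (H10 (dir d) U) 0 f) (hf0 : ∀ᵐ x, f.fst x = ((‖f.fst x‖ : ℝ) : ℂ)) :
    ∀ᵐ x, ‖f.fst x‖ ^ 2 ≤ C1 d ^ 2 * energy 0 f ^ ((d : ℝ) / 2) := by
  set m := energy 0 f with hm
  have hm0 : 0 ≤ m := by rw [hm, energy]; simp
  have hd0 : (0 : ℝ) < d := by exact_mod_cast hd
  rcases hm0.eq_or_lt with h0 | hpos
  -- With eigenvalue zero the bound has no exponential growth and tends to zero as time grows,
  -- contradicting normalization.
  · exfalso
    have hall : ∀ᵐ x, ∀ n : ℕ, ‖f.fst x‖ ≤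
        (8 * Real.pi * ((n : ℝ) + 1)) ^ (-((d : ℝ) / 4)) := by
      rw [ae_all_iff]
      intro n
      filter_upwards [hf.ae_norm_le hUm hUb hf0 (t := (n : ℝ) + 1) (by positivity)] with x hx
      rw [← hm, ← h0] at hx
      simpa using hx
    have hlim : Tendsto (fun n : ℕ => (8 * Real.pi * ((n : ℝ) + 1)) ^ (-((d : ℝ) / 4))) atTop
        (𝓝 0) := by
      refine (tendsto_rpow_neg_atTop (by positivity)).comp ?_
      refine Tendsto.const_mul_atTop (by positivity) ?_
      exact tendsto_atTop_add_const_right _ _ tendsto_natCast_atTop_atTop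
    have hz : f.fst = 0 := by
      rw [Lp.eq_zero_iff_ae_eq_zero]
      filter_upwards [hall] with x hx
      exact norm_le_zero_iff.1 (ge_of_tendsto' hlim hx)
    exact ne_zero_of_norm_one hf.2.1 hz
  -- The time `1 / m` turns the exponential into `e`. The resulting constant `e (8π)^{-d/4}` is
  -- smaller than `C1 d`.
  · filter_upwards [hf.ae_norm_le hUm hUb hf0 (t := 1 / m) (by positivity)] with x hx
    rw [← hm] at hx
    have e1 : m * (1 / m) = 1 := by field_simp
    rw [e1] at hx
    have h1 : ‖f.fst x‖ ^ 2 ≤ (Real.exp 1 * (8 * Real.pi * (1 / m)) ^ (-((d : ℝ) / 4))) ^ 2 := by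
      gcongr
    refine h1.trans ?_
    have e2 : (8 * Real.pi * (1 / m)) ^ (-((d : ℝ) / 4)) ≤
        (4 * Real.pi) ^ (-((d : ℝ) / 4)) * m ^ ((d : ℝ) / 4) := by
      rw [Real.mul_rpow (by positivity) (by positivity), one_div, Real.inv_rpow hm0,
        ← Real.rpow_neg hm0, neg_neg]
      gcongr ?_ * _
      exact Real.rpow_le_rpow_of_nonpos (by positivity) (by nlinarith [Real.pi_pos])
        (by rw [neg_nonpos]; positivity)
    have e3 : (m ^ ((d : ℝ) / 4)) ^ 2 = m ^ ((d : ℝ) / 2) := by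
      rw [← Real.rpow_natCast, ← Real.rpow_mul hm0]; congr 1; push_cast; ring
    rw [← e3, C1, ← mul_pow]
    have h4 : 0 ≤ (4 * Real.pi) ^ (-((d : ℝ) / 4)) * m ^ ((d : ℝ) / 4) := by positivity
    have h5 : 0 < Real.exp 1 := Real.exp_pos 1
    refine pow_le_pow_left₀ (by positivity) ?_ 2
    nlinarith [mul_nonneg h5.le h4, mul_le_mul_of_nonneg_left e2 h5.le]

end Heat

/-! ### The continuous representative of the interaction -/

section Inversion

open scoped FourierTransform SchwartzMap

variable {d : ℕ} {v : Space d → ℝ}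

/-- Fourier inversion almost everywhere. -/
theorem ae_eq_fourierInv_fourier {V : Type*} [NormedAddCommGroup V] [InnerProductSpace ℝ V]
    [FiniteDimensional ℝ V] [MeasurableSpace V] [BorelSpace V] {f : V → ℂ} (hf : Integrable f)
    (hF : Integrable (𝓕 f)) : ∀ᵐ x, f x = 𝓕⁻ (𝓕 f) x := by
  -- The Fourier transform can be moved from one factor of an integral to the other.
  have hsa : ∀ {g h : V → ℂ}, Integrable g → Integrable h →
      ∫ ξ, 𝓕 g ξ * h ξ = ∫ x, g x * 𝓕 h x := fun {g h} hg hh => by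
    simpa using! VectorFourier.integral_fourierIntegral_smul_eq_flip (L := innerₗ V)
      Real.continuous_fourierChar continuous_inner hg hh
  have hFn : Integrable (fun x => 𝓕 f (-x)) := hF.comp_neg
  have hcont : Continuous (𝓕⁻ (𝓕 f)) := by
    rw [Real.fourierInv_eq_fourier_comp_neg]
    exact VectorFourier.fourierIntegral_continuous Real.continuous_fourierChar
      (L := innerₗ V) continuous_inner hFn
  refine ae_eq_of_integral_contDiff_smul_eq hf.locallyIntegrable hcont.locallyIntegrable
    fun φ hφ hφs => ?_
  have h1 : ContDiff ℝ ((⊤ : ℕ∞) : WithTop ℕ∞) (fun x => (φ x : ℂ)) :=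
    Complex.ofRealCLM.contDiff.comp hφ
  have h2 : HasCompactSupport (fun x => (φ x : ℂ)) := hφs.comp_left Complex.ofReal_zero
  set Φ : 𝓢(V, ℂ) := h2.toSchwartzMap h1 with hΦ
  have hΦx : ∀ x, Φ x = (φ x : ℂ) := fun x => rfl
  -- The test function is itself the transform of a Schwartz function; moving the transform across
  -- the integral twice leaves it paired with `𝓕⁻ (𝓕 f)`.
  set Ψ : 𝓢(V, ℂ) := 𝓕⁻ Φ with hΨ
  have hΨΦ : 𝓕 (Ψ : V → ℂ) = Φ := by
    rw [← SchwartzMap.fourier_coe, hΨ, FourierTransform.fourier_fourierInv_eq]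
  have hΨx : ∀ x, Ψ x = 𝓕 (Φ : V → ℂ) (-x) := fun x => by
    rw [hΨ, SchwartzMap.fourierInv_coe, Real.fourierInv_eq_fourier_neg]
  have hFs : ∀ (g : V → ℂ), ∫ x, φ x • g x = ∫ x, Φ x * g x := fun g =>
    integral_congr_ae (Eventually.of_forall fun x => by simp only [hΦx, Complex.real_smul])
  rw [hFs, hFs]
  calc ∫ x, Φ x * f x = ∫ x, 𝓕 (Ψ : V → ℂ) x * f x := by rw [hΨΦ]
    _ = ∫ x, Ψ x * 𝓕 f x := hsa Ψ.integrable hf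
    _ = ∫ x, 𝓕 (Φ : V → ℂ) (-x) * 𝓕 f (- -x) := by simp only [hΨx, neg_neg]
    _ = ∫ x, 𝓕 (Φ : V → ℂ) x * 𝓕 f (-x) :=
        integral_neg_eq_self (fun x => 𝓕 (Φ : V → ℂ) x * 𝓕 f (-x)) volume
    _ = ∫ x, Φ x * 𝓕 (fun y => 𝓕 f (-y)) x := hsa Φ.integrable hFn
    _ = ∫ x, Φ x * 𝓕⁻ (𝓕 f) x := by rw [Real.fourierInv_eq_fourier_comp_neg]

/-- The Fourier weight of the interaction. -/
def weight (v : Space d → ℝ) (ξ : Space d) : ℝ :=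
  (2 * Real.pi) ^ (-((d : ℝ) / 2)) * (fourier v ξ).re

/-- The continuous representative of the interaction. -/
def rep (v : Space d → ℝ) (x : Space d) : ℝ := ∫ ξ, weight v ξ * Real.cos (inner ℝ x ξ)

theorem fourier_eq_fourierTransform (v : Space d → ℝ) (ξ : Space d) :
    fourier v ξ = (((2 * Real.pi) ^ (-((d : ℝ) / 2)) : ℝ) : ℂ) *
      𝓕 (fun x => (v x : ℂ)) ((2 * Real.pi)⁻¹ • ξ) := by
  rw [fourier, Real.fourier_eq']
  congr 1
  refine integral_congr_ae (Eventually.of_forall fun x => ?_)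
  simp only [smul_eq_mul, inner_smul_right]
  congr 2
  push_cast
  field_simp

variable (hv : IsAdmissibleInteraction v)
include hv

theorem IsAdmissibleInteraction.weight_nonneg (ξ : Space d) : 0 ≤ weight v ξ :=
  mul_nonneg (by positivity) (hv.fourier_nonneg ξ).1

theorem IsAdmissibleInteraction.integrable_weight : Integrable (weight v) volume :=
  hv.fourier_integrable.re.const_mul _

theorem IsAdmissibleInteraction.integral_weight : ∫ ξ, weight v ξ = valueAtZero v := by
  simp only [weight, valueAtZero]
  rw [integral_const_mul]
  congr 1
  refine integral_congr_ae (Eventually.of_forall fun ξ => ?_)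
  have h := hv.fourier_nonneg ξ
  have : fourier v ξ = (((fourier v ξ).re : ℝ) : ℂ) := Complex.ext rfl (by simp [h.2])
  simp only
  rw [this, Complex.norm_real, Real.norm_of_nonneg h.1, Complex.ofReal_re]

theorem IsAdmissibleInteraction.integrable_weight_mul {g : Space d → ℝ} (hg : Continuous g) {C : ℝ}
    (hC : ∀ x, |g x| ≤ C) : Integrable (fun ξ => weight v ξ * g ξ) volume :=
  hv.integrable_weight.mul_bdd (c := C) hg.aestronglyMeasurable (Eventually.of_forall hC)

theorem IsAdmissibleInteraction.continuous_rep : Continuous (rep v) := by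
  refine continuous_of_dominated (F := fun x ξ => weight v ξ * Real.cos (inner ℝ x ξ))
    (bound := fun ξ => weight v ξ) (fun x => ?_) (fun x => Eventually.of_forall fun ξ => ?_)
    hv.integrable_weight (Eventually.of_forall fun ξ => by fun_prop)
  · exact (hv.integrable_weight_mul (C := 1) (by fun_prop)
      fun ξ => Real.abs_cos_le_one _).aestronglyMeasurable
  · rw [norm_mul, Real.norm_of_nonneg (hv.weight_nonneg ξ)]
    exact mul_le_of_le_one_right (hv.weight_nonneg ξ) (Real.abs_cos_le_one _)

/-- Fourier inversion in the normalization of `fourier`. Since the transform of `v` is real, taking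
real parts of the inversion integral leaves only the cosine. -/
theorem IsAdmissibleInteraction.ae_eq_rep : v =ᵐ[volume] rep v := by
  have h1 : Integrable (fun x => (v x : ℂ)) volume :=
    (memLp_one_iff_integrable.1 hv.memLp_one).ofReal
  have hp : (0 : ℝ) < 2 * Real.pi := by positivity
  set c : ℂ := (((2 * Real.pi) ^ (-((d : ℝ) / 2)) : ℝ) : ℂ) with hc
  have hc0 : c ≠ 0 := by rw [hc, Complex.ofReal_ne_zero]; positivity
  have hF : ∀ ξ, 𝓕 (fun x => (v x : ℂ)) ξ = c⁻¹ * fourier v ((2 * Real.pi) • ξ) := fun ξ => by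
    rw [fourier_eq_fourierTransform, smul_smul, inv_mul_cancel₀ hp.ne', one_smul, ← mul_assoc, ← hc,
      inv_mul_cancel₀ hc0, one_mul]
  have h2 : Integrable (𝓕 (fun x => (v x : ℂ))) volume := by
    rw [funext hF]
    exact (hv.fourier_integrable.comp_smul hp.ne').const_mul _
  filter_upwards [ae_eq_fourierInv_fourier h1 h2] with x hx
  have hre : ∀ ξ, fourier v ξ = (((fourier v ξ).re : ℝ) : ℂ) := fun ξ =>
    Complex.ext rfl (by simp [(hv.fourier_nonneg ξ).2])
  have h3 : 𝓕⁻ (𝓕 (fun x => (v x : ℂ))) x =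
      ∫ ξ, c * fourier v ξ * Complex.exp (Complex.I * (inner ℝ x ξ : ℝ)) := by
    rw [Real.fourierInv_eq']
    have := Measure.integral_comp_smul (volume : Measure (Space d))
      (fun ξ => c * fourier v ξ * Complex.exp (Complex.I * (inner ℝ x ξ : ℝ))) (2 * Real.pi)
    rw [finrank_euclideanSpace_fin, abs_of_pos (by positivity),
      eq_inv_smul_iff₀ (pow_ne_zero _ hp.ne')] at this
    rw [← this, ← integral_smul]
    -- The Jacobian of the frequency rescaling cancels the square of the prefactor `(2π)^{-d/2}`.
    have hcc : ((2 * Real.pi) ^ d : ℝ) * c * c = 1 := by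
      rw [hc, ← Complex.ofReal_mul, ← Complex.ofReal_mul, Complex.ofReal_eq_one,
        ← Real.rpow_natCast, ← Real.rpow_add hp, ← Real.rpow_add hp]
      convert Real.rpow_zero _ using 2
      ring
    have hci : c⁻¹ = ((2 * Real.pi) ^ d : ℝ) * c := (eq_inv_of_mul_eq_one_left hcc).symm
    refine integral_congr_ae (Eventually.of_forall fun ξ => ?_)
    simp only [hF, smul_eq_mul, inner_smul_right, Complex.real_smul, hci, real_inner_comm x ξ,
      mul_comm Complex.I]
    ring
  have h4 : v x = (𝓕⁻ (𝓕 (fun x => (v x : ℂ))) x).re := by rw [← hx, Complex.ofReal_re]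
  rw [h4, h3, rep]
  have hint : Integrable (fun ξ => c * fourier v ξ * Complex.exp (Complex.I * (inner ℝ x ξ : ℝ)))
      volume := by
    refine (hv.fourier_integrable.const_mul c).mul_bdd (c := 1)
      (by fun_prop : Continuous _).aestronglyMeasurable (Eventually.of_forall fun ξ => ?_)
    rw [mul_comm, Complex.norm_exp_ofReal_mul_I]
  rw [← RCLike.re_to_complex, ← integral_re hint]
  refine integral_congr_ae (Eventually.of_forall fun ξ => ?_)
  simp only [RCLike.re_to_complex]
  rw [hre ξ, hc, ← Complex.ofReal_mul, Complex.re_ofReal_mul, mul_comm Complex.I,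
    Complex.exp_ofReal_mul_I_re, weight]

end Inversion

/-! ### Interaction energies -/

section Interaction

variable {d : ℕ} {v : Space d → ℝ}

theorem rep_neg (v : Space d → ℝ) (x : Space d) : rep v (-x) = rep v x := by
  simp only [rep, inner_neg_left, Real.cos_neg]

theorem rep_sub_comm (v : Space d → ℝ) (x y : Space d) : rep v (x - y) = rep v (y - x) := by
  rw [← rep_neg, neg_sub]

/-- The potential generated by the density `h`. -/
def potential (v : Space d → ℝ) (h : Space d → ℝ) (x : Space d) : ℝ := ∫ y, h y * rep v (x - y)

/-- The mutual interaction energy of the densities `g` and `h`. -/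
def interact (v : Space d → ℝ) (g h : Space d → ℝ) : ℝ := ∫ x, g x * potential v h x

/-- The density of a one-particle function. -/
def density (u : OneBody d) (x : Space d) : ℝ := ‖u.fst x‖ ^ 2

theorem integrable_density (u : OneBody d) : Integrable (density u) volume :=
  integrable_norm_sq u.fst

theorem density_nonneg (u : OneBody d) (x : Space d) : 0 ≤ density u x := sq_nonneg _

theorem integral_density (u : OneBody d) : ∫ x, density u x = ‖u.fst‖ ^ 2 :=
  (norm_sq_eq_integral u.fst).symm

theorem integral_mul_integral_swap {h K : Space d → ℝ} (hh : Integrable h volume)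
    (hK : Integrable K volume) {c : Space d → Space d → ℝ} (hc : Continuous (Function.uncurry c))
    (hc1 : ∀ x y, |c x y| ≤ 1) :
    ∫ y, h y * ∫ ξ, K ξ * c y ξ = ∫ ξ, K ξ * ∫ y, h y * c y ξ := by
  simp only [← integral_const_mul]
  rw [integral_integral_swap]
  · refine integral_congr_ae (Eventually.of_forall fun ξ => integral_congr_ae
      (Eventually.of_forall fun y => by ring))
  · refine ((hh.mul_prod hK).mul_bdd (c := 1) hc.aestronglyMeasurable
      (Eventually.of_forall fun p => hc1 p.1 p.2)).congr (Eventually.of_forall fun p => ?_)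
    simp only [Function.uncurry]
    ring

theorem integrable_mul_of_abs_le_one {h : Space d → ℝ} (hh : Integrable h volume)
    {c : Space d → ℝ} (hc : Continuous c) (hc1 : ∀ x, |c x| ≤ 1) :
    Integrable (fun y => h y * c y) volume :=
  hh.mul_bdd (c := 1) hc.aestronglyMeasurable (Eventually.of_forall hc1)

theorem continuous_integral_mul {h : Space d → ℝ} (hh : Integrable h volume)
    {c : Space d → Space d → ℝ} (hc : Continuous (Function.uncurry c)) {C : ℝ}
    (hc1 : ∀ x y, |c x y| ≤ C) : Continuous fun x => ∫ y, h y * c y x := by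
  refine continuous_of_dominated (bound := fun y => ‖h y‖ * C) (fun x => ?_)
    (fun x => Eventually.of_forall fun y => ?_) (hh.norm.mul_const _) (Eventually.of_forall fun y => ?_)
  · exact hh.aestronglyMeasurable.mul
      ((hc.comp (by fun_prop : Continuous fun y : Space d => (y, x))).aestronglyMeasurable)
  · rw [norm_mul]
    gcongr
    exact hc1 y x
  · exact continuous_const.mul (hc.comp (by fun_prop : Continuous fun x : Space d => (y, x)))

theorem abs_integral_mul_le {h : Space d → ℝ} (hh : Integrable h volume)
    {c : Space d → ℝ} {C : ℝ} (hc1 : ∀ x, |c x| ≤ C) : |∫ y, h y * c y| ≤ C * ∫ y, |h y| := by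
  rw [← Real.norm_eq_abs, ← integral_const_mul]
  refine norm_integral_le_of_norm_le (hh.abs.const_mul C) (Eventually.of_forall fun y => ?_)
  rw [norm_mul, mul_comm]
  exact mul_le_mul_of_nonneg_right (hc1 y) (norm_nonneg _)

theorem integral_norm_mul_norm_le {X E : Type*} [MeasureSpace X] [NormedAddCommGroup E]
    [InnerProductSpace ℂ E] (f g : Lp E 2 (volume : Measure X)) :
    ∫ x, ‖f x‖ * ‖g x‖ ≤ ‖f‖ * ‖g‖ := by
  have h := integral_mul_norm_le_Lp_mul_Lq (μ := (volume : Measure X)) (f := f) (g := g)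
    Real.HolderConjugate.two_two (by simpa using Lp.memLp f) (by simpa using Lp.memLp g)
  have e : ∀ k : Lp E 2 (volume : Measure X), (∫ x, ‖k x‖ ^ (2 : ℝ)) ^ (1 / (2 : ℝ)) = ‖k‖ := fun k => by
    rw [← Real.sqrt_eq_rpow]
    simp only [Real.rpow_two]
    rw [← norm_sq_eq_integral, Real.sqrt_sq (norm_nonneg _)]
  rwa [e, e] at h

/-- The `N` diagonal terms separated here, each equal to `v(0)`, are the source of the error `N
v(0)/2`. -/
theorem sum_rep_eq {N : ℕ} (v : Space d → ℝ) (x : Config N d) :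
    ∑ i, ∑ j, rep v (x i - x j) = N * rep v 0 + 2 * pairPotential (rep v) x := by
  have h1 := Finset.sum_sum_Ioi_add_eq_sum_sum_off_diag fun i j : Fin N => rep v (x i - x j)
  have h3 : ∀ i j : Fin N, rep v (x j - x i) = rep v (x i - x j) := fun i j => rep_sub_comm _ _ _
  have h2 : ∀ i : Fin N, ∑ j, rep v (x i - x j) =
      rep v 0 + ∑ j ∈ {i}ᶜ, rep v (x j - x i) := fun i => by
    rw [← Finset.sum_add_sum_compl {i}, Finset.sum_singleton, sub_self]
    congr 1
    exact Finset.sum_congr rfl fun j _ => h3 j i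
  rw [Finset.sum_congr rfl fun i _ => h2 i, Finset.sum_add_distrib, ← h1]
  simp only [Finset.sum_const, Finset.card_univ, Fintype.card_fin, nsmul_eq_mul, pairPotential,
    Finset.mul_sum]
  congr 1
  refine Finset.sum_congr rfl fun i _ => Finset.sum_congr rfl fun j _ => ?_
  rw [h3 i j]
  ring

variable (hv : IsAdmissibleInteraction v)
include hv

/-- The continuous functions `|rep v|` and `rep v` agree almost everywhere, hence everywhere. -/
theorem IsAdmissibleInteraction.rep_nonneg (x : Space d) : 0 ≤ rep v x := by
  have h : (fun x => |rep v x|) = rep v := by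
    refine (Continuous.ae_eq_iff_eq volume hv.continuous_rep.abs hv.continuous_rep).1 ?_
    filter_upwards [hv.ae_eq_rep, hv.nonneg] with x h1 h2
    rw [← h1, abs_of_nonneg h2]
  rw [← congrFun h x]
  exact abs_nonneg _

theorem IsAdmissibleInteraction.abs_rep_le (x : Space d) : |rep v x| ≤ valueAtZero v := by
  rw [← hv.integral_weight, ← Real.norm_eq_abs]
  refine norm_integral_le_of_norm_le hv.integrable_weight (Eventually.of_forall fun ξ => ?_)
  rw [norm_mul, Real.norm_of_nonneg (hv.weight_nonneg ξ)]
  exact mul_le_of_le_one_right (hv.weight_nonneg ξ) (Real.abs_cos_le_one _)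

theorem IsAdmissibleInteraction.valueAtZero_nonneg : 0 ≤ valueAtZero v :=
  (abs_nonneg _).trans (hv.abs_rep_le 0)

theorem IsAdmissibleInteraction.rep_zero : rep v 0 = valueAtZero v := by
  rw [← hv.integral_weight, rep]
  simp

theorem IsAdmissibleInteraction.ae_eq_rep_sub (x : Space d) : ∀ᵐ y, v (x - y) = rep v (x - y) :=
  (quasiMeasurePreserving_sub_left volume x).ae hv.ae_eq_rep

theorem IsAdmissibleInteraction.integrable_rep : Integrable (rep v) volume :=
  (memLp_one_iff_integrable.1 hv.memLp_one).congr hv.ae_eq_rep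

theorem IsAdmissibleInteraction.integral_rep : ∫ x, rep v x = ∫ x, |v x| := by
  refine integral_congr_ae ?_
  filter_upwards [hv.ae_eq_rep] with x hx
  rw [hx, abs_of_nonneg (hv.rep_nonneg x)]

theorem IsAdmissibleInteraction.integral_mul_eq_potential (h : Space d → ℝ) (x : Space d) :
    ∫ y, h y * v (x - y) = potential v h x := by
  refine integral_congr_ae ?_
  filter_upwards [hv.ae_eq_rep_sub x] with y hy
  rw [hy]

theorem IsAdmissibleInteraction.selfInteraction_eq (u : OneBody d) :
    selfInteraction v u = interact v (density u) (density u) := by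
  rw [selfInteraction, interact]
  refine integral_congr_ae (Eventually.of_forall fun x => ?_)
  simp only
  rw [← hv.integral_mul_eq_potential, ← integral_const_mul]
  refine integral_congr_ae (Eventually.of_forall fun y => ?_)
  simp only [density]
  ring

theorem IsAdmissibleInteraction.meanFieldPotential_eq (N : ℕ) (u : OneBody d) :
    meanFieldPotential N v u = fun x => ((N : ℝ) - 1) * potential v (density u) x -
      ((N : ℝ) - 1) / 2 * interact v (density u) (density u) := by
  ext x
  rw [meanFieldPotential, hv.selfInteraction_eq, ← hv.integral_mul_eq_potential]
  rfl

theorem IsAdmissibleInteraction.continuous_uncurry :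
    Continuous (Function.uncurry fun y x : Space d => rep v (x - y)) :=
  hv.continuous_rep.comp (by fun_prop : Continuous fun p : Space d × Space d => p.2 - p.1)

theorem IsAdmissibleInteraction.continuous_potential {h : Space d → ℝ} (hh : Integrable h volume) :
    Continuous (potential v h) :=
  continuous_integral_mul hh hv.continuous_uncurry fun _ _ => hv.abs_rep_le _

theorem IsAdmissibleInteraction.abs_potential_le {h : Space d → ℝ} (hh : Integrable h volume)
    (x : Space d) : |potential v h x| ≤ valueAtZero v * ∫ y, |h y| :=
  abs_integral_mul_le hh fun _ => hv.abs_rep_le _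

theorem IsAdmissibleInteraction.potential_nonneg {h : Space d → ℝ} (h0 : ∀ x, 0 ≤ h x)
    (x : Space d) : 0 ≤ potential v h x :=
  integral_nonneg fun y => mul_nonneg (h0 y) (hv.rep_nonneg _)

theorem IsAdmissibleInteraction.integrable_mul_rep {h : Space d → ℝ} (hh : Integrable h volume)
    (x : Space d) : Integrable (fun y => h y * rep v (x - y)) volume :=
  hh.mul_bdd (c := valueAtZero v)
    (hv.continuous_rep.comp (by fun_prop)).aestronglyMeasurable
    (Eventually.of_forall fun _ => hv.abs_rep_le _)

theorem IsAdmissibleInteraction.integrable_mul_potential {g h : Space d → ℝ}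
    (hg : Integrable g volume) (hh : Integrable h volume) :
    Integrable (fun x => g x * potential v h x) volume :=
  hg.mul_bdd (c := valueAtZero v * ∫ y, |h y|)
    (hv.continuous_potential hh).aestronglyMeasurable
    (Eventually.of_forall fun x => hv.abs_potential_le hh x)

theorem IsAdmissibleInteraction.memLp_potential {h : Space d → ℝ} (hh : Integrable h volume) :
    MemLp (potential v h) ∞ volume :=
  memLp_top_of_bound (hv.continuous_potential hh).aestronglyMeasurable (valueAtZero v * ∫ y, |h y|)
    (Eventually.of_forall fun x => hv.abs_potential_le hh x)

theorem IsAdmissibleInteraction.memLp_meanFieldPotential (N : ℕ) (u : OneBody d) :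
    MemLp (meanFieldPotential N v u) ∞ volume := by
  rw [hv.meanFieldPotential_eq]
  exact ((hv.memLp_potential (integrable_density u)).const_mul _).sub (memLp_top_const _)

theorem IsAdmissibleInteraction.interact_comm {g h : Space d → ℝ} (hg : Integrable g volume)
    (hh : Integrable h volume) : interact v g h = interact v h g := by
  simp only [interact, potential, ← integral_const_mul]
  rw [integral_integral_swap]
  · refine integral_congr_ae (Eventually.of_forall fun x => integral_congr_ae
      (Eventually.of_forall fun y => ?_))
    simp only [rep_sub_comm v y x]
    ring
  · refine ((hg.mul_prod hh).mul_bdd (c := valueAtZero v)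
      (hv.continuous_rep.comp (by fun_prop : Continuous fun p : Space d × Space d =>
        p.1 - p.2)).aestronglyMeasurable
      (Eventually.of_forall fun p => hv.abs_rep_le _)).congr (Eventually.of_forall fun p => ?_)
    simp only [Function.uncurry, Function.comp_apply]
    ring

theorem IsAdmissibleInteraction.interact_add_left {g h k : Space d → ℝ} (hg : Integrable g volume)
    (hh : Integrable h volume) (hk : Integrable k volume) (a b : ℝ) :
    interact v (fun y => a * g y + b * h y) k = a * interact v g k + b * interact v h k := by
  simp only [interact]
  rw [← integral_const_mul, ← integral_const_mul, ← integral_add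
    ((hv.integrable_mul_potential hg hk).const_mul a) ((hv.integrable_mul_potential hh hk).const_mul b)]
  exact integral_congr_ae (Eventually.of_forall fun y => by ring)

theorem IsAdmissibleInteraction.interact_combination {g h : Space d → ℝ} (hg : Integrable g volume)
    (hh : Integrable h volume) (a b : ℝ) :
    interact v (fun y => a * g y + b * h y) (fun y => a * g y + b * h y) =
      a ^ 2 * interact v g g + 2 * (a * b) * interact v g h + b ^ 2 * interact v h h := by
  have hs : Integrable (fun y => a * g y + b * h y) volume := (hg.const_mul a).add (hh.const_mul b)
  rw [hv.interact_add_left hg hh hs, hv.interact_comm hg hs, hv.interact_comm hh hs,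
    hv.interact_add_left hg hh hg, hv.interact_add_left hg hh hh, hv.interact_comm hh hg]
  ring

theorem IsAdmissibleInteraction.interact_nonneg {g h : Space d → ℝ} (hg : ∀ x, 0 ≤ g x)
    (hh : ∀ x, 0 ≤ h x) : 0 ≤ interact v g h :=
  integral_nonneg fun x => mul_nonneg (hg x) (hv.potential_nonneg hh x)

theorem IsAdmissibleInteraction.abs_interact_le {g h : Space d → ℝ} (hg : Integrable g volume)
    (hh : Integrable h volume) : |interact v g h| ≤ (valueAtZero v * ∫ y, |h y|) * ∫ y, |g y| :=
  abs_integral_mul_le hg fun x => hv.abs_potential_le hh x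

/-- A bounded density generates a potential bounded by its supremum times `‖v‖₁`. -/
theorem IsAdmissibleInteraction.interact_le_of_le {g : Space d → ℝ} (hg : Integrable g volume)
    (h0 : ∀ x, 0 ≤ g x) {M : ℝ} (hM : ∀ᵐ x, g x ≤ M) :
    interact v g g ≤ (M * ∫ x, |v x|) * ∫ x, g x := by
  have hpot : ∀ x, potential v g x ≤ M * ∫ x, |v x| := fun x => by
    rw [← hv.integral_rep, ← integral_sub_left_eq_self (rep v) volume x, ← integral_const_mul]
    refine integral_mono_ae (hv.integrable_mul_rep hg x)
      ((hv.integrable_rep.comp_sub_left x).const_mul M) ?_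
    filter_upwards [hM] with y hy
    exact mul_le_mul_of_nonneg_right hy (hv.rep_nonneg _)
  rw [interact, ← integral_const_mul]
  refine integral_mono (hv.integrable_mul_potential hg hg) (hg.const_mul _) fun x => ?_
  simp only
  rw [mul_comm]
  exact mul_le_mul_of_nonneg_right (hpot x) (h0 x)

/-- Positive definiteness of the interaction, for point charges in a background. -/
theorem IsAdmissibleInteraction.pos_def {ι : Type*} [Fintype ι] (x : ι → Space d) {h : Space d → ℝ}
    (hh : Integrable h volume) (s : ℝ) :
    0 ≤ ∑ i, ∑ j, rep v (x i - x j) - 2 * s * ∑ i, potential v h (x i) + s ^ 2 * interact v h h := by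
  have hcos : Continuous (Function.uncurry fun y ξ : Space d => Real.cos (inner ℝ y ξ)) := by
    simp only [Function.uncurry_def]; fun_prop
  have hsin : Continuous (Function.uncurry fun y ξ : Space d => Real.sin (inner ℝ y ξ)) := by
    simp only [Function.uncurry_def]; fun_prop
  -- `Cc` and `Ss` are the cosine and sine transforms of `h`; the addition formula splits every term
  -- into a cosine part and a sine part, treated separately.
  set Cc : Space d → ℝ := fun ξ => ∫ y, h y * Real.cos (inner ℝ y ξ) with hCc
  set Ss : Space d → ℝ := fun ξ => ∫ y, h y * Real.sin (inner ℝ y ξ) with hSs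
  have hCcont : Continuous Cc := continuous_integral_mul hh hcos fun _ _ => Real.abs_cos_le_one _
  have hScont : Continuous Ss := continuous_integral_mul hh hsin fun _ _ => Real.abs_sin_le_one _
  set I := ∫ y, |h y| with hI
  have hCb : ∀ ξ, |Cc ξ| ≤ I := fun ξ => by
    simpa using abs_integral_mul_le hh (c := fun y => Real.cos (inner ℝ y ξ))
      fun _ => Real.abs_cos_le_one _
  have hSb : ∀ ξ, |Ss ξ| ≤ I := fun ξ => by
    simpa using abs_integral_mul_le hh (c := fun y => Real.sin (inner ℝ y ξ))
      fun _ => Real.abs_sin_le_one _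
  have hkC : Integrable (fun ξ => weight v ξ * Cc ξ) volume := hv.integrable_weight_mul hCcont hCb
  have hkS : Integrable (fun ξ => weight v ξ * Ss ξ) volume := hv.integrable_weight_mul hScont hSb
  have hkCc : ∀ y, Integrable (fun ξ => weight v ξ * Cc ξ * Real.cos (inner ℝ y ξ)) volume := fun y =>
    integrable_mul_of_abs_le_one hkC (by fun_prop) fun _ => Real.abs_cos_le_one _
  have hkSs : ∀ y, Integrable (fun ξ => weight v ξ * Ss ξ * Real.sin (inner ℝ y ξ)) volume := fun y =>
    integrable_mul_of_abs_le_one hkS (by fun_prop) fun _ => Real.abs_sin_le_one _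
  have hpot : ∀ y, potential v h y = (∫ ξ, weight v ξ * Cc ξ * Real.cos (inner ℝ y ξ)) +
      ∫ ξ, weight v ξ * Ss ξ * Real.sin (inner ℝ y ξ) := fun y => by
    have hc : Continuous (Function.uncurry fun z ξ : Space d => Real.cos (inner ℝ (y - z) ξ)) := by
      simp only [Function.uncurry_def]; fun_prop
    rw [← integral_add (hkCc y) (hkSs y)]
    simp only [potential, rep]
    rw [integral_mul_integral_swap hh hv.integrable_weight hc fun _ _ => Real.abs_cos_le_one _]
    refine integral_congr_ae (Eventually.of_forall fun ξ => ?_)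
    have e : ∀ z, h z * Real.cos (inner ℝ (y - z) ξ) =
        Real.cos (inner ℝ y ξ) * (h z * Real.cos (inner ℝ z ξ)) +
        Real.sin (inner ℝ y ξ) * (h z * Real.sin (inner ℝ z ξ)) := fun z => by
      rw [inner_sub_left, Real.cos_sub]; ring
    simp only [e]
    rw [integral_add ((integrable_mul_of_abs_le_one hh (by fun_prop)
        fun _ => Real.abs_cos_le_one _).const_mul _)
      ((integrable_mul_of_abs_le_one hh (by fun_prop) fun _ => Real.abs_sin_le_one _).const_mul _),
      integral_const_mul, integral_const_mul]
    simp only [hCc, hSs]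
    ring
  have hmut : interact v h h = (∫ ξ, weight v ξ * Cc ξ * Cc ξ) + ∫ ξ, weight v ξ * Ss ξ * Ss ξ := by
    have hc1 : Continuous fun y => ∫ ξ, weight v ξ * Cc ξ * Real.cos (inner ℝ y ξ) :=
      continuous_integral_mul hkC (c := fun ξ y => Real.cos (inner ℝ y ξ))
        (by simp only [Function.uncurry_def]; fun_prop) fun _ _ => Real.abs_cos_le_one _
    have hc2 : Continuous fun y => ∫ ξ, weight v ξ * Ss ξ * Real.sin (inner ℝ y ξ) :=
      continuous_integral_mul hkS (c := fun ξ y => Real.sin (inner ℝ y ξ))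
        (by simp only [Function.uncurry_def]; fun_prop) fun _ _ => Real.abs_sin_le_one _
    rw [interact]
    simp only [hpot, mul_add]
    rw [integral_add, integral_mul_integral_swap hh hkC hcos fun _ _ => Real.abs_cos_le_one _,
      integral_mul_integral_swap hh hkS hsin fun _ _ => Real.abs_sin_le_one _]
    · exact hh.mul_bdd hc1.aestronglyMeasurable (Eventually.of_forall fun y =>
        abs_integral_mul_le hkC (c := fun ξ => Real.cos (inner ℝ y ξ))
          fun _ => Real.abs_cos_le_one _)
    · exact hh.mul_bdd hc2.aestronglyMeasurable (Eventually.of_forall fun y =>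
        abs_integral_mul_le hkS (c := fun ξ => Real.sin (inner ℝ y ξ))
          fun _ => Real.abs_sin_le_one _)
  have hrep : ∀ i j, rep v (x i - x j) =
      (∫ ξ, weight v ξ * (Real.cos (inner ℝ (x i) ξ) * Real.cos (inner ℝ (x j) ξ))) +
      ∫ ξ, weight v ξ * (Real.sin (inner ℝ (x i) ξ) * Real.sin (inner ℝ (x j) ξ)) := fun i j => by
    rw [rep, ← integral_add]
    · refine integral_congr_ae (Eventually.of_forall fun ξ => ?_)
      simp only
      rw [inner_sub_left, Real.cos_sub]
      ring
    · refine hv.integrable_weight_mul (C := 1) (by fun_prop) fun ξ => ?_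
      rw [abs_mul]
      exact mul_le_one₀ (Real.abs_cos_le_one _) (abs_nonneg _) (Real.abs_cos_le_one _)
    · refine hv.integrable_weight_mul (C := 1) (by fun_prop) fun ξ => ?_
      rw [abs_mul]
      exact mul_le_one₀ (Real.abs_sin_le_one _) (abs_nonneg _) (Real.abs_sin_le_one _)
  -- For either trigonometric family the three terms combine into the integral of a perfect square,
  -- `∑ c (x i) - s G` squared, against the nonnegative Fourier weight.
  have key : ∀ (c : Space d → Space d → ℝ) (G : Space d → ℝ),
      Continuous (Function.uncurry c) → (∀ y ξ, |c y ξ| ≤ 1) → Continuous G → (∀ ξ, |G ξ| ≤ I) →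
      0 ≤ ∑ i, ∑ j, (∫ ξ, weight v ξ * (c (x i) ξ * c (x j) ξ)) -
        2 * s * ∑ i, (∫ ξ, weight v ξ * G ξ * c (x i) ξ) + s ^ 2 * ∫ ξ, weight v ξ * G ξ * G ξ := by
    intro c G hc hc1 hG hGI
    have hci : ∀ i, Continuous (c (x i)) := fun i =>
      hc.comp (by fun_prop : Continuous fun ξ => (x i, ξ))
    have i1 : ∀ i j, Integrable (fun ξ => weight v ξ * (c (x i) ξ * c (x j) ξ)) volume := fun i j =>
      hv.integrable_weight_mul (C := 1) ((hci i).mul (hci j)) fun ξ => by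
        rw [abs_mul]; exact mul_le_one₀ (hc1 _ _) (abs_nonneg _) (hc1 _ _)
    have i2 : ∀ i, Integrable (fun ξ => weight v ξ * G ξ * c (x i) ξ) volume := fun i =>
      integrable_mul_of_abs_le_one (hv.integrable_weight_mul hG hGI) (hci i) (hc1 _)
    have i3 : Integrable (fun ξ => weight v ξ * G ξ * G ξ) volume :=
      (hv.integrable_weight_mul hG hGI).mul_bdd (c := I) hG.aestronglyMeasurable
        (Eventually.of_forall hGI)
    have e : ∑ i, ∑ j, (∫ ξ, weight v ξ * (c (x i) ξ * c (x j) ξ)) -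
        2 * s * ∑ i, (∫ ξ, weight v ξ * G ξ * c (x i) ξ) + s ^ 2 * ∫ ξ, weight v ξ * G ξ * G ξ =
        ∫ ξ, weight v ξ * (∑ i, c (x i) ξ - s * G ξ) ^ 2 := by
      have j1 : Integrable (fun ξ => ∑ i, ∑ j, weight v ξ * (c (x i) ξ * c (x j) ξ)) volume :=
        integrable_finsetSum _ fun i _ => integrable_finsetSum _ fun j _ => i1 i j
      have j2 : Integrable (fun ξ => ∑ i, weight v ξ * G ξ * c (x i) ξ) volume :=
        integrable_finsetSum _ fun i _ => i2 i
      have j3 : Integrable (fun ξ => ∑ i, ∑ j, weight v ξ * (c (x i) ξ * c (x j) ξ) -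
          2 * s * ∑ i, weight v ξ * G ξ * c (x i) ξ) volume := j1.sub (j2.const_mul _)
      have s1 : ∑ i, ∑ j, (∫ ξ, weight v ξ * (c (x i) ξ * c (x j) ξ)) =
          ∫ ξ, ∑ i, ∑ j, weight v ξ * (c (x i) ξ * c (x j) ξ) := by
        rw [integral_finsetSum _ fun i _ => integrable_finsetSum _ fun j _ => i1 i j]
        exact Finset.sum_congr rfl fun i _ => (integral_finsetSum _ fun j _ => i1 i j).symm
      rw [s1, ← integral_finsetSum _ fun i _ => i2 i, ← integral_const_mul, ← integral_const_mul,
        ← integral_sub j1 (j2.const_mul _), ← integral_add j3 (i3.const_mul _)]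
      refine integral_congr_ae (Eventually.of_forall fun ξ => ?_)
      have a1 : ∑ i, ∑ j, weight v ξ * (c (x i) ξ * c (x j) ξ) =
          weight v ξ * (∑ i, c (x i) ξ) ^ 2 := by
        rw [sq, Finset.sum_mul_sum, Finset.mul_sum]
        exact Finset.sum_congr rfl fun i _ => (Finset.mul_sum _ _ _).symm
      simp only
      rw [a1, ← Finset.mul_sum]
      ring
    rw [e]
    exact integral_nonneg fun ξ => mul_nonneg (hv.weight_nonneg ξ) (sq_nonneg _)
  have k1 := key _ Cc hcos (fun _ _ => Real.abs_cos_le_one _) hCcont hCb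
  have k2 := key _ Ss hsin (fun _ _ => Real.abs_sin_le_one _) hScont hSb
  simp only [hrep, hpot, hmut, Finset.sum_add_distrib]
  linarith

/-- For `i ≠ j` the map `x ↦ x i - x j` is linear and surjective, so it pulls null sets back to null
sets; the exceptional set on which `v` differs from `rep v` therefore stays null in configuration
space. -/
theorem IsAdmissibleInteraction.ae_pairPotential_eq (N : ℕ) :
    ∀ᵐ x : Config N d, pairPotential v x = pairPotential (rep v) x := by
  have h : ∀ i j : Fin N, i ≠ j → ∀ᵐ x : Config N d, v (x i - x j) = rep v (x i - x j) := by
    intro i j hij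
    set L : Config N d →ₗ[ℝ] Space d := (LinearMap.proj i : Config N d →ₗ[ℝ] Space d) - LinearMap.proj j with hL
    have hsurj : Function.Surjective L := fun y => ⟨Pi.single i y, by
      simp [hL, Pi.single_eq_of_ne hij.symm]⟩
    obtain ⟨c, -, hc⟩ := L.exists_map_addHaar_eq_smul_addHaar volume volume hsurj
    have hq : Measure.QuasiMeasurePreserving L volume volume :=
      ⟨L.continuous_of_finiteDimensional.measurable, by
        rw [hc]; exact Measure.smul_absolutelyContinuous⟩
    exact hq.ae hv.ae_eq_rep
  have h' : ∀ᵐ x : Config N d, ∀ i j : Fin N, i ≠ j → v (x i - x j) = rep v (x i - x j) := by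
    simp only [ae_all_iff]
    exact h
  filter_upwards [h'] with x hx
  exact Finset.sum_congr rfl fun i _ => Finset.sum_congr rfl fun j hj =>
    hx i j (Finset.mem_Ioi.1 hj).ne

theorem IsAdmissibleInteraction.continuous_pairPotential_rep (N : ℕ) :
    Continuous fun x : Config N d => pairPotential (rep v) x :=
  continuous_finsetSum _ fun i _ => continuous_finsetSum _ fun j _ =>
    hv.continuous_rep.comp (by fun_prop)

theorem IsAdmissibleInteraction.memLp_pairPotential (N : ℕ) :
    MemLp (fun x : Config N d => pairPotential v x) ∞ volume := by
  have h : MemLp (fun x : Config N d => pairPotential (rep v) x) ∞ volume := by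
    refine memLp_top_of_bound (hv.continuous_pairPotential_rep N).aestronglyMeasurable
      (∑ i : Fin N, ∑ _j ∈ Finset.Ioi i, valueAtZero v) (Eventually.of_forall fun x => ?_)
    refine (norm_sum_le _ _).trans (Finset.sum_le_sum fun i _ => (norm_sum_le _ _).trans
      (Finset.sum_le_sum fun j _ => hv.abs_rep_le _))
  exact h.ae_eq (by filter_upwards [hv.ae_pairPotential_eq N] with x hx using hx.symm)

/-- Almost everywhere the pair interaction dominates the sum of the mean-field potentials, up to the
self-energy. -/
theorem IsAdmissibleInteraction.pairPotential_ge {N : ℕ} (hN : 1 ≤ N) (u : OneBody d) :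
    ∀ᵐ x : Config N d, ∑ i, meanFieldPotential N v u (x i) - N * valueAtZero v / 2 ≤
      pairPotential v x := by
  filter_upwards [hv.ae_pairPotential_eq N] with x hx
  -- Background charge `N - 1` makes the linear term that of the mean-field potentials. The
  -- quadratic term is `(N-1)²/2` times the self-energy, whereas the mean-field constants add up to
  -- `N(N-1)/2` times it; the surplus has the favourable sign.
  have h1 := hv.pos_def x (integrable_density u) ((N : ℝ) - 1)
  have h2 : 0 ≤ interact v (density u) (density u) :=
    hv.interact_nonneg (density_nonneg u) (density_nonneg u)
  have hN' : (1 : ℝ) ≤ N := by exact_mod_cast hN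
  rw [hx, hv.meanFieldPotential_eq, Finset.sum_sub_distrib, ← Finset.mul_sum]
  rw [sum_rep_eq, hv.rep_zero] at h1
  simp only [Finset.sum_const, Finset.card_univ, Fintype.card_fin, nsmul_eq_mul]
  nlinarith [mul_nonneg (sub_nonneg.2 hN') h2]

/-- The interaction energy is continuous on `L²`. -/
theorem IsAdmissibleInteraction.continuous_interact :
    Continuous fun f : Lp ℂ 2 (volume : Measure (Space d)) =>
      interact v (fun x => ‖f x‖ ^ 2) (fun x => ‖f x‖ ^ 2) := by
  rw [continuous_iff_continuousAt]
  intro f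
  rw [ContinuousAt, tendsto_iff_dist_tendsto_zero]
  have hlim : Tendsto (fun g : Lp ℂ 2 (volume : Measure (Space d)) =>
      (valueAtZero v * (‖g‖ ^ 2 + ‖f‖ ^ 2)) * (‖g - f‖ * ‖g‖ + ‖g - f‖ * ‖f‖)) (𝓝 f) (𝓝 0) := by
    have hc : Continuous (fun g : Lp ℂ 2 (volume : Measure (Space d)) =>
      (valueAtZero v * (‖g‖ ^ 2 + ‖f‖ ^ 2)) * (‖g - f‖ * ‖g‖ + ‖g - f‖ * ‖f‖)) := by fun_prop
    have := hc.tendsto f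
    simpa using this
  refine squeeze_zero (fun _ => dist_nonneg) (fun g => ?_) hlim
  have hg := integrable_norm_sq g
  have hf := integrable_norm_sq f
  -- Difference of squares for the symmetric bilinear form `interact`, evaluated on the difference
  -- and the sum of the two densities.
  have e : interact v (fun x => ‖g x‖ ^ 2) (fun x => ‖g x‖ ^ 2) -
      interact v (fun x => ‖f x‖ ^ 2) (fun x => ‖f x‖ ^ 2) =
      interact v (fun x => 1 * ‖g x‖ ^ 2 + (-1) * ‖f x‖ ^ 2)
        (fun x => 1 * ‖g x‖ ^ 2 + 1 * ‖f x‖ ^ 2) := by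
    have hs : Integrable (fun x => 1 * ‖g x‖ ^ 2 + 1 * ‖f x‖ ^ 2) volume :=
      (hg.const_mul 1).add (hf.const_mul 1)
    rw [hv.interact_add_left hg hf hs, hv.interact_comm hg hs, hv.interact_comm hf hs,
      hv.interact_add_left hg hf hg, hv.interact_add_left hg hf hf, hv.interact_comm hf hg]
    ring
  have hd : Integrable (fun x => 1 * ‖g x‖ ^ 2 + (-1) * ‖f x‖ ^ 2) volume :=
    (hg.const_mul 1).add (hf.const_mul (-1))
  have hs : Integrable (fun x => 1 * ‖g x‖ ^ 2 + 1 * ‖f x‖ ^ 2) volume :=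
    (hg.const_mul 1).add (hf.const_mul 1)
  rw [Real.dist_eq, e]
  refine (hv.abs_interact_le hd hs).trans ?_
  have i1 : ∫ x, |1 * ‖g x‖ ^ 2 + 1 * ‖f x‖ ^ 2| = ‖g‖ ^ 2 + ‖f‖ ^ 2 := by
    rw [norm_sq_eq_integral g, norm_sq_eq_integral f, ← integral_add hg hf]
    refine integral_congr_ae (Eventually.of_forall fun x => ?_)
    simp only [one_mul]
    exact abs_of_nonneg (by positivity)
  have hgf := Lp.coeFn_sub g f
  -- `|g|² - |f|²` factors into `(|g| - |f|)(|g| + |f|)`, and Cauchy–Schwarz bounds the integral by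
  -- `‖g - f‖ (‖g‖ + ‖f‖)`.
  have i2 : ∫ x, |1 * ‖g x‖ ^ 2 + (-1) * ‖f x‖ ^ 2| ≤ ‖g - f‖ * ‖g‖ + ‖g - f‖ * ‖f‖ := by
    have hint : ∀ k : Lp ℂ 2 (volume : Measure (Space d)),
        Integrable (fun x => ‖(g - f) x‖ * ‖k x‖) volume := fun k =>
      (Lp.memLp (g - f)).norm.integrable_mul (Lp.memLp k).norm
    refine le_trans ?_ (add_le_add (integral_norm_mul_norm_le (g - f) g)
      (integral_norm_mul_norm_le (g - f) f))
    rw [← integral_add (hint g) (hint f)]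
    refine integral_mono_ae hd.abs ((hint g).add (hint f)) ?_
    filter_upwards [hgf] with x hx
    have h1 : |‖g x‖ - ‖f x‖| ≤ ‖(g - f) x‖ := by
      rw [hx]; exact abs_norm_sub_norm_le _ _
    have h2 : 1 * ‖g x‖ ^ 2 + (-1) * ‖f x‖ ^ 2 = (‖g x‖ - ‖f x‖) * (‖g x‖ + ‖f x‖) := by ring
    rw [h2, abs_mul, abs_of_nonneg (show 0 ≤ ‖g x‖ + ‖f x‖ by positivity), ← mul_add]
    gcongr
  rw [i1]
  have := hv.valueAtZero_nonneg
  gcongr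

end Interaction

/-! ### The Hartree problem and the mean-field operator -/

section Components

variable {d : ℕ} {U K : Set (Space d)}

theorem span_dir (d : ℕ) : Submodule.span ℝ (range (dir d)) = ⊤ := by
  rw [← (EuclideanSpace.basisFun (Fin d) ℝ).toBasis.span_eq]
  congr 1
  ext x
  simp [dir]

theorem memLp_zero_top {X : Type*} [MeasureSpace X] : MemLp (0 : X → ℝ) ∞ volume := MemLp.zero

theorem energy_zero {X κ : Type*} [MeasureSpace X] [NormedAddCommGroup X] [NormedSpace ℝ X]
    [Fintype κ] (f : GradPair X κ) : energy 0 f = ‖f.snd‖ ^ 2 := by simp [energy]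

theorem dirichletEigenvalue_one_nonneg (U : Set (Space d)) : 0 ≤ dirichletEigenvalue U 1 := by
  refine Real.sInf_nonneg fun t ht => ?_
  refine bddBelow_eigenvalue (S := H10 (dir d) U) (n := 1) memLp_zero_top (m := 0) (fun g _ => ?_)
    one_pos ht
  rw [energy_zero, zero_mul]
  positivity

/-- If there were no two independent eigenfunctions, the second eigenvalue would be `sInf ∅ = 0`.
Positivity thus guarantees that the form domain is at least two-dimensional. -/
theorem exists_linearIndependent_of_pos (h : 0 < dirichletEigenvalue U 2) :
    ∃ f ∈ H10 (dir d) U, ∃ g ∈ H10 (dir d) U, LinearIndependent ℂ ![f.fst, g.fst] := by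
  by_contra hcon
  have : {t : ℝ | ∃ f : Fin 2 → OneBody d, LinearIndependent ℂ (fun i => (f i).fst) ∧
      ∀ i, ∃ μ ≤ t, IsEigenpair (oneBodyDomain U) 0 (f i) μ} = ∅ := by
    refine eq_empty_of_forall_notMem fun t ⟨f, hf, hfe⟩ => hcon ?_
    obtain ⟨a, -, ha⟩ := hfe 0
    obtain ⟨b, -, hb⟩ := hfe 1
    refine ⟨f 0, ha.1, f 1, hb.1, ?_⟩
    convert hf using 1
    ext i
    fin_cases i <;> rfl
  rw [dirichletEigenvalue, eigenvalue, this, Real.sInf_empty] at h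
  exact lt_irrefl _ h

theorem IsGround.of_energy_le {X κ : Type*} [MeasureSpace X] [NormedAddCommGroup X]
    [NormedSpace ℝ X] [Fintype κ] {S : Submodule ℂ (GradPair X κ)} {W : X → ℝ} {f g : GradPair X κ}
    (hf : IsGround S W f) (hg : g ∈ S) (hg1 : ‖g.fst‖ = 1) (h : energy W g ≤ energy W f) :
    IsGround S W g :=
  ⟨hg, hg1, fun k hk => (mul_le_mul_of_nonneg_right h (sq_nonneg _)).trans (hf.2.2 k hk)⟩

theorem inner_eq_zero_of_disjoint {X : Type*} [MeasureSpace X] {K : Set X}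
    {f g : Lp ℂ 2 (volume : Measure X)} (hf : ∀ᵐ x, x ∉ K → f x = 0)
    (hg : ∀ᵐ x, x ∈ K → g x = 0) : inner ℂ f g = 0 := by
  rw [L2.inner_def]
  refine integral_eq_zero_of_ae ?_
  filter_upwards [hf, hg] with x h1 h2
  by_cases hx : x ∈ K
  · simp [h2 hx]
  · simp [h1 hx]

theorem restrictL_fst_eq_zero {X κ : Type*} [MeasureSpace X] [NormedAddCommGroup X]
    [NormedSpace ℝ X] [BorelSpace X] [FiniteDimensional ℝ X] [(volume : Measure X).IsAddHaarMeasure]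
    [Fintype κ] {K : Set X} (hK : MeasurableSet K) (f : GradPair X κ) :
    ∀ᵐ x, x ∉ K → (restrictL hK f).fst x = 0 := by
  filter_upwards [restrictL_fst hK f] with x hx hxK
  rw [hx, indicator_of_notMem hxK]

theorem restrictL_compl_mem_H10 (hK : IsOpen K) (hKU : K ⊆ U) (hUK : IsOpen (U \ K)) {f : OneBody d}
    (hf : f ∈ H10 (dir d) U) : restrictL hK.measurableSet.compl f ∈ H10 (dir d) U := by
  have h : restrictL hK.measurableSet.compl f = f - restrictL hK.measurableSet f :=
    eq_sub_of_add_eq' (restrictL_add_compl hK.measurableSet f)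
  rw [h]
  exact Submodule.sub_mem _ hf (H10_mono hKU (restrictL_mem_H10 hK hUK hf))

/-- A connected component of an open set splits it into two open sets. -/
theorem isOpen_component (hU : IsOpen U) {x : Space d} (_hx : x ∈ U) :
    IsOpen (connectedComponentIn U x) ∧ IsOpen (U \ connectedComponentIn U x) := by
  refine ⟨hU.connectedComponentIn, isOpen_iff_forall_mem_open.2 fun y hy =>
    ⟨connectedComponentIn U y, fun z hz => ⟨connectedComponentIn_subset U y hz, fun hzx => hy.2 ?_⟩,
      hU.connectedComponentIn, mem_connectedComponentIn hy.1⟩⟩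
  rw [connectedComponentIn_eq hzx, ← connectedComponentIn_eq hz]
  exact mem_connectedComponentIn hy.1

variable (hUo : IsOpen U) (hUb : Bornology.IsBounded U)
  (hgap : dirichletEigenvalue U 1 < dirichletEigenvalue U 2)

include hUb in
theorem compact_H10 : HasCompactEmbedding (H10 (dir d) U) := hasCompactEmbedding_H10 (span_dir d) hUb

include hUb in
theorem IsGround.dirichlet_le {f g : OneBody d} (hf : IsGround (H10 (dir d) U) 0 f)
    (hg : g ∈ H10 (dir d) U) (hfg : inner ℂ f.fst g.fst = 0) :
    dirichletEigenvalue U 2 * ‖g.fst‖ ^ 2 ≤ energy 0 g :=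
  hf.eigenvalue_two_le_energy memLp_zero_top isClosed_H10 (compact_H10 hUb) hg hfg

theorem IsGround.dirichlet_eq {f : OneBody d} (hf : IsGround (H10 (dir d) U) 0 f) :
    dirichletEigenvalue U 1 = energy 0 f := hf.eigenvalue_one memLp_zero_top

include hUb hgap in
-- Strictness of the gap makes the ground state unique up to multiples: on its complement the energy
-- is at least the second eigenvalue.
theorem IsGround.fst_eq_zero_of_orthogonal {f g : OneBody d} (hf : IsGround (H10 (dir d) U) 0 f)
    (hg : g ∈ H10 (dir d) U) (hfg : inner ℂ f.fst g.fst = 0)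
    (he : energy 0 g ≤ energy 0 f * ‖g.fst‖ ^ 2) : g.fst = 0 := by
  have h1 := hf.dirichlet_le hUb hg hfg
  rw [← hf.dirichlet_eq] at he
  by_contra h0
  have : 0 < ‖g.fst‖ ^ 2 := by positivity
  nlinarith

include hUb hgap in
/-- A ground state cannot live on both sides of a splitting of the domain. -/
theorem IsGround.ae_eq_zero_or (hK : IsOpen K) (hKU : K ⊆ U) (hUK : IsOpen (U \ K)) {f : OneBody d}
    (hf : IsGround (H10 (dir d) U) 0 f) :
    (∀ᵐ x, x ∈ K → f.fst x = 0) ∨ (∀ᵐ x, x ∉ K → f.fst x = 0) := by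
  have hKm := hK.measurableSet
  set g := restrictL hKm f with hg
  set g' := restrictL hKm.compl f with hg'
  have hgS : g ∈ H10 (dir d) U := H10_mono hKU (restrictL_mem_H10 hK hUK hf.1)
  have hgS' : g' ∈ H10 (dir d) U := restrictL_compl_mem_H10 hK hKU hUK hf.1
  have e1 := energy_restrictL memLp_zero_top hKm f
  have e2 := norm_sq_restrictL_fst hKm f
  have e3 := hf.2.2 g hgS
  have e4 := hf.2.2 g' hgS'
  rw [hf.2.1] at e2
  -- Norms and energies of the two pieces add up to those of `f`, so each piece attains equality in
  -- its lower bound. If one piece is nonzero it is, after normalization, a ground state, and the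
  -- other, being orthogonal to it with the same energy quotient, must vanish.
  have e5 : energy 0 f * ‖g.fst‖ ^ 2 + energy 0 f * ‖g'.fst‖ ^ 2 = energy 0 f := by
    rw [← mul_add, ← e2]; ring
  have hsupp : ∀ᵐ x, x ∉ K → g.fst x = 0 := restrictL_fst_eq_zero hKm f
  have hsupp' : ∀ᵐ x, x ∈ K → g'.fst x = 0 := by
    filter_upwards [restrictL_fst_eq_zero hKm.compl f] with x hx hxK
    exact hx fun h => h hxK
  by_cases h0 : g.fst = 0
  · left
    filter_upwards [restrictL_fst hKm f, Lp.coeFn_zero ℂ 2 (volume : Measure (Space d))] with x h1 h2 hx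
    rw [← hg, h0, h2, indicator_of_mem hx] at h1
    exact h1.symm
  · right
    have hn : 0 < ‖g.fst‖ := norm_pos_iff.2 h0
    set c : ℂ := ((‖g.fst‖⁻¹ : ℝ) : ℂ) with hc
    have hcn : ‖c‖ = ‖g.fst‖⁻¹ := by
      rw [hc, Complex.norm_real, norm_inv, norm_norm]
    have hgr : IsGround (H10 (dir d) U) 0 (c • g) := by
      refine hf.of_energy_le (Submodule.smul_mem _ _ hgS) ?_ ?_
      · rw [WithLp.smul_fst, norm_smul, hcn, inv_mul_cancel₀ hn.ne']
      · rw [energy_smul, hcn, inv_pow, inv_mul_le_iff₀ (by positivity)]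
        linarith
    have h1 : g'.fst = 0 := by
      refine hgr.fst_eq_zero_of_orthogonal hUb hgap hgS' ?_ ?_
      · rw [WithLp.smul_fst, inner_smul_left, inner_eq_zero_of_disjoint hsupp hsupp', mul_zero]
      · rw [← hgr.dirichlet_eq, hf.dirichlet_eq]
        linarith
    filter_upwards [restrictL_fst hKm.compl f, Lp.coeFn_zero ℂ 2 (volume : Measure (Space d))]
      with x h2 h3 hx
    rw [← hg', h1, h3, indicator_of_mem hx] at h2
    exact h2.symm

theorem isGround_of_isEigenpair {f₀ f : OneBody d} (hf₀ : IsGround (H10 (dir d) U) 0 f₀)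
    (hf : IsEigenpair (oneBodyDomain U) 0 f (dirichletEigenvalue U 1)) (hf1 : ‖f.fst‖ = 1) :
    IsGround (H10 (dir d) U) 0 f := by
  refine hf₀.of_energy_le hf.1 hf1 ?_
  rw [hf.energy_eq memLp_zero_top, hf1, hf₀.dirichlet_eq]
  simp

include hUb hgap in
theorem exists_isGround_dirichlet : ∃ f, IsGround (H10 (dir d) U) 0 f := by
  obtain ⟨f, hf, g, hg, hfg⟩ := exists_linearIndependent_of_pos
    ((dirichletEigenvalue_one_nonneg U).trans_lt hgap)
  exact exists_isGround memLp_zero_top isClosed_H10 (compact_H10 hUb) ⟨f, hf, hfg.ne_zero 0⟩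

include hUo hUb hgap in
-- A ground state is nonzero on some component and then vanishes off it by `IsGround.ae_eq_zero_or`.
-- Ground states living on two different components would be orthogonal, which the gap forbids.
theorem existsUnique_isGroundComponent : ∃! K, IsGroundComponent U K := by
  obtain ⟨f, hf⟩ := exists_isGround_dirichlet hUb hgap
  have hsub : ∀ x, connectedComponentIn U x ⊆ U := connectedComponentIn_subset U
  have hex : ∃ x ∈ U, ¬ ∀ᵐ y, y ∈ connectedComponentIn U x → f.fst y = 0 := by
    by_contra! hcon
    refine ne_zero_of_norm_one hf.2.1 ((Lp.eq_zero_iff_ae_eq_zero).2 ?_)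
    -- Components are open, so every point of this set has a neighbourhood in which the set is null;
    -- that suffices, with no count of the components.
    have hnull : volume {y | y ∈ U ∧ f.fst y ≠ 0} = 0 := by
      refine measure_null_of_locally_null _ fun x hx => ?_
      refine ⟨connectedComponentIn U x ∩ {y | y ∈ U ∧ f.fst y ≠ 0},
        inter_mem (mem_nhdsWithin_of_mem_nhds ((isOpen_component hUo hx.1).1.mem_nhds
          (mem_connectedComponentIn hx.1))) self_mem_nhdsWithin, ?_⟩
      refine measure_mono_null (fun y hy => ?_) (ae_iff.1 (hcon x hx.1))
      simp only [mem_ofPred_eq, Classical.not_imp]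
      exact ⟨hy.1, hy.2.2⟩
    filter_upwards [ae_eq_zero_of_mem_H10 hUo.measurableSet hf.1, measure_eq_zero_iff_ae_notMem.1 hnull]
      with y h1 h2
    by_contra h3
    exact h2 ⟨by_contra fun h => h3 (h1 h), h3⟩
  obtain ⟨x, hx, hxf⟩ := hex
  have hopen := isOpen_component hUo hx
  have hsupp := (hf.ae_eq_zero_or hUb hgap hopen.1 (hsub x) hopen.2).resolve_left hxf
  refine ⟨connectedComponentIn U x, ⟨⟨x, hx, rfl⟩, f, ?_, hf.2.1, hsupp⟩, ?_⟩
  · rw [hf.dirichlet_eq]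
    exact hf.isEigenpair memLp_zero_top
  · rintro K' ⟨⟨y, hy, rfl⟩, φ, hφ, hφ1, hφs⟩
    have hφg := isGround_of_isEigenpair hf hφ hφ1
    by_contra hne
    have hdisj : Disjoint (connectedComponentIn U x) (connectedComponentIn U y) := by
      rw [Set.disjoint_left]
      intro z hzx hzy
      exact hne ((connectedComponentIn_eq hzy).trans (connectedComponentIn_eq hzx).symm)
    refine ne_zero_of_norm_one hφ1 (hf.fst_eq_zero_of_orthogonal hUb hgap hφ.1
      (inner_eq_zero_of_disjoint hsupp ?_) ?_)
    · filter_upwards [hφs] with z hz hzx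
      exact hz (Set.disjoint_left.1 hdisj hzx)
    · rw [← hφg.dirichlet_eq, ← hf.dirichlet_eq, hφ1]
      simp

/-- On the ground component there is a nonnegative ground state, of bounded density. -/
theorem IsGroundComponent.exists_ground (hd : 1 ≤ d) (hUo : IsOpen U) (hUb : Bornology.IsBounded U)
    (hgap : dirichletEigenvalue U 1 < dirichletEigenvalue U 2) (hK : IsGroundComponent U K) :
    ∃ w ∈ H10 (dir d) K, IsGround (H10 (dir d) U) 0 w ∧
      ∀ᵐ x, density w x ≤ C1 d ^ 2 * dirichletEigenvalue U 1 ^ ((d : ℝ) / 2) := by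
  obtain ⟨⟨x, hx, rfl⟩, φ, hφ, hφ1, hφs⟩ := hK
  obtain ⟨f, hf⟩ := exists_isGround_dirichlet hUb hgap
  have hφg := isGround_of_isEigenpair hf hφ hφ1
  have hopen := isOpen_component hUo hx
  have hsub : connectedComponentIn U x ⊆ U := connectedComponentIn_subset U x
  have hKm := hopen.1.measurableSet
  set g := restrictL hKm φ with hg
  have hgK : g ∈ H10 (dir d) (connectedComponentIn U x) := restrictL_mem_H10 hopen.1 hopen.2 hφ.1
  have hgφ : g.fst = φ.fst := by
    refine Lp.ext ?_
    filter_upwards [restrictL_fst hKm φ, hφs] with y h1 h2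
    rw [h1]
    by_cases hy : y ∈ connectedComponentIn U x
    · rw [indicator_of_mem hy]
    · rw [indicator_of_notMem hy, h2 hy]
  -- With weights `1` and `0` the square root is `|g|`: passing to the modulus does not raise the
  -- kinetic energy.
  obtain ⟨w, hwK, hw, hwe⟩ := exists_mem_H10_sqrt hKm (hUb.subset hsub) zero_le_one le_rfl hgK hgK
  have hw' : ∀ᵐ y, w.fst y = ((‖φ.fst y‖ : ℝ) : ℂ) := by
    filter_upwards [hw] with y hy
    rw [hy, hgφ]
    simp
  have hw1 : ‖w.fst‖ = 1 := by
    rw [← hφ1, ← sq_eq_sq₀ (norm_nonneg _) (norm_nonneg _), norm_sq_eq_integral, norm_sq_eq_integral]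
    refine integral_congr_ae ?_
    filter_upwards [hw'] with y hy
    rw [hy, Complex.norm_real, norm_norm]
  have hwg : IsGround (H10 (dir d) U) 0 w := by
    refine hφg.of_energy_le (H10_mono hsub hwK) hw1 ?_
    have h1 := norm_sq_restrictL_snd hKm φ
    have h2 := sq_nonneg ‖(restrictL hKm.compl φ).snd‖
    rw [energy_zero, energy_zero]
    linarith
  refine ⟨w, hwK, hwg, ?_⟩
  rw [hwg.dirichlet_eq]
  refine hwg.ae_norm_sq_le hd hUo.measurableSet hUb ?_
  filter_upwards [hw'] with y hy
  rw [hy, Complex.norm_real, norm_norm]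

end Components

/-! ### Hartree minimizers and the gap of their mean-field operator -/

section Hartree

variable {d N : ℕ} {U K : Set (Space d)} {v : Space d → ℝ}

theorem energy_meanField (hv : IsAdmissibleInteraction v) (N : ℕ) (u g : OneBody d) :
    energy (meanFieldPotential N v u) g = ‖g.snd‖ ^ 2 +
      ((N : ℝ) - 1) * interact v (density g) (density u) -
      ((N : ℝ) - 1) / 2 * interact v (density u) (density u) * ‖g.fst‖ ^ 2 := by
  have h1 := hv.integrable_mul_potential (integrable_density g) (integrable_density u)
  rw [energy, hv.meanFieldPotential_eq, ← integral_density g]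
  generalize interact v (density u) (density u) = D
  rw [interact, ← integral_const_mul, add_sub_assoc, ← integral_const_mul,
    ← integral_sub (h1.const_mul _) ((integrable_density g).const_mul _)]
  congr 1
  refine integral_congr_ae (Eventually.of_forall fun x => ?_)
  simp only [density]
  ring

theorem hartree_eq (hv : IsAdmissibleInteraction v) (N : ℕ) (u : OneBody d) :
    hartree N v u = ‖u.snd‖ ^ 2 + ((N : ℝ) - 1) / 2 * interact v (density u) (density u) := by
  rw [hartree, hv.selfInteraction_eq]

/-- The constant in the mean-field potential removes the double counting of the self-interaction at
`g = u`. -/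
theorem IsHartreeMinimizer.energy_eq (hv : IsAdmissibleInteraction v) {u : OneBody d}
    (hu : IsHartreeMinimizer N v K u) : energy (meanFieldPotential N v u) u = hartree N v u := by
  rw [energy_meanField hv, hartree_eq hv, hu.2.1]
  ring

theorem exists_isHartreeMinimizer (hv : IsAdmissibleInteraction v) (hN : 1 ≤ N)
    (hKb : Bornology.IsBounded K) (hne : ∃ f ∈ H10 (dir d) K, f.fst ≠ 0) :
    ∃ u, IsHartreeMinimizer N v K u := by
  have hN' : 0 ≤ ((N : ℝ) - 1) / 2 := by
    have : (1 : ℝ) ≤ N := by exact_mod_cast hN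
    linarith
  obtain ⟨u, hu, hu1, hmin⟩ := exists_minimizer isClosed_H10 (compact_H10 hKb)
    (fun f => ((N : ℝ) - 1) / 2 * interact v (fun x => ‖f x‖ ^ 2) (fun x => ‖f x‖ ^ 2))
    (continuous_const.mul hv.continuous_interact) 0
    (fun f _ => mul_nonneg hN' (hv.interact_nonneg (fun _ => sq_nonneg _) fun _ => sq_nonneg _)) hne
  refine ⟨u, hu, hu1, fun f hf hf1 => ?_⟩
  rw [hartree_eq hv, hartree_eq hv]
  exact hmin f hf hf1

/-- A Hartree minimizer is a ground state of its own mean-field operator. -/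
theorem IsHartreeMinimizer.isGround (hv : IsAdmissibleInteraction v) (hKm : MeasurableSet K)
    (hKb : Bornology.IsBounded K) {u : OneBody d} (hu : IsHartreeMinimizer N v K u) :
    IsGround (H10 (dir d) K) (meanFieldPotential N v u) u := by
  refine ⟨hu.1, hu.2.1, fun g hg => le_energy_of_normalized (fun ψ hψ hψ1 => ?_) hg⟩
  rw [hu.energy_eq hv]
  set c := ((N : ℝ) - 1) / 2 with hc
  set Du := interact v (density u) (density u) with hDu
  set Dm := interact v (density ψ) (density u) with hDm
  set Dψ := interact v (density ψ) (density ψ) with hDψ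
  -- The competitor is the square root of `(1-t)|u|² + t|ψ|²`: its kinetic energy is at most the
  -- interpolation and its interaction energy is a quadratic polynomial in `t`. Dividing the
  -- minimality inequality by `t` and sending `t → 0` gives the linearized inequality, which is
  -- minimality for the mean-field form.
  have hineq : ∀ t : ℝ, 0 < t → t < 1 →
      0 ≤ (‖ψ.snd‖ ^ 2 - ‖u.snd‖ ^ 2 + c * (2 * Dm - 2 * Du)) + t * (c * (Du - 2 * Dm + Dψ)) := by
    intro t ht0 ht1
    obtain ⟨w, hwK, hw, hwe⟩ := exists_mem_H10_sqrt hKm hKb (sub_nonneg.2 ht1.le) ht0.le hu.1 hψ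
    have hdw : density w =ᵐ[volume] fun x => (1 - t) * density u x + t * density ψ x := by
      filter_upwards [hw] with x hx
      simp only [density]
      rw [hx, Complex.norm_real, Real.norm_of_nonneg (Real.sqrt_nonneg _), Real.sq_sqrt]
      have := sub_nonneg.2 ht1.le
      positivity
    have hw1 : ‖w.fst‖ = 1 := by
      rw [← sq_eq_sq₀ (norm_nonneg _) zero_le_one, ← integral_density, integral_congr_ae hdw,
        integral_add ((integrable_density u).const_mul _) ((integrable_density ψ).const_mul _),
        integral_const_mul, integral_const_mul, integral_density, integral_density, hu.2.1, hψ1]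
      ring
    have hDw : interact v (density w) (density w) =
        (1 - t) ^ 2 * Du + 2 * ((1 - t) * t) * Dm + t ^ 2 * Dψ := by
      rw [hDm, hv.interact_comm (integrable_density ψ) (integrable_density u), hDu, hDψ,
        ← hv.interact_combination (integrable_density u) (integrable_density ψ)]
      have hpot : potential v (density w) =
          potential v fun x => (1 - t) * density u x + t * density ψ x := by
        ext x
        refine integral_congr_ae ?_
        filter_upwards [hdw] with y hy
        rw [hy]
      rw [interact, interact, hpot]
      refine integral_congr_ae ?_
      filter_upwards [hdw] with y hy
      rw [hy]
    have hmin := hu.2.2 w hwK hw1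
    rw [hartree_eq hv, hartree_eq hv, hDw, ← hc, ← hDu] at hmin
    have : 0 ≤ t * ((‖ψ.snd‖ ^ 2 - ‖u.snd‖ ^ 2 + c * (2 * Dm - 2 * Du)) +
        t * (c * (Du - 2 * Dm + Dψ))) := by nlinarith
    exact nonneg_of_mul_nonneg_right this ht0
  have hlim : Tendsto (fun t : ℝ => (‖ψ.snd‖ ^ 2 - ‖u.snd‖ ^ 2 + c * (2 * Dm - 2 * Du)) +
      t * (c * (Du - 2 * Dm + Dψ))) (𝓝[>] 0)
      (𝓝 ((‖ψ.snd‖ ^ 2 - ‖u.snd‖ ^ 2 + c * (2 * Dm - 2 * Du)) + 0 * (c * (Du - 2 * Dm + Dψ)))) := by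
    refine Tendsto.mono_left (Continuous.tendsto ?_ 0) nhdsWithin_le_nhds
    fun_prop
  have h0 := ge_of_tendsto hlim (by
    filter_upwards [Ioo_mem_nhdsGT (zero_lt_one (α := ℝ))] with t ht using hineq t ht.1 ht.2)
  rw [energy_meanField hv, hartree_eq hv, hψ1, ← hc, ← hDu, ← hDm]
  have : (N : ℝ) - 1 = 2 * c := by rw [hc]; ring
  rw [this]
  nlinarith

/-- The one-particle part of the theorem. -/
theorem IsHartreeMinimizer.meanField (hv : IsAdmissibleInteraction v) (hd : 1 ≤ d) (hN : 1 ≤ N)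
    (hUo : IsOpen U) (hUb : Bornology.IsBounded U)
    (hgap : dirichletEigenvalue U 2 - dirichletEigenvalue U 1 >
      C1 d ^ 2 * N * (∫ x, |v x|) * dirichletEigenvalue U 1 ^ ((d : ℝ) / 2))
    (hK : IsGroundComponent U K) {u : OneBody d} (hu : IsHartreeMinimizer N v K u) :
    IsGround (H10 (dir d) U) (meanFieldPotential N v u) u ∧
      meanFieldEigenvalue N v U u 1 = hartree N v u ∧
      meanFieldEigenvalue N v U u 1 < meanFieldEigenvalue N v U u 2 := by
  have hN' : (1 : ℝ) ≤ N := by exact_mod_cast hN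
  have hv1 : 0 ≤ ∫ x, |v x| := integral_nonneg fun _ => abs_nonneg _
  have hl0 := dirichletEigenvalue_one_nonneg U
  have hgap' : dirichletEigenvalue U 1 < dirichletEigenvalue U 2 := by
    have : 0 ≤ C1 d ^ 2 * N * (∫ x, |v x|) * dirichletEigenvalue U 1 ^ ((d : ℝ) / 2) := by
      positivity
    linarith
  obtain ⟨w, hwK, hwg, hwb⟩ := hK.exists_ground hd hUo hUb hgap'
  obtain ⟨⟨x, hx, rfl⟩, -⟩ := hK
  set K := connectedComponentIn U x with hKdef
  have hopen := isOpen_component hUo hx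
  rw [← hKdef] at hopen
  have hsub : K ⊆ U := connectedComponentIn_subset U x
  have hKm := hopen.1.measurableSet
  have huU : u ∈ H10 (dir d) U := H10_mono hsub hu.1
  set W := meanFieldPotential N v u with hWdef
  have hW : MemLp W ∞ volume := hv.memLp_meanFieldPotential N u
  set c := ((N : ℝ) - 1) / 2 with hc
  have hc0 : 0 ≤ c := by rw [hc]; linarith
  set Du := interact v (density u) (density u) with hDu
  set Dw := interact v (density w) (density w) with hDw
  set l1 := dirichletEigenvalue U 1 with hl1
  set l2 := dirichletEigenvalue U 2 with hl2
  have hDw0 : 0 ≤ Dw := hv.interact_nonneg (density_nonneg w) (density_nonneg w)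
  have hDwle : Dw ≤ C1 d ^ 2 * l1 ^ ((d : ℝ) / 2) * ∫ x, |v x| := by
    have := hv.interact_le_of_le (integrable_density w) (density_nonneg w) hwb
    rwa [integral_density, hwg.2.1, one_pow, mul_one] at this
  have hE : hartree N v u ≤ l1 + c * Dw := by
    refine (hu.2.2 w hwK hwg.2.1).trans (le_of_eq ?_)
    rw [hartree_eq hv, hl1, hwg.dirichlet_eq, energy_zero]
  have hT : l1 ≤ ‖u.snd‖ ^ 2 := by
    have := hwg.2.2 u huU
    rwa [hu.2.1, one_pow, mul_one, ← hwg.dirichlet_eq, energy_zero] at this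
  have hE' : hartree N v u = ‖u.snd‖ ^ 2 + c * Du := hartree_eq hv N u
  -- From `l1 + c Du ≤ hartree N v u ≤ l1 + c Dw` follows `c Du ≤ c Dw`, so the Hartree energy plus
  -- `c Du` is at most `l1 + 2c Dw = l1 + (N-1) Dw`. The gap hypothesis and the supremum bound on
  -- `w` give `N Dw < l2 - l1`.
  have hstrict : hartree N v u < l2 - c * Du := by
    have h1 : N * Dw < l2 - l1 := by
      refine lt_of_le_of_lt ?_ hgap
      calc N * Dw ≤ N * (C1 d ^ 2 * l1 ^ ((d : ℝ) / 2) * ∫ x, |v x|) := by gcongr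
        _ = _ := by ring
    have h2 : (N : ℝ) = 2 * c + 1 := by rw [hc]; ring
    rw [h2] at h1
    nlinarith
  -- The convolution part of the mean-field potential is nonnegative, so only the subtracted
  -- constant is lost.
  have hlow : ∀ g : OneBody d, energy 0 g - c * Du * ‖g.fst‖ ^ 2 ≤ energy W g := fun g => by
    rw [energy_zero, hWdef, energy_meanField hv, ← hDu, ← hc]
    have := mul_nonneg (by linarith : (0 : ℝ) ≤ N - 1)
      (hv.interact_nonneg (density_nonneg g) (density_nonneg u))
    linarith
  have horth : ∀ g ∈ H10 (dir d) U, inner ℂ w.fst g.fst = 0 →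
      (l2 - c * Du) * ‖g.fst‖ ^ 2 ≤ energy W g := fun g hg hwg' => by
    have h1 := hwg.dirichlet_le hUb hg hwg'
    have h2 := hlow g
    linarith
  have hWu : energy W u = hartree N v u := hu.energy_eq hv
  have huK := hu.isGround hv hKm (hUb.subset hsub)
  -- Split `g` along `K`. The part in `K` is handled by minimality there; the part outside is
  -- orthogonal to `w`, which lives in `K`, so its energy is above `l2 - c Du` and hence above the
  -- Hartree energy.
  have hground : IsGround (H10 (dir d) U) W u := by
    refine ⟨huU, hu.2.1, fun g hg => ?_⟩
    rw [energy_restrictL hW hKm g, norm_sq_restrictL_fst hKm g, mul_add]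
    refine add_le_add (huK.2.2 _ (restrictL_mem_H10 hopen.1 hopen.2 hg)) ?_
    refine le_trans ?_ (horth _ (restrictL_compl_mem_H10 hopen.1 hsub hopen.2 hg) ?_)
    · rw [hWu]
      gcongr
    · refine inner_eq_zero_of_disjoint (ae_eq_zero_of_mem_H10 hKm hwK) ?_
      filter_upwards [restrictL_fst_eq_zero hKm.compl g] with y hy hyK
      exact hy fun h => h hyK
  have he1 : meanFieldEigenvalue N v U u 1 = hartree N v u :=
    (hground.eigenvalue_one hW).trans hWu
  refine ⟨hground, he1, ?_⟩
  rw [he1]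
  -- In the max-min bound the constraint is orthogonality to the Dirichlet ground state `w`, not to
  -- `u`. The rest supplies two independent eigenfunctions, without which the second eigenvalue
  -- would be a default value.
  refine hstrict.trans_le (le_eigenvalue_two hW w.fst horth ?_)
  obtain ⟨f, hf, g, hg, hfg⟩ := exists_linearIndependent_of_pos (hl0.trans_lt hgap')
  obtain ⟨a, b, hab, hab'⟩ := exists_combination_orthogonal hfg u.fst
  obtain ⟨f₂, h1, h2⟩ := hground.exists_second hW isClosed_H10 (compact_H10 hUb)
    ⟨a • f + b • g, ⟨Submodule.add_mem _ (Submodule.smul_mem _ _ hf) (Submodule.smul_mem _ _ hg),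
      hab'⟩, hab⟩
  exact ⟨u, f₂, _, _, hground.isEigenpair hW, h2, linearIndependent_pair_of_orthogonal
    (ne_zero_of_norm_one hu.2.1) (ne_zero_of_norm_one h1.2.1) h1.1.2⟩

end Hartree

/-! ### Product functions -/

section Product

variable {N d : ℕ} {U : Set (Space d)}

/-- The product set `U^N`. -/
def power (N : ℕ) (U : Set (Space d)) : Set (Config N d) := {x | ∀ i, x i ∈ U}

theorem power_eq_pi (U : Set (Space d)) : power N U = univ.pi fun _ => U := by
  ext x; simp [power]

theorem isBounded_power (hU : Bornology.IsBounded U) : Bornology.IsBounded (power N U) := by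
  rw [power_eq_pi]
  exact Bornology.IsBounded.pi fun _ => hU

theorem span_configDir (N d : ℕ) : Submodule.span ℝ (range (configDir N d)) = ⊤ := by
  rw [eq_top_iff]
  rintro x -
  have h : x = ∑ i, ∑ a, x i a • configDir N d (i, a) := by
    ext j b
    simp only [configDir, dir, Finset.sum_apply, Pi.smul_apply, smul_eq_mul,
      WithLp.ofLp_sum, WithLp.ofLp_smul]
    rw [Finset.sum_eq_single j]
    · simp
    · intro i _ hij
      simp [Pi.single_eq_of_ne hij.symm]
    · simp
  rw [h]
  exact Submodule.sum_mem _ fun i _ => Submodule.sum_mem _ fun a _ =>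
    Submodule.smul_mem _ _ (Submodule.subset_span ⟨(i, a), rfl⟩)

theorem ae_all_eval {p : Space d → Prop} (h : ∀ᵐ x, p x) : ∀ᵐ x : Config N d, ∀ i, p (x i) := by
  rw [ae_all_iff]
  exact fun i => (Measure.quasiMeasurePreserving_eval (fun _ : Fin N => (volume : Measure (Space d))) i).ae h

theorem fderiv_prod_apply {φ : Space d → ℂ} (hφ : ContDiff ℝ ((⊤ : ℕ∞) : WithTop ℕ∞) φ)
    (x : Config N d) (i : Fin N) (a : Fin d) :
    fderiv ℝ (fun x : Config N d => ∏ j, φ (x j)) x (configDir N d (i, a)) =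
      (∏ j ∈ Finset.univ.erase i, φ (x j)) * fderiv ℝ φ (x i) (dir d a) := by
  have h : ∀ j ∈ Finset.univ, HasFDerivAt (fun x : Config N d => φ (x j))
      ((fderiv ℝ φ (x j)).comp (ContinuousLinearMap.proj j)) x := fun j _ =>
    ((hφ.differentiable (by simp)) (x j)).hasFDerivAt.comp x (hasFDerivAt_apply j x)
  rw [(HasFDerivAt.finsetProd h).fderiv]
  simp only [_root_.sum_apply, _root_.smul_apply, ContinuousLinearMap.comp_apply,
    ContinuousLinearMap.proj_apply, smul_eq_mul, configDir]
  rw [Finset.sum_eq_single i]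
  · simp
  · intro j _ hj
    simp [Pi.single_eq_of_ne hj]
  · simp

/-- Each summand is a product of functions of separate variables, ready for Fubini. -/
theorem norm_grad_prod_sq {φ : Space d → ℂ} (hφ : ContDiff ℝ ((⊤ : ℕ∞) : WithTop ℕ∞) φ)
    (x : Config N d) :
    ‖grad (configDir N d) (fun x : Config N d => ∏ j, φ (x j)) x‖ ^ 2 =
      ∑ i, ∏ j, if j = i then ‖grad (dir d) φ (x j)‖ ^ 2 else ‖φ (x j)‖ ^ 2 := by
  rw [norm_grad_sq, Fintype.sum_prod_type]
  refine Finset.sum_congr rfl fun i _ => ?_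
  simp only [fderiv_prod_apply hφ, norm_mul, mul_pow, norm_prod]
  rw [← Finset.mul_sum, ← norm_grad_sq, ← Finset.mul_prod_erase _ _ (Finset.mem_univ i), if_pos rfl,
    mul_comm, ← Finset.prod_pow]
  congr 1
  exact Finset.prod_congr rfl fun j hj => by rw [if_neg (Finset.ne_of_mem_erase hj)]

/-- A test function defines a product test function. -/
theorem exists_testPair_prod {p : OneBody d} (hp : p ∈ testPairs (dir d) U) :
    ∃ P ∈ testPairs (configDir N d) (power N U),
      P.fst =ᵐ[volume] (fun x => ∏ i, p.fst (x i)) ∧ ‖P.fst‖ ^ 2 = (‖p.fst‖ ^ 2) ^ N ∧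
      ‖P.snd‖ ^ 2 = N * (‖p.snd‖ ^ 2 * (‖p.fst‖ ^ 2) ^ (N - 1)) := by
  obtain ⟨φ, hφ, hφs, hφU, hp1, hp2⟩ := hp
  set Φ : Config N d → ℂ := fun x => ∏ j, φ (x j) with hΦ
  have hcomp : IsCompact (power N (tsupport φ)) := by
    rw [power_eq_pi]; exact isCompact_univ_pi fun _ => hφs
  have hzero : ∀ x, x ∉ power N (tsupport φ) → Φ x = 0 := fun x hx => by
    simp only [power, mem_ofPred_eq, not_forall] at hx
    obtain ⟨i, hi⟩ := hx
    exact Finset.prod_eq_zero (Finset.mem_univ i) (image_eq_zero_of_notMem_tsupport hi)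
  have hΦd : ContDiff ℝ ((⊤ : ℕ∞) : WithTop ℕ∞) Φ :=
    contDiff_prod fun j _ => hφ.comp (contDiff_apply ℝ (Space d) j)
  have hΦt : tsupport Φ ⊆ power N (tsupport φ) :=
    closure_minimal (fun x hx => by_contra fun h => hx (hzero x h)) hcomp.isClosed
  obtain ⟨P, hP, hP1, hP2⟩ := exists_testPair (e := configDir N d) hΦd
    (HasCompactSupport.intro hcomp hzero) (hΦt.trans fun x hx i => hφU (hx i))
  refine ⟨P, hP, ?_, ?_, ?_⟩
  · filter_upwards [hP1, ae_all_eval (N := N) hp1] with x h1 h2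
    rw [h1]
    exact Finset.prod_congr rfl fun i _ => (h2 i).symm
  · have e : ‖p.fst‖ ^ 2 = ∫ x, ‖φ x‖ ^ 2 := by
      rw [norm_sq_eq_integral]
      refine integral_congr_ae ?_
      filter_upwards [hp1] with x hx
      rw [hx]
    rw [norm_sq_eq_integral, e]
    have := integral_fintype_prod_volume_eq_pow (ι := Fin N) (fun x : Space d => ‖φ x‖ ^ 2)
    rw [Fintype.card_fin] at this
    rw [← this]
    refine integral_congr_ae ?_
    filter_upwards [hP1] with x hx
    rw [hx, hΦ, norm_prod, Finset.prod_pow]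
  · have e1 : ‖p.fst‖ ^ 2 = ∫ x, ‖φ x‖ ^ 2 := by
      rw [norm_sq_eq_integral]
      refine integral_congr_ae ?_
      filter_upwards [hp1] with x hx
      rw [hx]
    have e2 : ‖p.snd‖ ^ 2 = ∫ x, ‖grad (dir d) φ x‖ ^ 2 := by
      rw [norm_sq_eq_integral]
      refine integral_congr_ae ?_
      filter_upwards [hp2] with x hx
      rw [hx]
    have i1 : Integrable (fun x => ‖φ x‖ ^ 2) volume :=
      (integrable_norm_sq p.fst).congr (by filter_upwards [hp1] with x hx; rw [hx])
    have i2 : Integrable (fun x => ‖grad (dir d) φ x‖ ^ 2) volume :=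
      (integrable_norm_sq p.snd).congr (by filter_upwards [hp2] with x hx; rw [hx])
    have hF : ∀ i j : Fin N, (fun y : Space d =>
        if j = i then ‖grad (dir d) φ y‖ ^ 2 else ‖φ y‖ ^ 2) =
        if j = i then (fun y => ‖grad (dir d) φ y‖ ^ 2) else fun y => ‖φ y‖ ^ 2 := fun i j => by
      split_ifs <;> rfl
    have hint : ∀ i : Fin N, Integrable (fun x : Config N d => ∏ j,
        if j = i then ‖grad (dir d) φ (x j)‖ ^ 2 else ‖φ (x j)‖ ^ 2) volume := fun i => by
      refine Integrable.fintype_prod (f := fun j y =>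
        if j = i then ‖grad (dir d) φ y‖ ^ 2 else ‖φ y‖ ^ 2) fun j => ?_
      rw [hF]
      split_ifs
      exacts [i2, i1]
    have h1 : ‖P.snd‖ ^ 2 = ∫ x : Config N d, ∑ i, ∏ j,
        if j = i then ‖grad (dir d) φ (x j)‖ ^ 2 else ‖φ (x j)‖ ^ 2 := by
      rw [norm_sq_eq_integral]
      refine integral_congr_ae ?_
      filter_upwards [hP2] with x hx
      rw [hx, norm_grad_prod_sq hφ]
    rw [h1, integral_finsetSum _ fun i _ => hint i]
    have h2 : ∀ i : Fin N, (∫ x : Config N d, ∏ j,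
        if j = i then ‖grad (dir d) φ (x j)‖ ^ 2 else ‖φ (x j)‖ ^ 2) =
        ‖p.snd‖ ^ 2 * (‖p.fst‖ ^ 2) ^ (N - 1) := fun i => by
      rw [integral_fintype_prod_volume_eq_prod (fun (j : Fin N) (y : Space d) =>
        if j = i then ‖grad (dir d) φ y‖ ^ 2 else ‖φ y‖ ^ 2),
        ← Finset.mul_prod_erase _ _ (Finset.mem_univ i)]
      simp only [if_true]
      rw [e1, e2]
      congr 1
      rw [Finset.prod_congr rfl (g := fun _ => ∫ x, ‖φ x‖ ^ 2) fun j hj => by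
        simp only [if_neg (Finset.ne_of_mem_erase hj)]]
      simp
    simp only [h2, Finset.sum_const, Finset.card_univ, Fintype.card_fin, nsmul_eq_mul]

/-- The product state `u^{⊗N}`. -/
theorem exists_mem_H10_prod (hUb : Bornology.IsBounded U) {u : OneBody d}
    (hu : u ∈ H10 (dir d) U) (hu1 : ‖u.fst‖ = 1) :
    ∃ Ψ ∈ H10 (configDir N d) (power N U), Ψ.fst =ᵐ[volume] (fun x => ∏ i, u.fst (x i)) ∧
      ‖Ψ.snd‖ ^ 2 ≤ N * ‖u.snd‖ ^ 2 := by
  obtain ⟨p, hp, hpu⟩ := exists_seq_testPairs hu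
  choose P hP hPp hP1 hP2 using fun n => exists_testPair_prod (N := N) (hp n)
  have l1 : Tendsto (fun n => (p n).fst) atTop (𝓝 u.fst) := (continuous_fst.tendsto u).comp hpu
  have l2 : Tendsto (fun n => (p n).snd) atTop (𝓝 u.snd) := (continuous_snd.tendsto u).comp hpu
  have lb : Tendsto (fun n => ‖(P n).snd‖ ^ 2) atTop (𝓝 (N * ‖u.snd‖ ^ 2)) := by
    simp only [hP2]
    have := ((l2.norm.pow 2).mul ((l1.norm.pow 2).pow (N - 1))).const_mul (N : ℝ)
    rwa [hu1, one_pow, one_pow, mul_one] at this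
  have lc : Tendsto (fun n => ‖(P n).fst‖ ^ 2) atTop (𝓝 1) := by
    simp only [hP1]
    have := (l1.norm.pow 2).pow N
    rwa [hu1, one_pow, one_pow] at this
  have hbd : ∃ C, ∀ n, ‖P n‖ ≤ C := by
    obtain ⟨C, hC⟩ := (lc.add lb).bddAbove_range
    refine ⟨√C, fun n => Real.le_sqrt_of_sq_le ?_⟩
    have := hC (mem_range_self n)
    rwa [← WithLp.prod_norm_sq_eq_of_L2] at this
  obtain ⟨C, hC⟩ := hbd
  -- Differences of tensor powers are not estimated. Compactness supplies an `L²` limit, which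
  -- almost everywhere convergence along further subsequences identifies with the tensor power of
  -- `u`.
  obtain ⟨w, σ, hσ, hw⟩ := hasCompactEmbedding_H10 (span_configDir N d) (isBounded_power hUb) P
    (fun n => testPairs_le_H10 (hP n)) C hC
  obtain ⟨Ψ, hΨ, hΨw, hΨb⟩ := exists_mem_of_tendsto_fst isClosed_H10
    (fun n => testPairs_le_H10 (hP (σ n))) hw (fun n => le_rfl) (lb.comp hσ.tendsto_atTop)
  refine ⟨Ψ, hΨ, ?_, hΨb⟩
  rw [hΨw]
  obtain ⟨τ, hτ, hτu⟩ := (tendstoInMeasure_of_tendsto_Lp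
    (l1.comp hσ.tendsto_atTop)).exists_seq_tendsto_ae
  obtain ⟨θ, hθ, hθw⟩ := (tendstoInMeasure_of_tendsto_Lp
    (hw.comp hτ.tendsto_atTop)).exists_seq_tendsto_ae
  filter_upwards [hθw, ae_all_eval (N := N) hτu, ae_all_iff.2 hPp] with x h1 h2 h3
  refine tendsto_nhds_unique h1 ?_
  simp only [Function.comp_apply, h3]
  exact tendsto_finsetProd _ fun i _ => (h2 i).comp hθ.tendsto_atTop

end Product

/-! ### Bosonic wave functions and the trial state -/

section PairMarginal

variable {N : ℕ} {Y : Type*} [MeasureSpace Y] [SigmaFinite (volume : Measure Y)]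

/-- The measure with density `ρ`. -/
def densityMeasure (ρ : Y → ℝ) : Measure Y := volume.withDensity fun x => ENNReal.ofReal (ρ x)

theorem isProbabilityMeasure_densityMeasure {ρ : Y → ℝ} (hi : Integrable ρ volume)
    (h0 : ∀ x, 0 ≤ ρ x) (h1 : ∫ x, ρ x = 1) : IsProbabilityMeasure (densityMeasure ρ) :=
  ⟨by rw [densityMeasure, withDensity_apply _ MeasurableSet.univ, setLIntegral_univ,
    ← ofReal_integral_eq_lintegral_ofReal hi (Eventually.of_forall h0), h1, ENNReal.ofReal_one]⟩

theorem integral_densityMeasure {ρ : Y → ℝ} (hm : Measurable ρ) (h0 : ∀ x, 0 ≤ ρ x) (G : Y → ℝ) :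
    ∫ x, G x ∂(densityMeasure ρ) = ∫ x, ρ x * G x := by
  rw [densityMeasure, integral_withDensity_eq_integral_toReal_smul hm.ennreal_ofReal
    (Eventually.of_forall fun _ => ENNReal.ofReal_lt_top)]
  refine integral_congr_ae (Eventually.of_forall fun x => ?_)
  simp only [ENNReal.toReal_ofReal (h0 x), smul_eq_mul]

/-- A product density is the density of a product measure, under which the coordinates are
independent; marginals then come from probability theory. -/
theorem pi_densityMeasure {ρ : Y → ℝ} (hi : Integrable ρ volume)
    (h0 : ∀ x, 0 ≤ ρ x) (h1 : ∫ x, ρ x = 1) :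
    Measure.pi (fun _ : Fin N => densityMeasure ρ) = densityMeasure fun x : Fin N → Y => ∏ i, ρ (x i) := by
  have := isProbabilityMeasure_densityMeasure hi h0 h1
  refine Measure.pi_eq fun s hs => ?_
  have hsm : MeasurableSet (univ.pi s) := MeasurableSet.univ_pi hs
  have hint : ∀ i, Integrable ((s i).indicator ρ) volume := fun i => hi.indicator (hs i)
  have hprod : Integrable (fun x : Fin N → Y => ∏ i, ρ (x i)) (volume : Measure (Fin N → Y)) :=
    Integrable.fintype_prod fun _ => hi
  rw [densityMeasure, withDensity_apply _ hsm, ← ofReal_integral_eq_lintegral_ofReal hprod.integrableOn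
      (Eventually.of_forall fun x => Finset.prod_nonneg fun i _ => h0 _), ← integral_indicator hsm]
  have e : (univ.pi s).indicator (fun x : Fin N → Y => ∏ i, ρ (x i)) =
      fun x => ∏ i, (s i).indicator ρ (x i) := by
    ext x
    by_cases hx : x ∈ univ.pi s
    · rw [indicator_of_mem hx]
      exact Finset.prod_congr rfl fun i _ => (indicator_of_mem (hx i (mem_univ i)) _).symm
    · rw [indicator_of_notMem hx]
      simp only [Set.mem_pi, mem_univ, true_implies, not_forall] at hx
      obtain ⟨i, hi⟩ := hx
      exact (Finset.prod_eq_zero (Finset.mem_univ i) (indicator_of_notMem hi _)).symm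
  rw [e, integral_fintype_prod_volume_eq_prod fun i y => (s i).indicator ρ y,
    ENNReal.ofReal_prod_of_nonneg fun i _ => integral_nonneg fun y => indicator_nonneg (fun x _ => h0 x) y]
  refine Finset.prod_congr rfl fun i _ => ?_
  rw [densityMeasure, withDensity_apply _ (hs i), integral_indicator (hs i),
    ofReal_integral_eq_lintegral_ofReal hi.integrableOn (Eventually.of_forall h0)]

/-- The two-particle marginal of a product density. -/
theorem integral_pair_mul_prod {ρ : Y → ℝ} (hm : Measurable ρ) (hi : Integrable ρ volume)
    (h0 : ∀ x, 0 ≤ ρ x) (h1 : ∫ x, ρ x = 1) {i j : Fin N} (hij : i ≠ j) {G : Y × Y → ℝ}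
    (hG : Measurable G) {C : ℝ} (hC : ∀ p, |G p| ≤ C) :
    ∫ x : Fin N → Y, (∏ k, ρ (x k)) * G (x i, x j) = ∫ x, ρ x * ∫ y, ρ y * G (x, y) := by
  have hp := isProbabilityMeasure_densityMeasure hi h0 h1
  -- Independence makes the joint law of coordinates `i` and `j` a product measure, so the other `N
  -- - 2` variables integrate out.
  have hind : iIndepFun (fun (i : Fin N) (x : Fin N → Y) => x i)
      (Measure.pi fun _ : Fin N => densityMeasure ρ) :=
    iIndepFun_pi (X := fun _ y => y) fun _ => aemeasurable_id
  have hmap := (indepFun_iff_map_prod_eq_prod_map_map (measurable_pi_apply i).aemeasurable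
    (measurable_pi_apply j).aemeasurable).1 (hind.indepFun hij)
  have hev : ∀ i : Fin N, (Measure.pi fun _ : Fin N => densityMeasure ρ).map (fun x => x i) =
      densityMeasure ρ := fun i => (measurePreserving_eval (fun _ : Fin N => densityMeasure ρ) i).map_eq
  rw [hev, hev] at hmap
  rw [← integral_densityMeasure (Y := Fin N → Y) (by fun_prop)
    (fun x => Finset.prod_nonneg fun i _ => h0 _), ← pi_densityMeasure hi h0 h1]
  have h2 := integral_map (μ := Measure.pi fun _ : Fin N => densityMeasure ρ)
    (φ := fun x => (x i, x j)) (by fun_prop) (f := G) hG.aestronglyMeasurable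
  rw [← h2, hmap, integral_prod _ (by
    refine (integrable_const C).mono' hG.aestronglyMeasurable (Eventually.of_forall hC)),
    integral_densityMeasure hm h0]
  simp only [integral_densityMeasure hm h0]

end PairMarginal

/-! ### The symmetric subspace and the product trial state -/

section Bosonic

variable {N d : ℕ} {U : Set (Space d)} {v : Space d → ℝ}

theorem measurePreserving_permute (N d : ℕ) (σ : Equiv.Perm (Fin N)) :
    MeasurePreserving (fun (x : Config N d) i => x (σ i)) volume volume :=
  volume_preserving_arrowCongr' σ.symm (MeasurableEquiv.refl (Space d)) (MeasurePreserving.id _)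

/-- Permutation of the particles. -/
def permute (N d : ℕ) (σ : Equiv.Perm (Fin N)) :
    Lp ℂ 2 (volume : Measure (Config N d)) →ₗᵢ[ℂ] Lp ℂ 2 (volume : Measure (Config N d)) :=
  Lp.compMeasurePreservingₗᵢ ℂ _ (measurePreserving_permute N d σ)

/-- Symmetry becomes a fixed-point equation for linear isometries, from which it is clear that it
defines a closed subspace. -/
theorem permute_eq_iff (σ : Equiv.Perm (Fin N)) (f : Lp ℂ 2 (volume : Measure (Config N d))) :
    permute N d σ f = f ↔ (fun x : Config N d => f fun i => x (σ i)) =ᵐ[volume] f := by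
  have h : permute N d σ f =ᵐ[volume] fun x : Config N d => f fun i => x (σ i) :=
    Lp.coeFn_compMeasurePreserving f (measurePreserving_permute N d σ)
  exact ⟨fun e => h.symm.trans (by rw [e]), fun e => Lp.ext (h.trans e)⟩

/-- The bosonic form domain as a subspace. -/
def bosonic (N : ℕ) (U : Set (Space d)) : Submodule ℂ (ManyBody N d) where
  carrier := bosonicDomain N U
  zero_mem' := ⟨Submodule.zero_mem _, fun σ => (permute_eq_iff σ _).1 (map_zero _)⟩
  add_mem' := fun {f g} hf hg => ⟨Submodule.add_mem _ hf.1 hg.1, fun σ => (permute_eq_iff σ _).1 (by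
    rw [WithLp.add_fst, map_add, (permute_eq_iff σ _).2 (hf.2 σ), (permute_eq_iff σ _).2 (hg.2 σ)])⟩
  smul_mem' := fun c f hf => ⟨Submodule.smul_mem _ _ hf.1, fun σ => (permute_eq_iff σ _).1 (by
    rw [WithLp.smul_fst, map_smul, (permute_eq_iff σ _).2 (hf.2 σ)])⟩

theorem bosonic_le : bosonic N U ≤ H10 (configDir N d) (power N U) := fun _ hf => hf.1

theorem isClosed_bosonic : IsClosed (bosonic N U : Set (ManyBody N d)) := by
  have h : (bosonic N U : Set (ManyBody N d)) = (H10 (configDir N d) (power N U) : Set _) ∩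
      ⋂ σ, {f | permute N d σ f.fst = f.fst} := by
    ext f
    simp only [mem_inter_iff, mem_iInter, mem_ofPred_eq, permute_eq_iff]
    rfl
  rw [h]
  exact isClosed_H10.inter (isClosed_iInter fun σ =>
    isClosed_eq ((permute N d σ).continuous.comp continuous_fst) continuous_fst)

theorem compact_bosonic (hUb : Bornology.IsBounded U) :
    HasCompactEmbedding (bosonic N U : Submodule ℂ (ManyBody N d)) :=
  (hasCompactEmbedding_H10 (span_configDir N d) (isBounded_power hUb)).mono bosonic_le

theorem sum_fin_cast (N : ℕ) : (∑ i : Fin N, ((i : ℕ) : ℝ)) = N * ((N : ℝ) - 1) / 2 := by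
  induction N with
  | zero => simp
  | succ n ih =>
    rw [Fin.sum_univ_castSucc]
    simp only [Fin.val_castSucc, Fin.val_last]
    rw [ih]
    push_cast
    ring

/-- The interaction energy of a product state. -/
theorem IsAdmissibleInteraction.integral_pairPotential_prod (hv : IsAdmissibleInteraction v)
    {u : OneBody d} (hu1 : ‖u.fst‖ = 1) :
    ∫ x : Config N d, pairPotential v x * ∏ i, density u (x i) =
      N * (((N : ℝ) - 1) / 2 * interact v (density u) (density u)) := by
  have hm : Measurable (density u) := (Lp.stronglyMeasurable u.fst).norm.measurable.pow_const 2
  have hi := integrable_density u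
  have h1 : ∫ x, density u x = 1 := by rw [integral_density, hu1, one_pow]
  have hprod : Integrable (fun x : Config N d => ∏ i, density u (x i)) volume :=
    Integrable.fintype_prod fun _ => hi
  have hpair : ∀ i j : Fin N, i ≠ j →
      ∫ x : Config N d, (∏ k, density u (x k)) * rep v (x i - x j) =
        interact v (density u) (density u) := fun i j hij =>
    integral_pair_mul_prod hm hi (density_nonneg u) h1 hij (G := fun p => rep v (p.1 - p.2))
      (hv.continuous_rep.measurable.comp (by fun_prop)) fun p => hv.abs_rep_le _
  have hint : ∀ i j : Fin N,
      Integrable (fun x : Config N d => (∏ k, density u (x k)) * rep v (x i - x j)) volume :=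
    fun i j => hprod.mul_bdd (c := valueAtZero v)
      (hv.continuous_rep.comp (by fun_prop)).aestronglyMeasurable
      (Eventually.of_forall fun x => hv.abs_rep_le _)
  have h2 : ∫ x : Config N d, pairPotential v x * ∏ i, density u (x i) =
      ∫ x : Config N d, ∑ i : Fin N, ∑ j ∈ Finset.Ioi i,
        (∏ k, density u (x k)) * rep v (x i - x j) := by
    refine integral_congr_ae ?_
    filter_upwards [hv.ae_pairPotential_eq N] with x hx
    rw [hx, mul_comm, pairPotential, Finset.mul_sum]
    exact Finset.sum_congr rfl fun i _ => Finset.mul_sum _ _ _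
  rw [h2, integral_finsetSum _ fun i _ => integrable_finsetSum _ fun j _ => hint i j]
  -- Exactly `N - 1 - i` indices lie above `i`, and every pair contributes the same mutual energy.
  have h3 : ∀ i : Fin N, (∫ x : Config N d, ∑ j ∈ Finset.Ioi i,
      (∏ k, density u (x k)) * rep v (x i - x j)) =
      ((N : ℝ) - 1 - (i : ℕ)) * interact v (density u) (density u) := fun i => by
    rw [integral_finsetSum _ fun j _ => hint i j,
      Finset.sum_congr rfl fun j hj => hpair i j (Finset.mem_Ioi.1 hj).ne, Finset.sum_const,
      Fin.card_Ioi, nsmul_eq_mul]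
    congr 1
    have := i.2
    rw [Nat.cast_sub (by omega), Nat.cast_sub (by omega)]
    push_cast
    ring
  rw [Finset.sum_congr rfl fun i _ => h3 i, ← Finset.sum_mul, Finset.sum_sub_distrib]
  rw [sum_fin_cast]
  simp only [Finset.sum_const, Finset.card_univ, Fintype.card_fin, nsmul_eq_mul]
  ring

/-- The product state of a Hartree minimizer is a trial state. -/
theorem exists_trial (hv : IsAdmissibleInteraction v) (hUb : Bornology.IsBounded U) {u : OneBody d}
    (hu : u ∈ H10 (dir d) U) (hu1 : ‖u.fst‖ = 1) :
    ∃ Ψ ∈ (bosonic N U : Submodule ℂ (ManyBody N d)), ‖Ψ.fst‖ = 1 ∧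
      energy (pairPotential v) Ψ ≤ N * hartree N v u := by
  obtain ⟨Ψ, hΨ, hΨu, hΨe⟩ := exists_mem_H10_prod (N := N) hUb hu hu1
  have hden : ∀ᵐ x : Config N d, ‖Ψ.fst x‖ ^ 2 = ∏ i, density u (x i) := by
    filter_upwards [hΨu] with x hx
    rw [hx, norm_prod, ← Finset.prod_pow]
    rfl
  refine ⟨Ψ, ⟨hΨ, fun σ => ?_⟩, ?_, ?_⟩
  · have h1 := (measurePreserving_permute N d σ).quasiMeasurePreserving.ae hΨu
    filter_upwards [h1, hΨu] with x h1 h2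
    rw [h1, h2]
    exact Equiv.prod_comp σ fun i => u.fst (x i)
  · rw [← sq_eq_sq₀ (norm_nonneg _) zero_le_one, norm_sq_eq_integral, integral_congr_ae hden,
      integral_fintype_prod_volume_eq_pow (ι := Fin N) (density u), integral_density, hu1]
    simp
  · rw [energy, hartree_eq hv, mul_add, ← hv.integral_pairPotential_prod hu1]
    refine add_le_add hΨe (le_of_eq (integral_congr_ae ?_))
    filter_upwards [hden] with x hx
    rw [hx]

/-- Ground states exist, and the ground state energy is the minimum of the energy. -/
theorem exists_isGround_bosonic (hv : IsAdmissibleInteraction v) (hUb : Bornology.IsBounded U)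
    {u : OneBody d} (hu : u ∈ H10 (dir d) U) (hu1 : ‖u.fst‖ = 1) :
    ∃ Ψ : ManyBody N d, IsGround (bosonic N U) (pairPotential v) Ψ := by
  obtain ⟨Φ, hΦ, hΦ1, -⟩ := exists_trial (N := N) hv hUb hu hu1
  exact exists_isGround (hv.memLp_pairPotential N) isClosed_bosonic (compact_bosonic hUb)
    ⟨Φ, hΦ, ne_zero_of_norm_one hΦ1⟩

theorem IsGround.groundStateEnergy_eq (hv : IsAdmissibleInteraction v) {Ψ : ManyBody N d}
    (hΨ : IsGround (bosonic N U) (pairPotential v) Ψ) :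
    groundStateEnergy N v U = energy (pairPotential v) Ψ := by
  have hre : ∀ f : ManyBody N d, (schrodingerForm (pairPotential v) f f).re =
      energy (pairPotential v) f := fun f => by
    rw [schrodingerForm_self (hv.memLp_pairPotential N), Complex.ofReal_re]
  refine IsLeast.csInf_eq ⟨⟨Ψ, hΨ.1, hΨ.2.1, (hre Ψ).symm⟩, ?_⟩
  rintro t ⟨f, hf, hf1, rfl⟩
  rw [hre]
  have := hΨ.2.2 f hf
  rwa [hf1, one_pow, mul_one] at this

theorem groundStateEnergy_le (hv : IsAdmissibleInteraction v) (hUb : Bornology.IsBounded U)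
    {u : OneBody d} (hu : u ∈ H10 (dir d) U) (hu1 : ‖u.fst‖ = 1) :
    groundStateEnergy N v U ≤ N * hartree N v u := by
  obtain ⟨Ψ, hΨ⟩ := exists_isGround_bosonic (N := N) hv hUb hu hu1
  obtain ⟨Φ, hΦ, hΦ1, hΦe⟩ := exists_trial (N := N) hv hUb hu hu1
  have := hΨ.2.2 Φ hΦ
  rw [hΦ1, one_pow, mul_one] at this
  rw [hΨ.groundStateEnergy_eq hv]
  exact this.trans hΦe

end Bosonic

/-! ### Slices and the occupation of the condensate -/

section Slice

variable {N d : ℕ} {U : Set (Space d)}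

/-- Positions of all particles but the first. -/
abbrev Rest (N d : ℕ) := {j : Fin N // (j : ℕ) ≠ 0} → Space d

/-- The indices split into `0` and the rest; the first block has a single index, so functions on it
are points of the one-particle space. All identifications involved preserve the product measure. -/
theorem measurePreserving_insertFirst (hN : 0 < N) :
    MeasurePreserving (fun p : Space d × Rest N d => insertFirst p.1 p.2)
      (volume : Measure (Space d × Rest N d)) (volume : Measure (Config N d)) := by
  have hu : Unique {j : Fin N // ¬ (j : ℕ) ≠ 0} :=
    ⟨⟨⟨⟨0, hN⟩, by simp⟩⟩, fun j => by
      obtain ⟨j, hj⟩ := j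
      simp only [ne_eq, not_not] at hj
      exact Subtype.ext (Fin.ext hj)⟩
  have h1 := (volume_preserving_piEquivPiSubtypeProd (fun _ : Fin N => Space d)
    (fun j => (j : ℕ) ≠ 0)).symm
  have h2 : MeasurePreserving (MeasurableEquiv.funUnique {j : Fin N // ¬ (j : ℕ) ≠ 0}
      (Space d)).symm volume volume := by
    convert (volume_preserving_funUnique {j : Fin N // ¬ (j : ℕ) ≠ 0} (Space d)).symm
  have h3 : MeasurePreserving (Prod.map (MeasurableEquiv.funUnique {j : Fin N // ¬ (j : ℕ) ≠ 0}
      (Space d)).symm (id : Rest N d → Rest N d)) volume volume := h2.prod (MeasurePreserving.id volume)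
  have h4 : MeasurePreserving (Prod.swap : ({j : Fin N // ¬ (j : ℕ) ≠ 0} → Space d) × Rest N d → _)
      volume volume := Measure.measurePreserving_swap
  exact h1.comp (h4.comp h3)

theorem continuous_insertFirst :
    Continuous fun p : Space d × Rest N d => (insertFirst p.1 p.2 : Config N d) := by
  refine continuous_pi fun j => ?_
  unfold insertFirst
  by_cases h : (j : ℕ) ≠ 0
  · simp only [h, not_false_eq_true, ne_eq, dite_true]; fun_prop
  · simp only [h, dite_false]; fun_prop

theorem integrable_insertFirst (hN : 0 < N) {E : Type*} [NormedAddCommGroup E] {F : Config N d → E}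
    (hF : Integrable F volume) :
    Integrable (fun p : Space d × Rest N d => F (insertFirst p.1 p.2)) volume :=
  (measurePreserving_insertFirst hN).integrable_comp_of_integrable hF

theorem integral_insertFirst (hN : 0 < N) {E : Type*} [NormedAddCommGroup E] [NormedSpace ℝ E]
    {F : Config N d → E} (hF : Integrable F volume) :
    ∫ z : Rest N d, ∫ x, F (insertFirst x z) = ∫ y, F y := by
  have hmp := measurePreserving_insertFirst (d := d) hN
  have h1 : ∫ y, F y = ∫ p : Space d × Rest N d, F (insertFirst p.1 p.2) := by
    rw [← hmp.map_eq, integral_map hmp.measurable.aemeasurable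
      (by rw [hmp.map_eq]; exact hF.aestronglyMeasurable)]
  rw [h1]
  exact (integral_prod_symm _ (integrable_insertFirst hN hF)).symm

theorem integrable_integral_insertFirst (hN : 0 < N) {E : Type*} [NormedAddCommGroup E]
    [NormedSpace ℝ E] {F : Config N d → E} (hF : Integrable F volume) :
    Integrable (fun z : Rest N d => ∫ x, F (insertFirst x z)) volume :=
  (integrable_insertFirst hN hF).integral_prod_right

/-- The function `⟨u, F(·, z)⟩` of the remaining particles. -/
def sliceInner (u : OneBody d) (F : Config N d → ℂ) (z : Rest N d) : ℂ :=
  ∫ x, conj (u.fst x) * F (insertFirst x z)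

/-- The weight of `F` on the one-particle state `u`. -/
def sliceWeight (u : OneBody d) (F : Config N d → ℂ) : ℝ := ∫ z, ‖sliceInner u F z‖ ^ 2

theorem inner_toLp_eq {X : Type*} [MeasureSpace X] (u : Lp ℂ 2 (volume : Measure X)) {f : X → ℂ}
    (hf : MemLp f 2 volume) : inner ℂ u (hf.toLp f) = ∫ x, conj (u x) * f x := by
  rw [L2.inner_def]
  refine integral_congr_ae ?_
  filter_upwards [hf.coeFn_toLp] with x hx
  rw [hx, RCLike.inner_apply, mul_comm]

theorem norm_sq_toLp {X : Type*} [MeasureSpace X] {f : X → ℂ} (hf : MemLp f 2 volume) :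
    ‖hf.toLp f‖ ^ 2 = ∫ x, ‖f x‖ ^ 2 := by
  rw [norm_sq_eq_integral]
  refine integral_congr_ae ?_
  filter_upwards [hf.coeFn_toLp] with x hx
  rw [hx]

theorem norm_sq_integral_conj_mul_le {X : Type*} [MeasureSpace X] {u : Lp ℂ 2 (volume : Measure X)}
    (hu : ‖u‖ = 1) {f : X → ℂ} (hf : MemLp f 2 volume) :
    ‖∫ x, conj (u x) * f x‖ ^ 2 ≤ ∫ x, ‖f x‖ ^ 2 := by
  rw [← inner_toLp_eq u hf, ← norm_sq_toLp hf]
  have := norm_inner_le_norm (𝕜 := ℂ) u (hf.toLp f)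
  rw [hu, one_mul] at this
  gcongr

theorem stronglyMeasurable_integrand (u : OneBody d) {F : Config N d → ℂ}
    (hF : StronglyMeasurable F) : StronglyMeasurable fun p : Space d × Rest N d =>
      conj (u.fst p.1) * F (insertFirst p.1 p.2) :=
  (Complex.continuous_conj.comp_stronglyMeasurable
    ((Lp.stronglyMeasurable u.fst).comp_measurable measurable_fst)).mul
    (hF.comp_measurable continuous_insertFirst.measurable)

theorem stronglyMeasurable_sliceInner (u : OneBody d) {F : Config N d → ℂ}
    (hF : StronglyMeasurable F) : StronglyMeasurable (sliceInner u F) :=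
  (stronglyMeasurable_integrand u hF).integral_prod_left'

theorem ae_memLp_slice (hN : 0 < N) {F : Config N d → ℂ} (hF : StronglyMeasurable F)
    (hF2 : MemLp F 2 volume) : ∀ᵐ z : Rest N d, MemLp (fun x => F (insertFirst x z)) 2 volume := by
  have h := integrable_insertFirst hN ((memLp_two_iff_integrable_sq_norm
    hF.aestronglyMeasurable).1 hF2)
  filter_upwards [h.prod_left_ae] with z hz
  refine (memLp_two_iff_integrable_sq_norm ?_).2 hz
  exact (hF.comp_measurable (continuous_insertFirst.measurable.comp
    measurable_prodMk_right)).aestronglyMeasurable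

theorem ae_norm_sq_sliceInner_le (hN : 0 < N) {u : OneBody d} (hu : ‖u.fst‖ = 1)
    {F : Config N d → ℂ} (hF : StronglyMeasurable F) (hF2 : MemLp F 2 volume) :
    ∀ᵐ z : Rest N d, ‖sliceInner u F z‖ ^ 2 ≤ ∫ x, ‖F (insertFirst x z)‖ ^ 2 := by
  filter_upwards [ae_memLp_slice hN hF hF2] with z hz
  exact norm_sq_integral_conj_mul_le hu hz

theorem integrable_sliceInner (hN : 0 < N) {u : OneBody d} (hu : ‖u.fst‖ = 1)
    {F : Config N d → ℂ} (hF : StronglyMeasurable F) (hF2 : MemLp F 2 volume) :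
    Integrable (fun z => ‖sliceInner u F z‖ ^ 2) volume := by
  refine (integrable_integral_insertFirst hN ((memLp_two_iff_integrable_sq_norm
    hF.aestronglyMeasurable).1 hF2)).mono'
    ((stronglyMeasurable_sliceInner u hF).norm.pow 2).aestronglyMeasurable ?_
  filter_upwards [ae_norm_sq_sliceInner_le hN hu hF hF2] with z hz
  rwa [Real.norm_of_nonneg (sq_nonneg _)]

/-- Cauchy–Schwarz in the first variable for almost every position of the others, then integration
over these. -/
theorem sliceWeight_le (hN : 0 < N) {u : OneBody d} (hu : ‖u.fst‖ = 1)
    {F : Config N d → ℂ} (hF : StronglyMeasurable F) (hF2 : MemLp F 2 volume) :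
    sliceWeight u F ≤ ∫ y, ‖F y‖ ^ 2 := by
  have hi := (memLp_two_iff_integrable_sq_norm hF.aestronglyMeasurable).1 hF2
  rw [← integral_insertFirst hN hi]
  exact integral_mono_ae (integrable_sliceInner hN hu hF hF2) (integrable_integral_insertFirst hN hi)
    (ae_norm_sq_sliceInner_le hN hu hF hF2)

/-- Continuity of the weight with respect to the `L²` norm, in quantitative form. -/
theorem sliceWeight_le_add (hN : 0 < N) {u : OneBody d} (hu : ‖u.fst‖ = 1)
    {F G : Config N d → ℂ} (hF : StronglyMeasurable F) (hF2 : MemLp F 2 volume)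
    (hG : StronglyMeasurable G) (hG2 : MemLp G 2 volume) {ε : ℝ} (hε : 0 < ε) :
    sliceWeight u F ≤ (1 + ε) * sliceWeight u G + (1 + 1 / ε) * ∫ y, ‖F y - G y‖ ^ 2 := by
  have hFG := hF.sub hG
  have hFG2 := hF2.sub hG2
  refine le_trans ?_ (add_le_add_right (mul_le_mul_of_nonneg_left (sliceWeight_le hN hu hFG hFG2)
    (by positivity : 0 ≤ 1 + 1 / ε)) _)
  rw [sliceWeight, sliceWeight, sliceWeight, ← integral_const_mul, ← integral_const_mul,
    ← integral_add ((integrable_sliceInner hN hu hG hG2).const_mul _)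
      ((integrable_sliceInner hN hu hFG hFG2).const_mul _)]
  refine integral_mono_ae (integrable_sliceInner hN hu hF hF2)
    (((integrable_sliceInner hN hu hG hG2).const_mul _).add
      ((integrable_sliceInner hN hu hFG hFG2).const_mul _)) ?_
  filter_upwards [ae_memLp_slice hN hG hG2, ae_memLp_slice hN hFG hFG2] with z h1 h2
  have hui : ∀ {f : Space d → ℂ}, MemLp f 2 volume → Integrable (fun x => conj (u.fst x) * f x) volume :=
    fun hf => (Lp.memLp u.fst).star.integrable_mul hf
  have e : sliceInner u F z = sliceInner u G z + sliceInner u (F - G) z := by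
    rw [sliceInner, sliceInner, sliceInner, ← integral_add (hui h1) (hui h2)]
    refine integral_congr_ae (Eventually.of_forall fun x => ?_)
    simp only [Pi.sub_apply]
    ring
  rw [e]
  have h3 := norm_add_le (sliceInner u G z) (sliceInner u (F - G) z)
  set a := ‖sliceInner u G z‖
  set b := ‖sliceInner u (F - G) z‖
  have h4 : ‖sliceInner u G z + sliceInner u (F - G) z‖ ^ 2 ≤ (a + b) ^ 2 := by gcongr
  refine h4.trans ?_
  -- Young's inequality with explicit remainder.
  have h5 : (1 + ε) * a ^ 2 + (1 + 1 / ε) * b ^ 2 - (a + b) ^ 2 = (ε * a - b) ^ 2 / ε := by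
    field_simp
    ring
  have h6 : 0 ≤ (ε * a - b) ^ 2 / ε := by positivity
  linarith

/-- The occupation number of `u` in terms of slices. -/
theorem occupation_eq (hN : 0 < N) (Ψ : ManyBody N d) (u : OneBody d) :
    occupation Ψ u = N * sliceWeight u Ψ.fst := by
  have hΨm := Lp.stronglyMeasurable Ψ.fst
  have hum := Lp.stronglyMeasurable u.fst
  -- Domination by `|u(x)|²|Ψ(y,z)|² + |u(y)|²|Ψ(x,z)|²` makes `f` integrable, so `z` can be
  -- integrated last. For fixed `z` the integrand is a product whose integral is the squared modulus
  -- of `sliceInner`.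
  set f : (Space d × Space d) × Rest N d → ℂ := fun q =>
    (conj (u.fst q.1.1) * Ψ.fst (insertFirst q.1.1 q.2)) *
      conj (conj (u.fst q.1.2) * Ψ.fst (insertFirst q.1.2 q.2)) with hf
  have hΨi := integrable_insertFirst hN (integrable_norm_sq Ψ.fst)
  have hui := integrable_norm_sq u.fst
  have hfm : StronglyMeasurable f := by
    have h := stronglyMeasurable_integrand u hΨm
    exact (h.comp_measurable (by fun_prop : Measurable fun q : (Space d × Space d) × Rest N d =>
      (q.1.1, q.2))).mul (Complex.continuous_conj.comp_stronglyMeasurable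
      (h.comp_measurable (by fun_prop : Measurable fun q : (Space d × Space d) × Rest N d =>
      (q.1.2, q.2))))
  have hg1 : Integrable (fun q : (Space d × Space d) × Rest N d =>
      ‖u.fst q.1.1‖ ^ 2 * ‖Ψ.fst (insertFirst q.1.2 q.2)‖ ^ 2) volume := by
    have h := hui.mul_prod hΨi
    have hmp : MeasurePreserving (MeasurableEquiv.prodAssoc :
        (Space d × Space d) × Rest N d ≃ᵐ Space d × Space d × Rest N d) volume volume :=
      volume_preserving_prodAssoc
    exact hmp.integrable_comp_of_integrable h
  have hg2 : Integrable (fun q : (Space d × Space d) × Rest N d =>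
      ‖u.fst q.1.2‖ ^ 2 * ‖Ψ.fst (insertFirst q.1.1 q.2)‖ ^ 2) volume := by
    have hsw : MeasurePreserving (Prod.map Prod.swap id :
        (Space d × Space d) × Rest N d → (Space d × Space d) × Rest N d) volume volume :=
      Measure.measurePreserving_swap.prod (MeasurePreserving.id _)
    exact hsw.integrable_comp_of_integrable hg1
  have hfi : Integrable f ((volume : Measure (Space d × Space d)).prod
      (volume : Measure (Rest N d))) := by
    refine (hg1.add hg2).mono' hfm.aestronglyMeasurable (Eventually.of_forall fun q => ?_)
    simp only [hf, norm_mul, RCLike.norm_conj, Pi.add_apply]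
    set a := ‖u.fst q.1.1‖
    set b := ‖u.fst q.1.2‖
    set c := ‖Ψ.fst (insertFirst q.1.1 q.2)‖
    set e := ‖Ψ.fst (insertFirst q.1.2 q.2)‖
    nlinarith [sq_nonneg (a * e - b * c), sq_nonneg (a * e), sq_nonneg (b * c)]
  have h1 : ∫ x, ∫ y, conj (u.fst x) * densityKernel Ψ x y * u.fst y =
      ∫ x, ∫ y, ∫ z : Rest N d, f ((x, y), z) := by
    refine integral_congr_ae (Eventually.of_forall fun x =>
      integral_congr_ae (Eventually.of_forall fun y => ?_))
    simp only [densityKernel]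
    rw [← integral_const_mul, ← integral_mul_const]
    refine integral_congr_ae (Eventually.of_forall fun z => ?_)
    simp only [hf, map_mul, Complex.conj_conj]
    ring
  have h2 : ∫ x, ∫ y, ∫ z : Rest N d, f ((x, y), z) = ∫ z : Rest N d, ∫ p, f (p, z) := by
    rw [← integral_prod (fun p : Space d × Space d => ∫ z : Rest N d, f (p, z))
      hfi.integral_prod_left]
    exact integral_integral_swap hfi
  have h3 : ∀ z : Rest N d, ∫ p, f (p, z) = ((‖sliceInner u Ψ.fst z‖ ^ 2 : ℝ) : ℂ) := fun z => by
    have := integral_prod_mul (μ := (volume : Measure (Space d))) (ν := (volume : Measure (Space d)))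
      (fun x => conj (u.fst x) * Ψ.fst (insertFirst x z))
      (fun y => conj (conj (u.fst y) * Ψ.fst (insertFirst y z)))
    refine this.trans ?_
    rw [integral_conj, ← sliceInner, Complex.mul_conj, Complex.normSq_eq_norm_sq]
  rw [occupation, h1, h2]
  simp only [h3]
  rw [integral_complex_ofReal, Complex.ofReal_re, sliceWeight]

end Slice

/-! ### The lower bound on the many-body energy -/

section OneBodyBound

variable {X : Type*} [NormedAddCommGroup X] [NormedSpace ℝ X] [MeasureSpace X]
  {κ : Type*} [Fintype κ] {W : X → ℝ} {S : Submodule ℂ (GradPair X κ)}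

/-- A spectral gap above the ground state `u` bounds the energy of an arbitrary function. -/
theorem IsGround.le_energy_add (hW : MemLp W ∞ (volume : Measure X)) {u : GradPair X κ}
    (hu : IsGround S W u) {c : ℝ}
    (hc : ∀ g ∈ S, inner ℂ u.fst g.fst = 0 → c * ‖g.fst‖ ^ 2 ≤ energy W g) {g : GradPair X κ}
    (hg : g ∈ S) :
    c * ‖g.fst‖ ^ 2 ≤ energy W g + (c - energy W u) * ‖inner ℂ u.fst g.fst‖ ^ 2 := by
  set α : ℂ := inner ℂ u.fst g.fst with hα
  set k : GradPair X κ := g - α • u with hk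
  have huu : inner ℂ u.fst u.fst = (1 : ℂ) := by rw [inner_self_fst, hu.2.1]; simp
  have hkS : k ∈ S := Submodule.sub_mem _ hg (Submodule.smul_mem _ _ hu.1)
  have hkf : k.fst = g.fst - α • u.fst := rfl
  have huk : inner ℂ u.fst k.fst = 0 := by
    rw [hkf, inner_sub_right, inner_smul_right, huu, mul_one, sub_self]
  have hgk : g = k + α • u := by rw [hk]; abel
  have hA := ((isEigenpair_iff hW).1 (hu.isEigenpair hW)).2.2
  set A : GradPair X κ →ₗ[ℂ] GradPair X κ := formOp hW (energy W u) with hAdef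
  -- The ground state lies in the kernel of the shifted form, so the form of `g` sees only its
  -- component `k` orthogonal to `u`.
  have h1 : inner ℂ g (A g) = inner ℂ k (A k) := by
    have e1 : A g = A k + α • A u := by rw [hgk, map_add, map_smul]
    rw [e1, inner_add_right, inner_smul_right, hA g hg, mul_zero, add_zero]
    nth_rewrite 1 [hgk]
    have e2 : inner ℂ u (A k) = 0 := by
      rw [hAdef, ← formOp_symm, ← hAdef, ← inner_conj_symm, hA k hkS, map_zero]
    rw [inner_add_left, inner_smul_left, e2, mul_zero, add_zero]
  have h2 := re_inner_formOp_self hW (energy W u) g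
  have h3 := re_inner_formOp_self hW (energy W u) k
  rw [← hAdef, h1, h3] at h2
  have h4 := hc k hkS huk
  have h5 : ‖g.fst‖ ^ 2 = ‖k.fst‖ ^ 2 + ‖α‖ ^ 2 := by
    have e2 : g.fst = k.fst + α • u.fst := by rw [hkf]; abel
    have := norm_add_sq_eq_norm_sq_add_norm_sq_of_inner_eq_zero k.fst (α • u.fst) (𝕜 := ℂ) (by
      rw [inner_smul_right, ← inner_conj_symm, huk]; simp)
    rw [e2, sq, this, norm_smul, hu.2.1]
    ring
  rw [h5] at h2 ⊢
  linarith

theorem continuous_energy (hW : MemLp W ∞ (volume : Measure X)) :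
    Continuous (energy W : GradPair X κ → ℝ) := by
  have h : (energy W : GradPair X κ → ℝ) =
      fun f => ‖f.snd‖ ^ 2 + (inner ℂ f.fst (mulL hW f.fst)).re := by
    ext f
    rw [inner_mulL_self, Complex.ofReal_re, energy]
  rw [h]
  have h1 : Continuous fun f : GradPair X κ => mulL hW f.fst := (mulL hW).continuous.comp continuous_fst
  exact (continuous_snd.norm.pow 2).add (Complex.continuous_re.comp (continuous_fst.inner h1))

end OneBodyBound

/-! ### The one-particle bound summed over the particles -/

section ManyBodyBound

variable {N d : ℕ} {U : Set (Space d)}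

/-- The slice through `z` is an affine copy of the one-particle space, so the chain rule gives its
derivatives. -/
theorem insertFirst_eq_add (hN : 0 < N) (x : Space d) (z : Rest N d) :
    (insertFirst x z : Config N d) = insertFirst 0 z +
      ContinuousLinearMap.single ℝ (fun _ : Fin N => Space d) ⟨0, hN⟩ x := by
  ext j a
  by_cases h : (j : ℕ) ≠ 0
  · have : j ≠ ⟨0, hN⟩ := fun e => h (by rw [e])
    simp [insertFirst, h, Pi.single_eq_of_ne this]
  · have : j = ⟨0, hN⟩ := Fin.ext (by simpa using h)
    subst this
    simp [insertFirst]

/-- The one-particle bound, applied to the first particle. -/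
theorem slice_inequality (hN : 0 < N) {W : Space d → ℝ} (hWc : Continuous W) {B : ℝ}
    (hWB : ∀ x, |W x| ≤ B) {u : OneBody d} (hu1 : ‖u.fst‖ = 1) {c γ : ℝ}
    (hc : ∀ g ∈ H10 (dir d) U,
      c * ‖g.fst‖ ^ 2 ≤ energy W g + γ * ‖inner ℂ u.fst g.fst‖ ^ 2)
    {φ : Config N d → ℂ} (hφ : ContDiff ℝ ((⊤ : ℕ∞) : WithTop ℕ∞) φ) (hφs : HasCompactSupport φ)
    (hφU : tsupport φ ⊆ power N U) :
    c * ∫ y, ‖φ y‖ ^ 2 ≤ (∫ y, ∑ a, ‖fderiv ℝ φ y (configDir N d (⟨0, hN⟩, a))‖ ^ 2) +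
      (∫ y, W (y ⟨0, hN⟩) * ‖φ y‖ ^ 2) + γ * sliceWeight u φ := by
  set o : Fin N := ⟨0, hN⟩ with ho
  have hφm : StronglyMeasurable φ := hφ.continuous.stronglyMeasurable
  have hφ2 : MemLp φ 2 volume := memLp_of_continuous_of_hasCompactSupport hφ.continuous hφs 2
  have i1 : Integrable (fun y => ‖φ y‖ ^ 2) volume :=
    (memLp_two_iff_integrable_sq_norm hφm.aestronglyMeasurable).1 hφ2
  have i2 : Integrable (fun y => ∑ a, ‖fderiv ℝ φ y (configDir N d (o, a))‖ ^ 2) volume := by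
    have hcont : Continuous (fderiv ℝ φ) := hφ.continuous_fderiv (by simp)
    refine Continuous.integrable_of_hasCompactSupport (by fun_prop) ?_
    refine (hφs.fderiv ℝ).mono' fun y hy => subset_tsupport _ fun h => hy ?_
    simp [h]
  have i3 : Integrable (fun y => W (y o) * ‖φ y‖ ^ 2) volume :=
    i1.bdd_mul (c := B) (hWc.comp (by fun_prop)).aestronglyMeasurable
      (Eventually.of_forall fun y => hWB _)
  have i4 : Integrable (fun z => ‖sliceInner u φ z‖ ^ 2) volume :=
    integrable_sliceInner hN hu1 hφm hφ2
  -- Every slice of a test function on `U^N` is a test function on `U`, so the one-particle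
  -- inequality holds for every `z`. For general elements of `H10` slices would be defined only
  -- almost everywhere.
  have key : ∀ z : Rest N d, c * (∫ x, ‖φ (insertFirst x z)‖ ^ 2) ≤
      (∫ x, ∑ a, ‖fderiv ℝ φ (insertFirst x z) (configDir N d (o, a))‖ ^ 2) +
      (∫ x, W (insertFirst x z o) * ‖φ (insertFirst x z)‖ ^ 2) + γ * ‖sliceInner u φ z‖ ^ 2 := by
    intro z
    set L := ContinuousLinearMap.single ℝ (fun _ : Fin N => Space d) o with hL
    set s : Space d → ℂ := fun x => φ (insertFirst x z) with hs
    have hsL : s = fun x => φ (insertFirst 0 z + L x) := by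
      ext x
      simp only [hs]
      rw [insertFirst_eq_add hN x z]
    have hsd : ContDiff ℝ ((⊤ : ℕ∞) : WithTop ℕ∞) s := by
      rw [hsL]; exact hφ.comp (contDiff_const.add L.contDiff)
    have hev : ∀ x, insertFirst x z o = x := fun x => by simp [insertFirst, ho]
    have hsz : ∀ x, x ∉ (fun y : Config N d => y o) '' tsupport φ → s x = 0 := fun x hx =>
      image_eq_zero_of_notMem_tsupport (f := φ) fun h => hx ⟨insertFirst x z, h, hev x⟩
    have himg : IsCompact ((fun y : Config N d => y o) '' tsupport φ) :=
      hφs.isCompact.image (continuous_apply o)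
    have hst : tsupport s ⊆ (fun y : Config N d => y o) '' tsupport φ :=
      closure_minimal (fun x hx => by_contra fun h => hx (hsz x h)) himg.isClosed
    obtain ⟨p, hp, hp1, hp2⟩ := exists_testPair (e := dir d) (U := U) hsd
      (HasCompactSupport.intro himg hsz) (hst.trans (by rintro x ⟨y, hy, rfl⟩; exact hφU hy o))
    have hgrad : ∀ x, ‖grad (dir d) s x‖ ^ 2 =
        ∑ a, ‖fderiv ℝ φ (insertFirst x z) (configDir N d (o, a))‖ ^ 2 := fun x => by
      rw [norm_grad_sq]
      refine Finset.sum_congr rfl fun a _ => ?_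
      have hd : HasFDerivAt s ((fderiv ℝ φ (insertFirst 0 z + L x)).comp L) x := by
        rw [hsL]
        exact ((hφ.differentiable (by simp)) _).hasFDerivAt.comp x (L.hasFDerivAt.const_add _)
      rw [hd.fderiv, insertFirst_eq_add hN x z]
      rfl
    have h := hc p (testPairs_le_H10 hp)
    have e1 : ‖p.fst‖ ^ 2 = ∫ x, ‖s x‖ ^ 2 := by
      rw [norm_sq_eq_integral]
      refine integral_congr_ae ?_
      filter_upwards [hp1] with x hx
      rw [hx]
    have e2 : energy W p = (∫ x, ‖grad (dir d) s x‖ ^ 2) + ∫ x, W x * ‖s x‖ ^ 2 := by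
      rw [energy, norm_sq_eq_integral]
      congr 1
      · refine integral_congr_ae ?_
        filter_upwards [hp2] with x hx
        rw [hx]
      · refine integral_congr_ae ?_
        filter_upwards [hp1] with x hx
        rw [hx]
    have e3 : inner ℂ u.fst p.fst = sliceInner u φ z := by
      rw [L2.inner_def, sliceInner]
      refine integral_congr_ae ?_
      filter_upwards [hp1] with x hx
      rw [hx, RCLike.inner_apply, mul_comm]
    rw [e1, e2, e3] at h
    simp only [hgrad] at h
    simpa only [hev] using h
  have i5 : Integrable (fun z : Rest N d =>
      (∫ x, ∑ a, ‖fderiv ℝ φ (insertFirst x z) (configDir N d (o, a))‖ ^ 2) +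
      ∫ x, W (insertFirst x z o) * ‖φ (insertFirst x z)‖ ^ 2) volume :=
    (integrable_integral_insertFirst hN i2).add (integrable_integral_insertFirst hN i3)
  rw [← integral_insertFirst hN i1, ← integral_insertFirst hN i2, ← integral_insertFirst hN i3,
    sliceWeight, ← integral_const_mul, ← integral_const_mul, ← integral_add
      (integrable_integral_insertFirst hN i2) (integrable_integral_insertFirst hN i3),
    ← integral_add i5 (i4.const_mul _)]
  exact integral_mono ((integrable_integral_insertFirst hN i1).const_mul _)
    (i5.add (i4.const_mul _)) key

theorem integral_permute (σ : Equiv.Perm (Fin N)) (F : Config N d → ℝ) :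
    ∫ y : Config N d, F (fun j => y (σ j)) = ∫ y, F y :=
  (volume_preserving_arrowCongr' σ.symm (MeasurableEquiv.refl (Space d))
    (MeasurePreserving.id _)).integral_comp' F

/-- Permutation of the particles as a homeomorphism. -/
def permuteHomeomorph (N d : ℕ) (σ : Equiv.Perm (Fin N)) : Config N d ≃ₜ Config N d where
  toFun y j := y (σ j)
  invFun y j := y (σ.symm j)
  left_inv y := by ext; simp
  right_inv y := by ext; simp
  continuous_toFun := by fun_prop
  continuous_invFun := by fun_prop

/-- The one-particle bound, applied to the `i`-th particle. -/
theorem slice_inequality_swap (hN : 0 < N) {W : Space d → ℝ} (hWc : Continuous W) {B : ℝ}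
    (hWB : ∀ x, |W x| ≤ B) {u : OneBody d} (hu1 : ‖u.fst‖ = 1) {c γ : ℝ}
    (hc : ∀ g ∈ H10 (dir d) U,
      c * ‖g.fst‖ ^ 2 ≤ energy W g + γ * ‖inner ℂ u.fst g.fst‖ ^ 2)
    {φ : Config N d → ℂ} (hφ : ContDiff ℝ ((⊤ : ℕ∞) : WithTop ℕ∞) φ) (hφs : HasCompactSupport φ)
    (hφU : tsupport φ ⊆ power N U) (i : Fin N) :
    c * ∫ y, ‖φ y‖ ^ 2 ≤ (∫ y, ∑ a, ‖fderiv ℝ φ y (configDir N d (i, a))‖ ^ 2) +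
      (∫ y, W (y i) * ‖φ y‖ ^ 2) +
      γ * sliceWeight u (fun y => φ fun j => y (Equiv.swap ⟨0, hN⟩ i j)) := by
  -- Exchanging the particles `0` and `i` reduces the claim to the first particle; measure, support
  -- condition and gradient transform accordingly.
  set σ : Equiv.Perm (Fin N) := Equiv.swap ⟨0, hN⟩ i with hσ
  set T := permuteHomeomorph N d σ with hT
  set φ' : Config N d → ℂ := fun y => φ fun j => y (σ j) with hφ'
  set P : Config N d →L[ℝ] Config N d :=
    ContinuousLinearMap.pi fun j => ContinuousLinearMap.proj (σ j) with hP
  have hφ'P : φ' = fun y => φ (P y) := rfl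
  have hd : ContDiff ℝ ((⊤ : ℕ∞) : WithTop ℕ∞) φ' := hφ.comp P.contDiff
  have hs : HasCompactSupport φ' := hφs.comp_homeomorph T
  have ht : tsupport φ' ⊆ power N U := by
    have h1 : tsupport φ' ⊆ T ⁻¹' tsupport φ :=
      closure_minimal (fun y hy => subset_tsupport φ hy) ((isClosed_tsupport φ).preimage T.continuous)
    intro y hy j
    have := hφU (h1 hy) (σ j)
    simpa [hT, permuteHomeomorph, hσ] using this
  have h := slice_inequality hN hWc hWB hu1 hc hd hs ht
  have e1 : ∫ y, ‖φ' y‖ ^ 2 = ∫ y, ‖φ y‖ ^ 2 := integral_permute σ fun y => ‖φ y‖ ^ 2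
  have e2 : ∫ y : Config N d, W (y ⟨0, hN⟩) * ‖φ' y‖ ^ 2 = ∫ y, W (y i) * ‖φ y‖ ^ 2 := by
    rw [← integral_permute σ fun y => W (y i) * ‖φ y‖ ^ 2]
    simp [hσ, hφ']
  have e3 : ∫ y, ∑ a, ‖fderiv ℝ φ' y (configDir N d (⟨0, hN⟩, a))‖ ^ 2 =
      ∫ y, ∑ a, ‖fderiv ℝ φ y (configDir N d (i, a))‖ ^ 2 := by
    rw [← integral_permute σ fun y => ∑ a, ‖fderiv ℝ φ y (configDir N d (i, a))‖ ^ 2]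
    refine integral_congr_ae (Eventually.of_forall fun y => Finset.sum_congr rfl fun a _ => ?_)
    have hf : HasFDerivAt φ' ((fderiv ℝ φ (P y)).comp P) y :=
      ((hφ.differentiable (by simp)) _).hasFDerivAt.comp y P.hasFDerivAt
    have hPc : P (configDir N d (⟨0, hN⟩, a)) = configDir N d (i, a) := by
      ext j b
      simp only [hP, ContinuousLinearMap.coe_pi', ContinuousLinearMap.proj_apply, configDir,
        Pi.single_apply]
      have hj : σ j = ⟨0, hN⟩ ↔ j = i := by
        rw [hσ, Equiv.swap_apply_eq_iff, Equiv.swap_apply_left]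
      simp only [hj]
    rw [hf.fderiv, ContinuousLinearMap.comp_apply, hPc]
    rfl
  rwa [e1, e2, e3] at h

/-- The sum of the one-particle bounds for a bosonic wave function. -/
theorem bosonic_bound (hN : 0 < N) {W : Space d → ℝ} (hWc : Continuous W) {B : ℝ}
    (hWB : ∀ x, |W x| ≤ B) {u : OneBody d} (hu1 : ‖u.fst‖ = 1) {c γ : ℝ} (hγ : 0 ≤ γ)
    (hc : ∀ g ∈ H10 (dir d) U,
      c * ‖g.fst‖ ^ 2 ≤ energy W g + γ * ‖inner ℂ u.fst g.fst‖ ^ 2)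
    {Ψ : ManyBody N d} (hΨ : Ψ ∈ (bosonic N U : Submodule ℂ (ManyBody N d))) :
    N * (c * ‖Ψ.fst‖ ^ 2) ≤ energy (fun y : Config N d => ∑ i, W (y i)) Ψ +
      N * (γ * sliceWeight u Ψ.fst) := by
  have hWN : MemLp (fun y : Config N d => ∑ i, W (y i)) ∞ volume := by
    refine memLp_top_of_bound (Continuous.aestronglyMeasurable (by fun_prop)) (∑ _i : Fin N, B)
      (Eventually.of_forall fun y => (norm_sum_le _ _).trans (Finset.sum_le_sum fun i _ => hWB _))
  -- The approximating test functions need not be symmetric, so the slice weights of their permuted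
  -- versions are compared with that of `Ψ` at the price of an error `‖p - Ψ‖²`.
  have htest : ∀ p ∈ testPairs (configDir N d) (power N U), ∀ ε : ℝ, 0 < ε →
      N * (c * ‖p.fst‖ ^ 2) ≤ energy (fun y : Config N d => ∑ i, W (y i)) p +
      N * (γ * ((1 + ε) * sliceWeight u Ψ.fst + (1 + 1 / ε) * ‖p.fst - Ψ.fst‖ ^ 2)) := by
    rintro p ⟨φ, hφ, hφs, hφU, hp1, hp2⟩ ε hε
    have e1 : ‖p.fst‖ ^ 2 = ∫ x, ‖φ x‖ ^ 2 := by
      rw [norm_sq_eq_integral]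
      refine integral_congr_ae ?_
      filter_upwards [hp1] with x hx
      rw [hx]
    have i1 : Integrable (fun x => ‖φ x‖ ^ 2) volume :=
      (integrable_norm_sq p.fst).congr (by filter_upwards [hp1] with x hx; rw [hx])
    have i2 : ∀ i : Fin N, Integrable (fun y => ∑ a, ‖fderiv ℝ φ y (configDir N d (i, a))‖ ^ 2)
        volume := fun i => by
      have hcont : Continuous (fderiv ℝ φ) := hφ.continuous_fderiv (by simp)
      refine Continuous.integrable_of_hasCompactSupport (by fun_prop) ?_
      refine (hφs.fderiv ℝ).mono' fun y hy => subset_tsupport _ fun h => hy ?_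
      simp [h]
    have i3 : ∀ i : Fin N, Integrable (fun y => W (y i) * ‖φ y‖ ^ 2) volume := fun i =>
      i1.bdd_mul (c := B) (hWc.comp (by fun_prop)).aestronglyMeasurable
        (Eventually.of_forall fun y => hWB _)
    have e2 : energy (fun y : Config N d => ∑ i, W (y i)) p =
        ∑ i, ((∫ y, ∑ a, ‖fderiv ℝ φ y (configDir N d (i, a))‖ ^ 2) +
          ∫ y, W (y i) * ‖φ y‖ ^ 2) := by
      rw [Finset.sum_add_distrib, ← integral_finsetSum _ fun i _ => i2 i,
        ← integral_finsetSum _ fun i _ => i3 i, energy, norm_sq_eq_integral]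
      congr 1
      · refine integral_congr_ae ?_
        filter_upwards [hp2] with x hx
        rw [hx, norm_grad_sq, Fintype.sum_prod_type]
      · refine integral_congr_ae ?_
        filter_upwards [hp1] with x hx
        rw [hx, Finset.sum_mul]
    have hw : ∀ i : Fin N, sliceWeight u (fun y => φ fun j => y (Equiv.swap ⟨0, hN⟩ i j)) ≤
        (1 + ε) * sliceWeight u Ψ.fst + (1 + 1 / ε) * ‖p.fst - Ψ.fst‖ ^ 2 := fun i => by
      set σ : Equiv.Perm (Fin N) := Equiv.swap ⟨0, hN⟩ i with hσ
      have hcσ : Continuous fun y : Config N d => φ fun j => y (σ j) :=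
        hφ.continuous.comp (by fun_prop)
      have hsσ : HasCompactSupport fun y : Config N d => φ fun j => y (σ j) :=
        hφs.comp_homeomorph (permuteHomeomorph N d σ)
      refine (sliceWeight_le_add hN hu1 hcσ.stronglyMeasurable
        (memLp_of_continuous_of_hasCompactSupport hcσ hsσ 2) (Lp.stronglyMeasurable Ψ.fst)
        (Lp.memLp Ψ.fst) hε).trans (le_of_eq ?_)
      congr 2
      -- Because `Ψ` is symmetric, a permuted test function is exactly as close to `Ψ` as the
      -- original, so the error does not depend on `i`.
      have h1 : ∫ y : Config N d, ‖φ (fun j => y (σ j)) - Ψ.fst y‖ ^ 2 =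
          ∫ y : Config N d, ‖φ (fun j => y (σ j)) - Ψ.fst (fun j => y (σ j))‖ ^ 2 := by
        refine integral_congr_ae ?_
        filter_upwards [hΨ.2 σ] with y hy
        rw [hy]
      rw [h1, integral_permute σ fun y => ‖φ y - Ψ.fst y‖ ^ 2, norm_sq_eq_integral]
      refine integral_congr_ae ?_
      filter_upwards [hp1, Lp.coeFn_sub p.fst Ψ.fst] with y h2 h3
      rw [h3, Pi.sub_apply, h2]
    rw [e2, e1]
    set R := (1 + ε) * sliceWeight u Ψ.fst + (1 + 1 / ε) * ‖p.fst - Ψ.fst‖ ^ 2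
    have hsum : ∑ _i : Fin N, c * ∫ x, ‖φ x‖ ^ 2 ≤
        ∑ i : Fin N, (((∫ y, ∑ a, ‖fderiv ℝ φ y (configDir N d (i, a))‖ ^ 2) +
          ∫ y, W (y i) * ‖φ y‖ ^ 2) + γ * R) :=
      Finset.sum_le_sum fun i _ => (slice_inequality_swap hN hWc hWB hu1 hc hφ hφs hφU i).trans
        (add_le_add_right (mul_le_mul_of_nonneg_left (hw i) hγ) _)
    rw [Finset.sum_add_distrib] at hsum
    simpa only [Finset.sum_const, Finset.card_univ, Fintype.card_fin, nsmul_eq_mul] using hsum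
  obtain ⟨p, hp, hpΨ⟩ := exists_seq_testPairs hΨ.1
  have l1 : Tendsto (fun n => (p n).fst) atTop (𝓝 Ψ.fst) := (continuous_fst.tendsto Ψ).comp hpΨ
  have l2 := ((continuous_energy hWN).tendsto Ψ).comp hpΨ
  -- The order of limits matters: the factor `1 + 1/ε` is harmless once `‖p - Ψ‖` has gone to zero
  -- at fixed `ε`; only then does `ε → 0`.
  have hε : ∀ ε : ℝ, 0 < ε → N * (c * ‖Ψ.fst‖ ^ 2) ≤
      energy (fun y : Config N d => ∑ i, W (y i)) Ψ +
        N * (γ * ((1 + ε) * sliceWeight u Ψ.fst + (1 + 1 / ε) * 0)) := by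
    intro ε hε
    have l3 : Tendsto (fun n => ‖(p n).fst - Ψ.fst‖ ^ 2) atTop (𝓝 0) := by
      have := (l1.sub_const Ψ.fst).norm.pow 2
      simpa using this
    exact le_of_tendsto_of_tendsto' (((l1.norm.pow 2).const_mul c).const_mul (N : ℝ))
      (l2.add ((((l3.const_mul (1 + 1 / ε)).const_add _).const_mul γ).const_mul (N : ℝ)))
      fun n => htest (p n) (hp n) ε hε
  have hlim : Tendsto (fun ε : ℝ => energy (fun y : Config N d => ∑ i, W (y i)) Ψ +
      N * (γ * ((1 + ε) * sliceWeight u Ψ.fst))) (𝓝[>] 0)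
      (𝓝 (energy (fun y : Config N d => ∑ i, W (y i)) Ψ +
        N * (γ * ((1 + 0) * sliceWeight u Ψ.fst)))) := by
    refine Tendsto.mono_left (Continuous.tendsto ?_ 0) nhdsWithin_le_nhds
    fun_prop
  rw [add_zero, one_mul] at hlim
  refine ge_of_tendsto hlim ?_
  filter_upwards [self_mem_nhdsWithin] with ε h
  simpa using hε ε h

end ManyBodyBound

/-! ### The vacancy set and the conclusion -/

section Vacancy

variable {d : ℕ}

theorem isOpen_box (d : ℕ) (ρ : ℝ) (N : ℕ) : IsOpen (box d ρ N) := by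
  simp only [box, ofPred_forall]
  exact isOpen_iInter_of_finite fun a => isOpen_lt (by fun_prop) continuous_const

theorem isBounded_box (d : ℕ) (ρ : ℝ) (N : ℕ) : Bornology.IsBounded (box d ρ N) := by
  set L := ρ ^ (-(1 / (d : ℝ))) * (N : ℝ) ^ (1 / (d : ℝ)) / 2
  refine isBounded_iff_forall_norm_le.2 ⟨√(∑ _a : Fin d, L ^ 2), fun x hx => ?_⟩
  rw [EuclideanSpace.norm_eq]
  refine Real.sqrt_le_sqrt (Finset.sum_le_sum fun a _ => ?_)
  have := hx a
  rw [Real.norm_eq_abs]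
  gcongr

/-- A ball that meets the bounded box has its centre in a fixed larger ball, so by local finiteness
only finitely many closed balls are removed. -/
theorem isOpen_vacancySet {ρ r : ℝ} {N : ℕ} {S : Set (Space d)}
    (hS : ∀ B : Set (Space d), Bornology.IsBounded B → (S ∩ B).Finite) :
    IsOpen (vacancySet ρ r N S) := by
  obtain ⟨R, hR⟩ := (isBounded_box d ρ N).exists_norm_le
  have h : vacancySet ρ r N S =
      box d ρ N \ ⋃ p ∈ S ∩ Metric.closedBall 0 (R + r), Metric.closedBall p r := by
    ext x
    simp only [vacancySet, Set.mem_sdiff, mem_iUnion, exists_prop, not_exists, not_and, mem_inter_iff]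
    refine and_congr_right fun hx => ⟨fun h p hp => h p hp.1, fun h p hp hxp => h p ⟨hp, ?_⟩ hxp⟩
    rw [mem_closedBall_zero_iff]
    have h1 : ‖p - x‖ ≤ r := by rw [← dist_eq_norm, dist_comm]; exact hxp
    have h2 := hR x hx
    have h3 := norm_add_le (p - x) x
    rw [sub_add_cancel] at h3
    linarith
  rw [h]
  exact (isOpen_box d ρ N).sdiff ((hS _ Metric.isBounded_closedBall).isClosed_biUnion
    fun p _ => Metric.isClosed_closedBall)

end Vacancy

/-! ### Many-body bounds and the main theorem -/

section Conclusion

variable {N d : ℕ} {U K : Set (Space d)} {v : Space d → ℝ}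

theorem exists_abs_meanFieldPotential_le (hv : IsAdmissibleInteraction v) (N : ℕ) (u : OneBody d) :
    ∃ B, ∀ x, |meanFieldPotential N v u x| ≤ B := by
  refine ⟨|(N : ℝ) - 1| * (valueAtZero v * ∫ y, |density u y|) +
    |((N : ℝ) - 1) / 2 * interact v (density u) (density u)|, fun x => ?_⟩
  rw [hv.meanFieldPotential_eq]
  refine (abs_sub _ _).trans (add_le_add_left ?_ _)
  rw [abs_mul]
  gcongr
  exact hv.abs_potential_le (integrable_density u) x

theorem continuous_meanFieldPotential (hv : IsAdmissibleInteraction v) (N : ℕ) (u : OneBody d) :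
    Continuous (meanFieldPotential N v u) := by
  rw [hv.meanFieldPotential_eq]
  exact (continuous_const.mul (hv.continuous_potential (integrable_density u))).sub continuous_const

/-- The pointwise inequality `IsAdmissibleInteraction.pairPotential_ge` integrated against `|Ψ|²`;
the kinetic terms on both sides are equal. -/
theorem energy_le_pairEnergy (hv : IsAdmissibleInteraction v) (hN : 1 ≤ N) (u : OneBody d)
    (Ψ : ManyBody N d) :
    energy (fun y : Config N d => ∑ i, meanFieldPotential N v u (y i)) Ψ ≤
      energy (pairPotential v) Ψ + N * valueAtZero v / 2 * ‖Ψ.fst‖ ^ 2 := by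
  obtain ⟨B, hB⟩ := exists_abs_meanFieldPotential_le hv N u
  have hWc := continuous_meanFieldPotential hv N u
  have hWN : MemLp (fun y : Config N d => ∑ i, meanFieldPotential N v u (y i)) ∞ volume := by
    refine memLp_top_of_bound (Continuous.aestronglyMeasurable (by fun_prop)) (∑ _i : Fin N, B)
      (Eventually.of_forall fun y => (norm_sum_le _ _).trans (Finset.sum_le_sum fun i _ => hB _))
  have i1 := integrable_mul_norm_sq (hv.memLp_pairPotential N) Ψ.fst
  have i2 := (integrable_norm_sq Ψ.fst).const_mul (N * valueAtZero v / 2)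
  rw [energy, energy, norm_sq_eq_integral Ψ.fst, add_assoc, ← integral_const_mul, ← integral_add i1 i2]
  refine add_le_add_right (integral_mono_ae (integrable_mul_norm_sq hWN Ψ.fst) (i1.add i2) ?_) _
  filter_upwards [hv.pairPotential_ge hN u] with y hy
  have := mul_le_mul_of_nonneg_right hy (sq_nonneg ‖Ψ.fst y‖)
  simp only [Pi.add_apply]
  linarith

/-- The lower bound on the energy of a bosonic wave function in terms of its condensate weight. -/
theorem le_pairEnergy (hv : IsAdmissibleInteraction v) (hN : 1 ≤ N) (hUb : Bornology.IsBounded U)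
    {u : OneBody d} (hu : IsGround (H10 (dir d) U) (meanFieldPotential N v u) u)
    (h12 : meanFieldEigenvalue N v U u 1 ≤ meanFieldEigenvalue N v U u 2)
    {Ψ : ManyBody N d} (hΨ : Ψ ∈ (bosonic N U : Submodule ℂ (ManyBody N d))) (hΨ1 : ‖Ψ.fst‖ = 1) :
    N * (meanFieldEigenvalue N v U u 1 - valueAtZero v / 2 +
      (meanFieldEigenvalue N v U u 2 - meanFieldEigenvalue N v U u 1) *
        (1 - sliceWeight u Ψ.fst)) ≤ energy (pairPotential v) Ψ := by
  obtain ⟨B, hB⟩ := exists_abs_meanFieldPotential_le hv N u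
  have hW := hv.memLp_meanFieldPotential N u
  have he1 : meanFieldEigenvalue N v U u 1 = energy (meanFieldPotential N v u) u :=
    hu.eigenvalue_one hW
  have hc : ∀ g ∈ H10 (dir d) U, meanFieldEigenvalue N v U u 2 * ‖g.fst‖ ^ 2 ≤
      energy (meanFieldPotential N v u) g +
        (meanFieldEigenvalue N v U u 2 - meanFieldEigenvalue N v U u 1) *
          ‖inner ℂ u.fst g.fst‖ ^ 2 := fun g hg => by
    rw [he1]
    exact hu.le_energy_add hW (fun g hg hug =>
      hu.eigenvalue_two_le_energy hW isClosed_H10 (compact_H10 hUb) hg hug) hg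
  have h1 := bosonic_bound hN (continuous_meanFieldPotential hv N u) hB hu.2.1
    (sub_nonneg.2 h12) hc hΨ
  have h2 := energy_le_pairEnergy hv hN u Ψ
  rw [hΨ1] at h1 h2
  linarith

/-- The product state gives `E ≤ N e₁`, and `le_pairEnergy` gives the reverse inequality with loss
`N v(0)/2` and gain proportional to the depletion. Dropping the gain yields the energy estimate;
keeping it yields the depletion estimate. -/
theorem many_body_bounds (hv : IsAdmissibleInteraction v) (hN : 1 ≤ N) (hUb : Bornology.IsBounded U)
    {u : OneBody d} (hu : IsGround (H10 (dir d) U) (meanFieldPotential N v u) u)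
    (he : meanFieldEigenvalue N v U u 1 = hartree N v u)
    (h12 : meanFieldEigenvalue N v U u 1 < meanFieldEigenvalue N v U u 2) :
    |groundStateEnergy N v U / N - meanFieldEigenvalue N v U u 1| ≤ valueAtZero v / 2 ∧
      (∃ Ψ : ManyBody N d, IsGroundState v U Ψ) ∧
      ∀ Ψ : ManyBody N d, IsGroundState v U Ψ → 1 - occupation Ψ u / N ≤
        valueAtZero v / 2 *
          (1 / (meanFieldEigenvalue N v U u 2 - meanFieldEigenvalue N v U u 1)) := by
  have hN0 : (0 : ℝ) < N := by exact_mod_cast hN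
  have hv0 := hv.valueAtZero_nonneg
  have hgap := sub_pos.2 h12
  have hup : groundStateEnergy N v U ≤ N * meanFieldEigenvalue N v U u 1 := by
    rw [he]; exact groundStateEnergy_le hv hUb hu.1 hu.2.1
  obtain ⟨Ψ, hΨ⟩ := exists_isGround_bosonic (N := N) hv hUb hu.1 hu.2.1
  have hE := hΨ.groundStateEnergy_eq hv
  refine ⟨?_, ⟨Ψ, ?_, hΨ.2.1⟩, fun Φ hΦ => ?_⟩
  · have h1 := le_pairEnergy hv hN hUb hu h12.le hΨ.1 hΨ.2.1
    have h2 := sliceWeight_le hN hu.2.1 (Lp.stronglyMeasurable Ψ.fst) (Lp.memLp Ψ.fst)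
    rw [← norm_sq_eq_integral, hΨ.2.1, one_pow] at h2
    rw [← hE] at h1
    have h3 := mul_nonneg hgap.le (sub_nonneg.2 h2)
    have h4 : N * (meanFieldEigenvalue N v U u 1 - valueAtZero v / 2) ≤ groundStateEnergy N v U :=
      le_trans (by gcongr; linarith) h1
    rw [mul_comm, ← le_div_iff₀ hN0] at h4
    rw [mul_comm, ← div_le_iff₀ hN0] at hup
    rw [abs_le]
    constructor <;> linarith
  · rw [hE]
    exact hΨ.isEigenpair (hv.memLp_pairPotential N)
  · have h1 := le_pairEnergy hv hN hUb hu h12.le hΦ.1.1 hΦ.2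
    rw [hΦ.1.energy_eq (hv.memLp_pairPotential N), hΦ.2, one_pow, mul_one] at h1
    have h2 := h1.trans hup
    -- After division by `N` the eigenvalue `e₁` cancels, leaving the gap times the depletion
    -- bounded by `v(0)/2`.
    have h3 := le_of_mul_le_mul_left h2 hN0
    rw [occupation_eq hN, mul_div_cancel_left₀ _ hN0.ne', mul_one_div, le_div_iff₀ hgap]
    linarith

end Conclusion

end

end KacLuttinger

theorem mainTheorem2 {Ω : Type*} [MeasurableSpace Ω] (P : Measure Ω) [IsProbabilityMeasure P]
    (d : ℕ) (hd : 2 ≤ d) (ρ r ν : ℝ) (hρ : 0 < ρ) (hr : 0 < r) (hν : 0 < ν)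
    (X : Ω → Set (Space d)) (hX : IsPoissonPointProcess P ν X)
    (N : ℕ) (hN : 1 ≤ N) (v : Space d → ℝ) (hv : IsAdmissibleInteraction v)
    (η : ℝ) (hη : 0 < η) (hη' : η < vacancyFraction d ν r)
    (ω : Ω) (hω : ω ∈ Omega2 X ρ r ν η N v)
    (U : Set (Space d)) (hU : U = vacancySet ρ r N (X ω)) :
    (∃! K, IsGroundComponent U K) ∧
    ∀ K, IsGroundComponent U K →
      (∃ u, IsHartreeMinimizer N v K u) ∧
      ∀ u, IsHartreeMinimizer N v K u →
        meanFieldEigenvalue N v U u 1 = hartree N v u ∧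
        |groundStateEnergy N v U / N - meanFieldEigenvalue N v U u 1| ≤ valueAtZero v / 2 ∧
        0 < meanFieldEigenvalue N v U u 2 - meanFieldEigenvalue N v U u 1 ∧
        (∃ Ψ : ManyBody N d, IsGroundState v U Ψ) ∧
        ∀ Ψ : ManyBody N d, IsGroundState v U Ψ →
          1 - occupation Ψ u / N ≤
            valueAtZero v / 2 *
              (1 / (meanFieldEigenvalue N v U u 2 - meanFieldEigenvalue N v U u 1)) := by
  subst hU
  set U := vacancySet ρ r N (X ω)
  -- The random geometry enters through openness of the vacancy set, by local finiteness of the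
  -- point process, through its boundedness, and through the spectral gap recorded in `hω`.
  have hUo : IsOpen U := isOpen_vacancySet (hX.locallyFinite ω)
  have hUb : Bornology.IsBounded U := (isBounded_box d ρ N).subset Set.sdiff_subset
  have hd1 : 1 ≤ d := by omega
  have hgap := hω.2
  have hgap' : dirichletEigenvalue U 1 < dirichletEigenvalue U 2 := by
    have hl0 := dirichletEigenvalue_one_nonneg U
    have hv1 : 0 ≤ ∫ x, |v x| := integral_nonneg fun _ => abs_nonneg _
    have : 0 ≤ C1 d ^ 2 * N * (∫ x, |v x|) * dirichletEigenvalue U 1 ^ ((d : ℝ) / 2) := by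
      positivity
    linarith
  refine ⟨existsUnique_isGroundComponent hUo hUb hgap', fun K hK => ⟨?_, fun u hu => ?_⟩⟩
  · obtain ⟨w, hwK, hw, -⟩ := hK.exists_ground hd1 hUo hUb hgap'
    obtain ⟨⟨x, -, rfl⟩, -⟩ := hK
    exact exists_isHartreeMinimizer hv hN (hUb.subset (connectedComponentIn_subset U x))
      ⟨w, hwK, ne_zero_of_norm_one hw.2.1⟩
  · obtain ⟨hground, he, h12⟩ := hu.meanField hv hd1 hN hUo hUb hgap hK
    obtain ⟨hE, hex, hocc⟩ := many_body_bounds hv hN hUb hground he h12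
    exact ⟨he, hE, sub_pos.2 h12, hex, hocc⟩
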